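/- Let $n\ge 3$ and $H=\frac{n-1}{n}$. Let $\mathbb H^n$ be the ball model of hyperbolic space, let $\gamma$ be a geodesic through $0$ with signed arc length $\rho$, and let $\mathbb P$ be the totally geodesic hyperplane orthogonal to $\gamma$ at $0$. A curve $C$ in the flat vertical plane $\gamma\times\mathbb R$, with coordinates $(\rho,t)$, generates a translation hypersurface in $\mathbb H^n\times\mathbb R$: each of its points is moved, in its horizontal slice, by the hyperbolic translations along the geodesics of $\mathbb P$ through $0$. For $d<1$ consider the equation $$\dot\mu\,(1+\dot\mu^2)^{-1/2}\cosh^{n-1}(\rho)=nH\,J(\rho)+d,\qquad J(\rho)=\int_0^\rho\cosh^{n-1}(t)\,dt .$$ Let $c_d>0$ be the zero of $\cosh^{n-1}-nHJ-d$ on $[0,\infty)$; let $a_d=0$ if $d\ge-1$, and let $a_d>0$ be the zero of $\cosh^{n-1}+nHJ+d$ if $d<-1$. Then $0\le a_d<c_d$, and $$\mu_d(\rho)=\int_{a_d}^{\rho}\frac{nHJ(t)+d}{\sqrt{\cosh^{2n-2}(t)-(nHJ(t)+d)^2}}\,dt$$ is an integrable expression that defines a continuous function on $[a_d,c_d]$,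 which solves the equation on $(a_d,c_d)$ and satisfies $h_d:=\mu_d(c_d)>0$. Let $C_d$ be the union of the graph of $\mu_d$ over $[a_d,c_d]$ with its images under the group generated by the reflections $\rho\mapsto-\rho$ and $t\mapsto 2h_d-t$ if $0\le d<1$, and by the reflections $t\mapsto -t$ and $t\mapsto 2h_d-t$ if $d<0$. Let $\mathcal T_d$ be the translation hypersurface generated by $C_d$. A profile parametrization of $C_d$ below is a continuous piecewise smooth one; the hypersurface has constant mean curvature $H$ with respect to a smooth unit normal which points upwards wherever the curve runs in the direction of increasing $\rho$. Asymptotic boundaries are taken in $\partial_\infty\mathbb H^n\times\mathbb R$. 1. If $d=0$, $\mathcal T_0$ is a smooth, complete, embedded hypersurface of constant mean curvature $H$; $C_0$ is a compact, simple, smooth closed curve with positive curvature, which is the boundary of a compact strictly convex set. $\mathcal T_0$ is symmetric with respect to the slice $t=h_0$, its parts above and below this slice are smooth vertical graphs over open subsets of $\mathbb H^n$, and it is symmetric with respect to the vertical hyperplane $\mathbb P\times\mathbb R$. Its asymptotic boundary is homeomorphic to $S^{n-2}\times[0,1]$. 2. If $0<d<1$, $\mathcal T_d$ has the same properties, with $h_d$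 in place of $h_0$, except for smoothness: $C_d$ is a compact, simple, piecewise smooth curve bounding a compact strictly convex set, with corners exactly at its points with $\rho=0$; away from the corners it is smooth with positive curvature and generates a smooth immersed hypersurface of constant mean curvature $H$; the hypersurface is embedded topologically, and the two vertical graphs are continuous. $\mathcal T_d$ is not smooth: its set of points on $\mathbb P\times\mathbb R$ is nonempty and consists exactly of those points of $\mathcal T_d$ through which no immersed $C^1$ hypersurface patch contained in $\mathcal T_d$ passes. 3. If $d\le -1$, $C_d$ has a smooth unit speed parametrization by $\mathbb R$, equivariant under a translation of the parameter and the vertical translation by $2h_d$, such that $\mathcal T_d$ is a complete smooth immersed hypersurface of constant mean curvature $H$, with transversal self-intersections. $\mathcal T_d$ is symmetric with respect to all slices $t=kh_d$, $k\in\mathbb Z$, and its asymptotic boundary is homeomorphic to $S^{n-2}\times\mathbb R$. 4. If $-1<d<0$, $\mathcal T_d$ has the same properties except for smoothness: $C_d$ has a piecewise smooth, equivariant parametrization whose corners are exactly at the points with $\rho=0$; away from these it generates a smooth immersed hypersurface of constant mean curvature $H$ with transversal self-intersections; globally the parametrization of the hypersurface is continuous and locally injective, and the hypersurface is complete, with the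 symmetries and the asymptotic boundary of item 3. $\mathcal T_d$ is not smooth, precisely in the sense of item 2 (at its points on $\mathbb P\times\mathbb R$). -/

import Mathlib

open Set Filter Topology MeasureTheory
open scoped ContDiff

namespace TranslationH

noncomputable section

/-! ### The ambient space `ℍⁿ × ℝ` in the ball model -/

/-- The vector space `ℝⁿ × ℝ` that contains `𝔹 × ℝ`; points of `ℍⁿ × ℝ` are the `p` with
`‖p.1‖ < 1`.  The norm of this type is never used as the metric: see `gHat`. -/
abbrev Amb (n : ℕ) : Type := EuclideanSpace ℝ (Fin n) × ℝ

/-- The product metric `4 (1 - |x|²)⁻² |dx|² + dt²` at the point `p`. -/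
def gHat {n : ℕ} (p u v : Amb n) : ℝ :=
  (2 / (1 - ‖p.1‖ ^ 2)) ^ 2 * inner ℝ u.1 v.1 + u.2 * v.2

/-- The Christoffel term `Γ_p(u, v)` of the Levi-Civita connection of `gHat` in the coordinates
`(x, t)`: the metric is conformal to the flat one in `x`, with factor `2 / (1 - |x|²)`, so
`∇_u V = D_u V + Γ_p(u, V)`. -/
def christoffel {n : ℕ} (p u v : Amb n) : Amb n :=
  ((2 / (1 - ‖p.1‖ ^ 2)) •
    (inner ℝ p.1 u.1 • v.1 + inner ℝ p.1 v.1 • u.1 - inner ℝ u.1 v.1 • p.1), 0)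

/-- The hyperbolic translation of the ball along the diameter through `a` that takes `0` to `a`
(Möbius addition `a ⊕ x`). -/
def hypTranslate {n : ℕ} (a x : EuclideanSpace ℝ (Fin n)) : EuclideanSpace ℝ (Fin n) :=
  (1 + 2 * inner ℝ a x + ‖a‖ ^ 2 * ‖x‖ ^ 2)⁻¹ •
    ((1 + 2 * inner ℝ a x + ‖x‖ ^ 2) • a + (1 - ‖a‖ ^ 2) • x)

/-- The asymptotic boundary: the points of `∂_∞ ℍⁿ × ℝ` in the closure of `T`. -/
def asymptoticBoundary {n : ℕ} (T : Set (Amb n)) : Set (Amb n) :=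
  closure T ∩ {p | ‖p.1‖ = 1}

/-- `A` is a vertical graph of class `C^k` over an open subset of `ℍⁿ`. -/
def IsVerticalGraph {n : ℕ} (k : WithTop ℕ∞) (A : Set (Amb n)) : Prop :=
  ∃ (Ω : Set (EuclideanSpace ℝ (Fin n))) (u : EuclideanSpace ℝ (Fin n) → ℝ),
    IsOpen Ω ∧ Ω ⊆ Metric.ball 0 1 ∧ ContDiffOn ℝ k u Ω ∧ A = {p | p.1 ∈ Ω ∧ p.2 = u p.1}

/-! ### Immersed hypersurfaces: mean curvature and completeness -/

/-- `N` is a unit normal of the map `X` at `q`, and the mean curvature (the trace of the second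
fundamental form divided by `n`) of `X` at `q` with respect to `N` is `h`.  The trace is computed
in a frame `b` that is orthonormal for the induced metric. -/
def HasMeanCurvatureAt {n : ℕ} {M : Type*} [NormedAddCommGroup M] [NormedSpace ℝ M]
    (X : M → Amb n) (q : M) (N : Amb n) (h : ℝ) : Prop :=
  gHat (X q) N N = 1 ∧ (∀ v : M, gHat (X q) (fderiv ℝ X q v) N = 0) ∧
  ∃ b : Fin n → M,
    (∀ i j, gHat (X q) (fderiv ℝ X q (b i)) (fderiv ℝ X q (b j)) = if i = j then 1 else 0) ∧
    ∑ i, gHat (X q) (fderiv ℝ (fderiv ℝ X) q (b i) (b i) +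
      christoffel (X q) (fderiv ℝ X q (b i)) (fderiv ℝ X q (b i))) N = n * h

/-- `p` and `q` are joined in `D` by a path whose image under `X` is `C¹` and has length `< ε`
in `ℍⁿ × ℝ`. -/
def JoinedWithin {n : ℕ} {M : Type*} [TopologicalSpace M] (D : Set M) (X : M → Amb n)
    (ε : ℝ) (p q : M) : Prop :=
  ∃ σ : ℝ → M, Continuous σ ∧ (∀ t, σ t ∈ D) ∧ σ 0 = p ∧ σ 1 = q ∧ ContDiff ℝ 1 (X ∘ σ) ∧
    ∫ t in (0 : ℝ)..1, √(gHat (X (σ t)) (deriv (X ∘ σ) t) (deriv (X ∘ σ) t)) < ε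

/-- `D` is complete for the length distance that `X` induces from `ℍⁿ × ℝ`: every Cauchy sequence
converges.  For a subset `T` of `ℍⁿ × ℝ` take `D = T` and `X = id`. -/
def IsInducedComplete {n : ℕ} {M : Type*} [TopologicalSpace M] (D : Set M) (X : M → Amb n) :
    Prop :=
  ∀ u : ℕ → M, (∀ k, u k ∈ D) →
    (∀ ε > 0, ∃ K : ℕ, ∀ k ≥ K, ∀ l ≥ K, JoinedWithin D X ε (u k) (u l)) →
    ∃ q ∈ D, ∀ ε > 0, ∃ K : ℕ, ∀ k ≥ K, JoinedWithin D X ε (u k) q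

/-- Some immersed `C¹` hypersurface patch that is contained in `T` passes through `p`.  The image
of a `C¹` immersion has this property at each of its points. -/
def HasImmersedPatchAt {n : ℕ} (T : Set (Amb n)) (p : Amb n) : Prop :=
  ∃ f : EuclideanSpace ℝ (Fin n) → Amb n, ContDiffAt ℝ 1 f 0 ∧ f 0 = p ∧
    Function.Injective (fderiv ℝ f 0) ∧ ∀ᶠ x in 𝓝 0, f x ∈ T

/-! ### Translation hypersurfaces

`e` is a unit vector; `γ` is the geodesic through `0` in direction `e`, with point
`tanh (ρ / 2) e` at signed distance `ρ` from `0`, and `ℙ` is the totally geodesic hyperplane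
`{a ∈ 𝔹 | a ⟂ e}`.  The vertical plane `𝕍 = γ × ℝ` has the flat coordinates `(ρ, t) ∈ ℝ × ℝ`. -/

/-- The hypersurface generated by a set `C` of points of `𝕍` under the translations with respect
to `ℙ`. -/
def translationHypersurface {n : ℕ} (e : EuclideanSpace ℝ (Fin n)) (C : Set (ℝ × ℝ)) :
    Set (Amb n) :=
  {p | ∃ a : EuclideanSpace ℝ (Fin n), ‖a‖ < 1 ∧ inner ℝ e a = 0 ∧
    ∃ z ∈ C, p = (hypTranslate a (Real.tanh (z.1 / 2) • e), z.2)}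

/-- The parametrization `(a, s) ↦ (τ_a (tanh (ρ(s) / 2) e), t(s))` of the translation hypersurface
generated by the parametrized curve `c = (ρ, t)`, for `a` in the unit ball of `e^⟂`. -/
def translationMap {n : ℕ} (e : EuclideanSpace ℝ (Fin n)) {S : Type*} (c : S → ℝ × ℝ) :
    ↥(ℝ ∙ e)ᗮ × S → Amb n :=
  fun q => (hypTranslate (q.1 : EuclideanSpace ℝ (Fin n)) (Real.tanh ((c q.2).1 / 2) • e),
    (c q.2).2)

/-- The parameter domain `ℙ × (ℝ \ Z)`. -/
def paramDomain {n : ℕ} (e : EuclideanSpace ℝ (Fin n)) (Z : Set ℝ) : Set (↥(ℝ ∙ e)ᗮ × ℝ) :=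
  {q | ‖q.1‖ < 1 ∧ q.2 ∉ Z}

/-- `c` is a continuous, piecewise smooth plane curve that is smooth with unit speed at the
parameters outside `Z` and has a corner (is not differentiable) at each parameter in `Z`. -/
structure IsProfileCurve (Z : Set ℝ) (c : ℝ → ℝ × ℝ) : Prop where
  continuous : Continuous c
  piecewise_smooth : ∀ s, ∃ δ > 0,
    ContDiffOn ℝ ∞ c (Icc (s - δ) s) ∧ ContDiffOn ℝ ∞ c (Icc s (s + δ))
  smooth : ∀ s ∉ Z, ContDiffAt ℝ ∞ c s
  unit_speed : ∀ s ∉ Z, (deriv c s).1 ^ 2 + (deriv c s).2 ^ 2 = 1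
  corner : ∀ s ∈ Z, ¬ DifferentiableAt ℝ c s

/-- Outside the corners `Z`, the hypersurface generated by `c` is a smooth immersed hypersurface
with constant mean curvature `H` for a smooth unit normal, which points upwards where `c` runs in
the direction of increasing `ρ`. -/
def IsImmersedHHypersurface {n : ℕ} (e : EuclideanSpace ℝ (Fin n)) (c : ℝ → ℝ × ℝ) (Z : Set ℝ)
    (H : ℝ) : Prop :=
  ContDiffOn ℝ ∞ (translationMap e c) (paramDomain e Z) ∧
  (∀ q ∈ paramDomain e Z, Function.Injective (fderiv ℝ (translationMap e c) q)) ∧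
  ∃ N : ↥(ℝ ∙ e)ᗮ × ℝ → Amb n, ContDiffOn ℝ ∞ N (paramDomain e Z) ∧
    ∀ q ∈ paramDomain e Z, HasMeanCurvatureAt (translationMap e c) q (N q) H ∧
      (0 < (deriv c q.2).1 → 0 < (N q).2)

/-! ### The generating curves -/

/-- `J_m(r) = ∫₀ʳ cosh^m`. -/
def J (m : ℕ) (r : ℝ) : ℝ := ∫ t in (0 : ℝ)..r, Real.cosh t ^ m

/-- `R_{H,d}`. -/
def R (n : ℕ) (H d t : ℝ) : ℝ := Real.cosh t ^ (n - 1) - n * H * J (n - 1) t - d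

/-- `S_{H,d}`. -/
def S (n : ℕ) (H d t : ℝ) : ℝ := Real.cosh t ^ (n - 1) + n * H * J (n - 1) t + d

/-- `T_{H,d}`, the slope of the generating curve. -/
def slope (n : ℕ) (H d t : ℝ) : ℝ := (n * H * J (n - 1) t + d) / √(R n H d t * S n H d t)

/-- The left end of the interval of definition: `0` if `d ≥ -1`, the zero of `S_{H,d}` if
`d < -1`. -/
def leftEnd (n : ℕ) (H d : ℝ) : ℝ := sInf {t | 0 ≤ t ∧ 0 ≤ S n H d t}

/-- The right end of the interval of definition: the zero of `R_{H,d}`. -/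
def rightEnd (n : ℕ) (H d : ℝ) : ℝ := sSup {t | 0 ≤ t ∧ 0 ≤ R n H d t}

/-- The height function `μ_{H,d}`, normalized by `μ = 0` at the left end. -/
def mu (n : ℕ) (H d ρ : ℝ) : ℝ := ∫ t in leftEnd n H d..ρ, slope n H d t

/-- The height `μ_{H,d}` at the right end, where the generating curve is vertical. -/
def halfHeight (n : ℕ) (H d : ℝ) : ℝ := mu n H d (rightEnd n H d)

/-- For `0 ≤ d`: the graph of `μ` together with its images under the reflections `ρ ↦ -ρ` and
`t ↦ 2 h - t`, `h = halfHeight`. -/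
def closedCurve (n : ℕ) (H d : ℝ) : Set (ℝ × ℝ) :=
  {z | |z.1| ∈ Icc (leftEnd n H d) (rightEnd n H d) ∧
    (z.2 = mu n H d |z.1| ∨ z.2 = 2 * halfHeight n H d - mu n H d |z.1|)}

/-- For `d < 0`: the graph of `μ` together with its images under the group generated by the
reflections `t ↦ -t` and `t ↦ 2 h - t`, `h = halfHeight`. -/
def periodicCurve (n : ℕ) (H d : ℝ) : Set (ℝ × ℝ) :=
  {z | z.1 ∈ Icc (leftEnd n H d) (rightEnd n H d) ∧
    ∃ k : ℤ, z.2 = 2 * k * halfHeight n H d + mu n H d z.1 ∨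
      z.2 = 2 * k * halfHeight n H d - mu n H d z.1}

open Classical in
/-- The complete generating curve of the translation `H`-hypersurface `𝒯_d`. -/
def generatingCurve (n : ℕ) (H d : ℝ) : Set (ℝ × ℝ) :=
  if 0 ≤ d then closedCurve n H d else periodicCurve n H d

/-- The graph of `μ_{H,d}` exists on the interval `[leftEnd, rightEnd]` and solves the equation
of translation `H`-hypersurfaces with flux constant `d`. -/
structure IsGeneratingSolution (n : ℕ) (H d : ℝ) : Prop where
  left_nonneg : 0 ≤ leftEnd n H d
  left_lt_right : leftEnd n H d < rightEnd n H d
  left_eq_zero : -1 ≤ d → leftEnd n H d = 0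
  left_zero : d < -1 → 0 < leftEnd n H d ∧ S n H d (leftEnd n H d) = 0
  right_zero : R n H d (rightEnd n H d) = 0
  pos : ∀ t ∈ Ioo (leftEnd n H d) (rightEnd n H d), 0 < R n H d t ∧ 0 < S n H d t
  integrable : IntervalIntegrable (slope n H d) volume (leftEnd n H d) (rightEnd n H d)
  continuousOn : ContinuousOn (mu n H d) (Icc (leftEnd n H d) (rightEnd n H d))
  equation : ∀ ρ ∈ Ioo (leftEnd n H d) (rightEnd n H d),
    DifferentiableAt ℝ (mu n H d) ρ ∧
    deriv (mu n H d) ρ / √(1 + deriv (mu n H d) ρ ^ 2) * Real.cosh ρ ^ (n - 1)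
      = n * H * J (n - 1) ρ + d
  height_pos : 0 < halfHeight n H d

/-! ### The two types of hypersurfaces -/

/-- The hypersurface generated by `C` is complete and embedded, with constant mean curvature `H`;
`C` is a compact, simple, strictly convex curve, parametrized by `c` with period `L` and with
corners at the parameters in `Z`.  The hypersurface is symmetric with respect to the horizontal
slice `t = h` and consists, above and below it, of vertical graphs of class `C^k`; it is symmetric
with respect to the vertical hyperplane `ℙ × ℝ`; its asymptotic boundary is a compact cylinder. -/
structure IsConvexClosedType {n : ℕ} (e : EuclideanSpace ℝ (Fin n)) (C : Set (ℝ × ℝ))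
    (H h : ℝ) (k : WithTop ℕ∞) (c : ℝ → ℝ × ℝ) (L : ℝ) (hc : Function.Periodic c L)
    (Z : Set ℝ) : Prop where
  period_pos : 0 < L
  profile : IsProfileCurve Z c
  range_eq : range c = C
  simple : InjOn c (Ico 0 L)
  strictlyConvex : ∃ K : Set (ℝ × ℝ),
    IsCompact K ∧ (interior K).Nonempty ∧ StrictConvex ℝ K ∧ frontier K = C
  curvature_pos : ∀ s ∉ Z, 0 < (deriv c s).1 * (deriv (deriv c) s).2
    - (deriv c s).2 * (deriv (deriv c) s).1
  immersed : IsImmersedHHypersurface e c Z H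
  embedded : IsEmbedding (fun q : ↥(Metric.ball (0 : ↥(ℝ ∙ e)ᗮ) 1) × AddCircle L =>
    translationMap e hc.lift ((q.1 : ↥(ℝ ∙ e)ᗮ), q.2))
  complete : IsInducedComplete (translationHypersurface e C) id
  horizontal_symmetry : ∀ x t,
    (x, t) ∈ translationHypersurface e C ↔ (x, 2 * h - t) ∈ translationHypersurface e C
  graph_below : IsVerticalGraph k (translationHypersurface e C ∩ {p | p.2 < h})
  graph_above : IsVerticalGraph k (translationHypersurface e C ∩ {p | h < p.2})
  vertical_symmetry : ∀ x t, (x, t) ∈ translationHypersurface e C ↔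
    (x - (2 * inner ℝ e x) • e, t) ∈ translationHypersurface e C
  asymptotic_cylinder : Nonempty (↥(asymptoticBoundary (translationHypersurface e C)) ≃ₜ
    ↥(Metric.sphere (0 : EuclideanSpace ℝ (Fin (n - 1))) 1) × ↥(Icc (0 : ℝ) 1))

/-- The hypersurface generated by `C` is a complete immersed hypersurface with constant mean
curvature `H`, with corners at the parameters in `Z`; the generating curve is parametrized by `c`
and invariant under the vertical translation by `2 h`; the hypersurface has transversal
self-intersections, is symmetric with respect to the slices `t = k h`, and its asymptotic boundary
is an infinite cylinder. -/
structure IsPeriodicType {n : ℕ} (e : EuclideanSpace ℝ (Fin n)) (C : Set (ℝ × ℝ))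
    (H h : ℝ) (c : ℝ → ℝ × ℝ) (Z : Set ℝ) : Prop where
  profile : IsProfileCurve Z c
  range_eq : range c = C
  periodic : ∃ L > 0, ∀ s, c (s + L) = c s + (0, 2 * h)
  immersed : IsImmersedHHypersurface e c Z H
  locally_injective : ∀ q ∈ paramDomain e ∅, ∃ U ∈ 𝓝 q, InjOn (translationMap e c) U
  complete : IsInducedComplete (paramDomain e ∅) (translationMap e c)
  self_intersection : ∃ q ∈ paramDomain e Z, ∃ q' ∈ paramDomain e Z,
    translationMap e c q = translationMap e c q' ∧
    (fderiv ℝ (translationMap e c) q).range ≠ (fderiv ℝ (translationMap e c) q').range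
  horizontal_symmetries : ∀ (k : ℤ) x t,
    (x, t) ∈ translationHypersurface e C ↔ (x, 2 * (k * h) - t) ∈ translationHypersurface e C
  asymptotic_cylinder : Nonempty (↥(asymptoticBoundary (translationHypersurface e C)) ≃ₜ
    ↥(Metric.sphere (0 : EuclideanSpace ℝ (Fin (n - 1))) 1) × ℝ)

/-- `T` is not a smooth hypersurface, not even an immersed one of class `C¹`: it fails to be so at
its points on the vertical hyperplane `ℙ × ℝ`, which exist, and only there. -/
def IsSingularAlong {n : ℕ} (e : EuclideanSpace ℝ (Fin n)) (T : Set (Amb n)) : Prop :=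
  (∃ p ∈ T, inner ℝ e p.1 = 0) ∧ ∀ p ∈ T, (¬ HasImmersedPatchAt T p ↔ inner ℝ e p.1 = 0)

end

end TranslationH

open TranslationH

/-! Fermi coordinates with respect to `ℙ` reduce the geometry to plane curves, and the tangent angle
replaces the singular integral `mu` by a smooth, globally defined curve.

In Fermi coordinates `(a, ρ, t)` the metric is `cosh² ρ · g_ℙ + dρ² + dt²` (`gHat_fderiv_fermiMap`).
The hypersurface generated by a unit speed curve `(ρ, t)` of curvature `κ` therefore has the
principal curvatures `κ` and, `m = n - 1` times, `t' tanh ρ`. Since `n H = m`, the equation to solve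
is `κ = m (1 - t' tanh ρ)`. Its right side is positive because `|t' tanh ρ| < 1`, so the tangent
angle `θ` serves as parameter along every solution. A first integral is `flux m θ ρ = cosh^m ρ sin θ
- m J(ρ) = d`. For fixed `θ` it is a strictly decreasing bijection of the line (here `n ≥ 3` is
needed), so `ρ` is a smooth function `profileDist m d` of `θ ∈ ℝ`, and `ds = arcDensity dθ`, `dρ =
cos θ ds`, `dt = sin θ ds`. The curve passes smoothly through `θ = π / 2`, where the graph of `mu`
becomes vertical; that graph is the piece `arcsin d ≤ θ ≤ π / 2` (`mu_profileDist`). Since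
`Real.arcsin` is clamped to `-π / 2` for `d ≤ -1`, all `d < 1` are treated alike. The symmetry `θ ↦
π - θ` is the reflection `t ↦ 2 h - t`, so the angles from `arcsin d` to `π - arcsin d` give an arc
that joins two points over the left end.

The generating curve is glued from copies of this arc by powers of `z ↦ ε z + (0, 2 h)`: a vertical
translation (`ε = 1`) for `d < 0`, a point reflection (`ε = -1`) for `d ≥ 0`. Unlike a single
reflection these motions preserve orientation, hence the signed equation for `κ`. With `α = arcsin
d` the end velocities are `(cos α, sin α)` and `(-cos α, sin α)`; they fit together exactly if `d =
0` or `d ≤ -1`, where the curve is one smooth arc (`genCurve_zero`, `genCurve_of_le`). Otherwise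
every joint is a corner on `ρ = 0`.

For `d ≥ 0` the slope `tan θ` grows with `ρ`, which gives convexity. For `d < 0` the height first
falls below zero but ends at `h > 0` (`height_arcsin_lt`), so the arc crosses its mirror image in `t
= 0` transversally. Completeness combines convergence in the ambient space
(`exists_tendsto_of_joinedWithin`) with closedness of the curve or with control of its parameter
(`exists_separation`). At a corner, an immersed patch would contain a differentiable curve with
stationary foot point and nonzero velocity, whose trace in the profile curve cannot exist
(`not_hasImmersedPatchAt`). -/

namespace TranslationH

noncomputable section

/-! ### Fermi coordinates with respect to `ℙ` -/

/-- The point at signed distance `r` from `ℙ` on the geodesic that meets `ℙ` orthogonally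
at `a`. -/
def fermi {n : ℕ} (e a : EuclideanSpace ℝ (Fin n)) (r : ℝ) : EuclideanSpace ℝ (Fin n) :=
  ((1 + ‖a‖ ^ 2) * Real.cosh r + (1 - ‖a‖ ^ 2))⁻¹ •
    ((2 * Real.cosh r) • a + ((1 - ‖a‖ ^ 2) * Real.sinh r) • e)

variable {n : ℕ} {e : EuclideanSpace ℝ (Fin n)}

theorem fermi_denom_pos (a : EuclideanSpace ℝ (Fin n)) (r : ℝ) :
    0 < (1 + ‖a‖ ^ 2) * Real.cosh r + (1 - ‖a‖ ^ 2) := by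
  have := Real.one_le_cosh r
  nlinarith [sq_nonneg ‖a‖, mul_nonneg (sq_nonneg ‖a‖) (sub_nonneg.2 this)]

theorem inner_orthogonal (a : ↥(ℝ ∙ e)ᗮ) : inner ℝ e (a : EuclideanSpace ℝ (Fin n)) = 0 :=
  Submodule.mem_orthogonal_singleton_iff_inner_right.1 a.2

theorem inner_orthogonal' (a : ↥(ℝ ∙ e)ᗮ) : inner ℝ (a : EuclideanSpace ℝ (Fin n)) e = 0 := by
  rw [real_inner_comm]; exact inner_orthogonal a

/-- Half-angle formulas for `cosh r` and `sinh r` turn the Möbius denominator into that of `fermi`.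
-/
theorem hypTranslate_tanh_half {a : EuclideanSpace ℝ (Fin n)} (he : ‖e‖ = 1)
    (ha : inner ℝ e a = 0) (r : ℝ) : hypTranslate a (Real.tanh (r / 2) • e) = fermi e a r := by
  have hC := Real.cosh_pos (r / 2)
  have hc : Real.cosh r = 2 * Real.cosh (r / 2) ^ 2 - 1 := by
    have := Real.cosh_two_mul (r / 2); have h2 := Real.cosh_sq (r / 2)
    rw [show 2 * (r / 2) = r by ring] at this; linarith
  have hs : Real.sinh r = 2 * Real.sinh (r / 2) * Real.cosh (r / 2) := by
    have := Real.sinh_two_mul (r / 2)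
    rwa [show 2 * (r / 2) = r by ring] at this
  have hS : Real.sinh (r / 2) ^ 2 = Real.cosh (r / 2) ^ 2 - 1 := by
    have := Real.cosh_sq (r / 2); linarith
  have hD := fermi_denom_pos a r
  have ha' : inner ℝ a e = 0 := by rw [real_inner_comm]; exact ha
  have hn : ‖Real.tanh (r / 2) • e‖ ^ 2 = Real.tanh (r / 2) ^ 2 := by
    rw [norm_smul, he, mul_one, Real.norm_eq_abs, sq_abs]
  unfold hypTranslate fermi
  rw [inner_smul_right, ha', hn, mul_zero, mul_zero, add_zero]
  have ht : Real.tanh (r / 2) = Real.sinh (r / 2) / Real.cosh (r / 2) :=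
    Real.tanh_eq_sinh_div_cosh _
  have hT : Real.tanh (r / 2) ^ 2 = (Real.cosh (r / 2) ^ 2 - 1) / Real.cosh (r / 2) ^ 2 := by
    rw [ht, div_pow, hS]
  have hden : 1 + ‖a‖ ^ 2 * Real.tanh (r / 2) ^ 2 =
      ((1 + ‖a‖ ^ 2) * Real.cosh r + (1 - ‖a‖ ^ 2)) / (2 * Real.cosh (r / 2) ^ 2) := by
    rw [hT, hc]; field_simp; ring
  rw [hden, inv_div]
  simp only [smul_add, smul_smul]
  congr 1
  · congr 1
    rw [hT, div_mul_eq_mul_div, inv_mul_eq_div]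
    congr 1
    rw [hc]; field_simp; ring
  · congr 1
    rw [div_mul_eq_mul_div, inv_mul_eq_div]
    congr 1
    rw [ht, hs]; field_simp

theorem one_sub_norm_fermi_sq {a : EuclideanSpace ℝ (Fin n)} (he : ‖e‖ = 1)
    (ha : inner ℝ e a = 0) (r : ℝ) : 1 - ‖fermi e a r‖ ^ 2 =
      2 * (1 - ‖a‖ ^ 2) / ((1 + ‖a‖ ^ 2) * Real.cosh r + (1 - ‖a‖ ^ 2)) := by
  have hD := fermi_denom_pos a r
  have ha' : inner ℝ a e = 0 := by rw [real_inner_comm]; exact ha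
  have hN : ‖(2 * Real.cosh r) • a + ((1 - ‖a‖ ^ 2) * Real.sinh r) • e‖ ^ 2 =
      4 * Real.cosh r ^ 2 * ‖a‖ ^ 2 + (1 - ‖a‖ ^ 2) ^ 2 * (Real.cosh r ^ 2 - 1) := by
    rw [norm_add_sq_real, inner_smul_left, inner_smul_right, ha', norm_smul, norm_smul, he,
      Real.norm_eq_abs, Real.norm_eq_abs, mul_pow, mul_pow, sq_abs, sq_abs, mul_pow,
      mul_pow, Real.cosh_sq r]
    simp only [conj_trivial, mul_zero, add_zero]; ring
  rw [fermi, norm_smul, mul_pow, hN, norm_inv, Real.norm_eq_abs, abs_of_pos hD]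
  field_simp
  ring

theorem inner_fermi {a : EuclideanSpace ℝ (Fin n)} (he : ‖e‖ = 1)
    (ha : inner ℝ e a = 0) (r : ℝ) : inner ℝ e (fermi e a r) =
      (1 - ‖a‖ ^ 2) * Real.sinh r / ((1 + ‖a‖ ^ 2) * Real.cosh r + (1 - ‖a‖ ^ 2)) := by
  rw [fermi, inner_smul_right, inner_add_right, inner_smul_right, inner_smul_right, ha,
    real_inner_self_eq_norm_sq, he]
  field_simp; ring

theorem norm_fermi_lt {a : EuclideanSpace ℝ (Fin n)} (he : ‖e‖ = 1)
    (ha : inner ℝ e a = 0) (hw : ‖a‖ < 1) (r : ℝ) : ‖fermi e a r‖ < 1 := by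
  have hD := fermi_denom_pos a r
  have h1 : 0 < 1 - ‖a‖ ^ 2 := by nlinarith [norm_nonneg a]
  have h := one_sub_norm_fermi_sq he ha r
  have h2 : 0 < 1 - ‖fermi e a r‖ ^ 2 := by rw [h]; positivity
  nlinarith [norm_nonneg (fermi e a r)]

/-- `fermi` stays smooth across the ideal boundary of `ℙ`, where the distance `r` no longer matters.
This makes the asymptotic boundary accessible to a compactness argument. -/
theorem fermi_of_norm_eq_one {a : EuclideanSpace ℝ (Fin n)} (ha : ‖a‖ = 1) (r : ℝ) :
    fermi e a r = a := by
  have := Real.cosh_pos r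
  rw [fermi, ha]
  simp only [one_pow, sub_self, zero_mul, zero_smul, add_zero, smul_smul]
  rw [show ((1 + 1) * Real.cosh r)⁻¹ * (2 * Real.cosh r) = 1 by field_simp; norm_num, one_smul]

/-- The signed distance of `x` from `ℙ`. -/
def signedDist (e x : EuclideanSpace ℝ (Fin n)) : ℝ :=
  Real.arsinh (2 * inner ℝ e x / (1 - ‖x‖ ^ 2))

/-- The foot point on `ℙ` of `x`. -/
def footPoint (e x : EuclideanSpace ℝ (Fin n)) : EuclideanSpace ℝ (Fin n) :=
  (Real.cosh (signedDist e x) * (1 - ‖x‖ ^ 2) + (1 + ‖x‖ ^ 2))⁻¹ •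
    (2 : ℝ) • (x - inner ℝ e x • e)

theorem signedDist_fermi {a : EuclideanSpace ℝ (Fin n)} (he : ‖e‖ = 1)
    (ha : inner ℝ e a = 0) (hw : ‖a‖ < 1) (r : ℝ) : signedDist e (fermi e a r) = r := by
  have hD := fermi_denom_pos a r
  have h1 : 0 < 1 - ‖a‖ ^ 2 := by nlinarith [norm_nonneg a]
  rw [signedDist, one_sub_norm_fermi_sq he ha, inner_fermi he ha]
  convert Real.arsinh_sinh r using 2
  field_simp

theorem footPoint_fermi {a : EuclideanSpace ℝ (Fin n)} (he : ‖e‖ = 1)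
    (ha : inner ℝ e a = 0) (hw : ‖a‖ < 1) (r : ℝ) : footPoint e (fermi e a r) = a := by
  have hD := fermi_denom_pos a r
  have hc := Real.cosh_pos r
  have h1 : 0 < 1 - ‖a‖ ^ 2 := by nlinarith [norm_nonneg a]
  have h2 : 1 + ‖fermi e a r‖ ^ 2 = 2 - (1 - ‖fermi e a r‖ ^ 2) := by ring
  rw [footPoint, signedDist_fermi he ha hw, h2, one_sub_norm_fermi_sq he ha, inner_fermi he ha]
  have h3 : fermi e a r - ((1 - ‖a‖ ^ 2) * Real.sinh r /
      ((1 + ‖a‖ ^ 2) * Real.cosh r + (1 - ‖a‖ ^ 2))) • e =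
      (2 * Real.cosh r / ((1 + ‖a‖ ^ 2) * Real.cosh r + (1 - ‖a‖ ^ 2))) • a := by
    rw [fermi]
    simp only [smul_add, smul_smul]
    rw [add_sub_assoc, ← sub_smul]
    rw [show ((1 + ‖a‖ ^ 2) * Real.cosh r + (1 - ‖a‖ ^ 2))⁻¹ * ((1 - ‖a‖ ^ 2) * Real.sinh r) -
      (1 - ‖a‖ ^ 2) * Real.sinh r / ((1 + ‖a‖ ^ 2) * Real.cosh r + (1 - ‖a‖ ^ 2)) = 0 by ring,
      zero_smul, add_zero]
    congr 1; ring
  rw [h3, smul_smul, smul_smul]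
  convert one_smul ℝ a using 2
  have h4 : Real.cosh r * (2 * (1 - ‖a‖ ^ 2) / ((1 + ‖a‖ ^ 2) * Real.cosh r + (1 - ‖a‖ ^ 2))) +
      (2 - 2 * (1 - ‖a‖ ^ 2) / ((1 + ‖a‖ ^ 2) * Real.cosh r + (1 - ‖a‖ ^ 2))) =
      4 * Real.cosh r / ((1 + ‖a‖ ^ 2) * Real.cosh r + (1 - ‖a‖ ^ 2)) := by
    field_simp; ring
  rw [h4]
  field_simp; norm_num

theorem inner_footPoint (he : ‖e‖ = 1) (x : EuclideanSpace ℝ (Fin n)) :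
    inner ℝ e (footPoint e x) = 0 := by
  rw [footPoint, inner_smul_right, inner_smul_right, inner_sub_right, inner_smul_right,
    real_inner_self_eq_norm_sq, he]
  ring

theorem cosh_signedDist_sq {x : EuclideanSpace ℝ (Fin n)} :
    Real.cosh (signedDist e x) ^ 2 = 1 + (2 * inner ℝ e x / (1 - ‖x‖ ^ 2)) ^ 2 := by
  rw [Real.cosh_sq, signedDist, Real.sinh_arsinh, add_comm]

theorem one_sub_norm_footPoint_sq (he : ‖e‖ = 1) {x : EuclideanSpace ℝ (Fin n)}
    (hx : ‖x‖ < 1) : 1 - ‖footPoint e x‖ ^ 2 =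
      2 * Real.cosh (signedDist e x) * (1 - ‖x‖ ^ 2) /
      (Real.cosh (signedDist e x) * (1 - ‖x‖ ^ 2) + (1 + ‖x‖ ^ 2)) := by
  have h1 : 0 < 1 - ‖x‖ ^ 2 := by nlinarith [norm_nonneg x]
  have hc := Real.cosh_pos (signedDist e x)
  have hD : 0 < Real.cosh (signedDist e x) * (1 - ‖x‖ ^ 2) + (1 + ‖x‖ ^ 2) := by positivity
  have hN : ‖x - inner ℝ e x • e‖ ^ 2 = ‖x‖ ^ 2 - inner ℝ e x ^ 2 := by
    rw [norm_sub_sq_real, inner_smul_right, norm_smul, he, Real.norm_eq_abs, mul_one, sq_abs,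
      real_inner_comm]; ring
  have hcs : (Real.cosh (signedDist e x) * (1 - ‖x‖ ^ 2)) ^ 2 =
      (1 - ‖x‖ ^ 2) ^ 2 + 4 * inner ℝ e x ^ 2 := by
    rw [mul_pow, cosh_signedDist_sq]; field_simp; ring
  rw [footPoint, norm_smul, norm_smul, mul_pow, mul_pow, hN, norm_inv, Real.norm_eq_abs,
    abs_of_pos hD, eq_div_iff hD.ne']
  field_simp
  rw [Real.norm_ofNat]
  linear_combination -hcs

theorem norm_footPoint_lt (he : ‖e‖ = 1) {x : EuclideanSpace ℝ (Fin n)}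
    (hx : ‖x‖ < 1) : ‖footPoint e x‖ < 1 := by
  have h1 : 0 < 1 - ‖x‖ ^ 2 := by nlinarith [norm_nonneg x]
  have hc := Real.cosh_pos (signedDist e x)
  have h := one_sub_norm_footPoint_sq he hx
  have h2 : 0 < 1 - ‖footPoint e x‖ ^ 2 := by rw [h]; positivity
  nlinarith [norm_nonneg (footPoint e x)]

theorem fermi_footPoint (he : ‖e‖ = 1) {x : EuclideanSpace ℝ (Fin n)} (hx : ‖x‖ < 1) :
    fermi e (footPoint e x) (signedDist e x) = x := by
  have h1 : 0 < 1 - ‖x‖ ^ 2 := by nlinarith [norm_nonneg x]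
  have hc := Real.cosh_pos (signedDist e x)
  have hD : 0 < Real.cosh (signedDist e x) * (1 - ‖x‖ ^ 2) + (1 + ‖x‖ ^ 2) := by positivity
  have hw := one_sub_norm_footPoint_sq he hx
  have hs : Real.sinh (signedDist e x) = 2 * inner ℝ e x / (1 - ‖x‖ ^ 2) := by
    rw [signedDist, Real.sinh_arsinh]
  have h2 : 1 + ‖footPoint e x‖ ^ 2 = 2 - (1 - ‖footPoint e x‖ ^ 2) := by ring
  have h3 : (2 - (1 - ‖footPoint e x‖ ^ 2)) * Real.cosh (signedDist e x) +
      (1 - ‖footPoint e x‖ ^ 2) = 4 * Real.cosh (signedDist e x) /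
      (Real.cosh (signedDist e x) * (1 - ‖x‖ ^ 2) + (1 + ‖x‖ ^ 2)) := by
    rw [hw]; field_simp; ring
  rw [fermi, h2, h3, hw, hs, footPoint, smul_add, smul_smul, smul_smul, smul_smul, smul_sub,
    smul_smul, smul_smul, sub_add_eq_add_sub, add_sub_assoc, ← sub_smul]
  have h4 : (4 * Real.cosh (signedDist e x) / (Real.cosh (signedDist e x) * (1 - ‖x‖ ^ 2) +
      (1 + ‖x‖ ^ 2)))⁻¹ * (2 * Real.cosh (signedDist e x)) *
      (Real.cosh (signedDist e x) * (1 - ‖x‖ ^ 2) + (1 + ‖x‖ ^ 2))⁻¹ * 2 = 1 := by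
    field_simp; norm_num
  rw [h4, one_smul]
  convert add_zero x using 2
  convert zero_smul ℝ e using 2
  field_simp; ring

end

end TranslationH

/-! ### Fermi coordinates as a smooth map, and the product metric in them. -/

namespace TranslationH

noncomputable section

variable {n : ℕ} {e : EuclideanSpace ℝ (Fin n)}

/-- Fermi coordinates `(a, (ρ, t))` on `ℍⁿ × ℝ`. -/
def fermiMap (e : EuclideanSpace ℝ (Fin n)) (q : ↥(ℝ ∙ e)ᗮ × (ℝ × ℝ)) : Amb n :=
  (fermi e q.1 q.2.1, q.2.2)

theorem translationMap_eq (he : ‖e‖ = 1) {S : Type*} (c : S → ℝ × ℝ) (q : ↥(ℝ ∙ e)ᗮ × S) :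
    translationMap e c q = fermiMap e (q.1, c q.2) := by
  rw [translationMap, fermiMap, hypTranslate_tanh_half he (inner_orthogonal q.1)]

theorem contDiff_fermi : ContDiff ℝ ∞
    (fun q : EuclideanSpace ℝ (Fin n) × ℝ => fermi e q.1 q.2) := by
  have h1 : ContDiff ℝ ∞ (fun q : EuclideanSpace ℝ (Fin n) × ℝ => q.1) := contDiff_fst
  have h : ContDiff ℝ ∞ (fun q : EuclideanSpace ℝ (Fin n) × ℝ => ‖q.1‖ ^ 2) := h1.norm_sq ℝ
  have hc : ContDiff ℝ ∞ (fun q : EuclideanSpace ℝ (Fin n) × ℝ => Real.cosh q.2) :=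
    Real.contDiff_cosh.comp contDiff_snd
  have hs : ContDiff ℝ ∞ (fun q : EuclideanSpace ℝ (Fin n) × ℝ => Real.sinh q.2) :=
    Real.contDiff_sinh.comp contDiff_snd
  have hD : ContDiff ℝ ∞ (fun q : EuclideanSpace ℝ (Fin n) × ℝ =>
      ((1 + ‖q.1‖ ^ 2) * Real.cosh q.2 + (1 - ‖q.1‖ ^ 2))⁻¹) :=
    (((contDiff_const.add h).mul hc).add (contDiff_const.sub h)).inv
      fun q => (fermi_denom_pos q.1 q.2).ne'
  have h2 : ContDiff ℝ ∞ (fun q : EuclideanSpace ℝ (Fin n) × ℝ => (2 * Real.cosh q.2) • q.1) :=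
    (contDiff_const.mul hc).smul h1
  have h3 : ContDiff ℝ ∞ (fun q : EuclideanSpace ℝ (Fin n) × ℝ =>
      ((1 - ‖q.1‖ ^ 2) * Real.sinh q.2) • e) :=
    ((contDiff_const.sub h).mul hs).smul contDiff_const
  exact hD.smul (h2.add h3)

theorem contDiff_fermiMap : ContDiff ℝ ∞ (fermiMap e) := by
  have h1 : ContDiff ℝ ∞ (fun q : ↥(ℝ ∙ e)ᗮ × (ℝ × ℝ) =>
      ((q.1 : EuclideanSpace ℝ (Fin n)), q.2.1)) :=
    ((ℝ ∙ e)ᗮ.subtypeL.contDiff.comp contDiff_fst).prodMk (contDiff_fst.comp contDiff_snd)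
  have h2 : ContDiff ℝ ∞ (fun q : ↥(ℝ ∙ e)ᗮ × (ℝ × ℝ) => q.2.2) :=
    contDiff_snd.comp contDiff_snd
  exact (contDiff_fermi.comp h1).prodMk h2

/-- Directional derivative of `fermi e`. -/
def fermiDeriv (e a : EuclideanSpace ℝ (Fin n)) (r : ℝ) (v : EuclideanSpace ℝ (Fin n)) (x : ℝ) :
    EuclideanSpace ℝ (Fin n) :=
  ((1 + ‖a‖ ^ 2) * Real.cosh r + (1 - ‖a‖ ^ 2))⁻¹ •
    ((2 * (Real.sinh r * x)) • a + (2 * Real.cosh r) • v +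
      (-(2 * inner ℝ a v) * Real.sinh r + (1 - ‖a‖ ^ 2) * (Real.cosh r * x)) • e -
      (2 * inner ℝ a v * (Real.cosh r - 1) + (1 + ‖a‖ ^ 2) * (Real.sinh r * x)) • fermi e a r)

theorem hasDerivAt_fermi {a : ℝ → EuclideanSpace ℝ (Fin n)} {r : ℝ → ℝ}
    {v : EuclideanSpace ℝ (Fin n)} {x s : ℝ} (ha : HasDerivAt a v s) (hr : HasDerivAt r x s) :
    HasDerivAt (fun s => fermi e (a s) (r s)) (fermiDeriv e (a s) (r s) v x) s := by
  have hw : HasDerivAt (fun s => ‖a s‖ ^ 2) (2 * inner ℝ (a s) v) s := ha.norm_sq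
  have hc := hr.cosh
  have hs := hr.sinh
  have hD := fermi_denom_pos (a s) (r s)
  have h := ((((hw.const_add 1).mul hc).add (hw.const_sub 1)).inv hD.ne').smul
    (((hc.const_mul 2).smul ha).add ((((hw.const_sub 1).mul hs)).smul_const e))
  refine h.congr_deriv ?_
  simp only [fermiDeriv, fermi, Pi.add_apply, Pi.mul_apply, Pi.inv_apply, Pi.smul_apply']
  match_scalars <;> field_simp <;> ring

theorem fderiv_fermiMap (q u : ↥(ℝ ∙ e)ᗮ × (ℝ × ℝ)) :
    fderiv ℝ (fermiMap e) q u = (fermiDeriv e q.1 q.2.1 u.1 u.2.1, u.2.2) := by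
  have h1 : HasFDerivAt (fermiMap e) (fderiv ℝ (fermiMap e) q) q :=
    ((contDiff_fermiMap (e := e)).differentiable (by simp) q).hasFDerivAt
  have h2 : HasDerivAt (fun s : ℝ => q + s • u) u 0 := by
    simpa using ((hasDerivAt_id (0 : ℝ)).smul_const u).const_add q
  have h3 : HasDerivAt (fun s : ℝ => fermiMap e (q + s • u)) (fderiv ℝ (fermiMap e) q u) 0 := by
    have h1' : HasFDerivAt (fermiMap e) (fderiv ℝ (fermiMap e) q) (q + (0 : ℝ) • u) := by
      simpa using h1
    exact h1'.comp_hasDerivAt (0 : ℝ) h2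
  have ha : HasDerivAt (fun s : ℝ => ((q.1 + s • u.1 : ↥(ℝ ∙ e)ᗮ) : EuclideanSpace ℝ (Fin n)))
      (u.1 : EuclideanSpace ℝ (Fin n)) 0 := by
    have := ((hasDerivAt_id (0 : ℝ)).smul_const (u.1 : EuclideanSpace ℝ (Fin n))).const_add
      (q.1 : EuclideanSpace ℝ (Fin n))
    simpa using this
  have hr : HasDerivAt (fun s : ℝ => q.2.1 + s * u.2.1) u.2.1 0 := by
    simpa using ((hasDerivAt_id (0 : ℝ)).mul_const u.2.1).const_add q.2.1
  have ht : HasDerivAt (fun s : ℝ => q.2.2 + s * u.2.2) u.2.2 0 := by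
    simpa using ((hasDerivAt_id (0 : ℝ)).mul_const u.2.2).const_add q.2.2
  have h4 := (hasDerivAt_fermi (e := e) ha hr).prodMk ht
  have h5 := h3.unique (h4.congr_of_eventuallyEq (Eventually.of_forall fun s => by
    simp [fermiMap]))
  simpa using h5

/-- The metric of `ℍⁿ × ℝ` in Fermi coordinates. -/
theorem gHat_fderiv_fermiMap (he : ‖e‖ = 1) {q : ↥(ℝ ∙ e)ᗮ × (ℝ × ℝ)} (hq : ‖q.1‖ < 1)
    (u v : ↥(ℝ ∙ e)ᗮ × (ℝ × ℝ)) :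
    gHat (fermiMap e q) (fderiv ℝ (fermiMap e) q u) (fderiv ℝ (fermiMap e) q v) =
      Real.cosh q.2.1 ^ 2 * (2 / (1 - ‖q.1‖ ^ 2)) ^ 2 * inner ℝ u.1 v.1 +
        u.2.1 * v.2.1 + u.2.2 * v.2.2 := by
  obtain ⟨a, r, t⟩ := q
  obtain ⟨u, u1, u2⟩ := u
  obtain ⟨v, v1, v2⟩ := v
  simp only [fderiv_fermiMap, gHat, fermiMap] at *
  have hD := fermi_denom_pos (a : EuclideanSpace ℝ (Fin n)) r
  have hw : 0 < 1 - ‖a‖ ^ 2 := by nlinarith [norm_nonneg a]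
  rw [one_sub_norm_fermi_sq he (inner_orthogonal a), fermiDeriv, fermiDeriv, fermi]
  have hee : inner ℝ e e = 1 := by rw [real_inner_self_eq_norm_sq, he]; norm_num
  have hua : inner ℝ (u : EuclideanSpace ℝ (Fin n)) (a : EuclideanSpace ℝ (Fin n)) =
    inner ℝ (a : EuclideanSpace ℝ (Fin n)) u := real_inner_comm _ _
  have haa : inner ℝ (a : EuclideanSpace ℝ (Fin n)) a = ‖a‖ ^ 2 := real_inner_self_eq_norm_sq _
  simp only [inner_smul_left, inner_smul_right, inner_add_left, inner_add_right, inner_sub_left,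
    inner_sub_right, inner_orthogonal, inner_orthogonal', hee, hua, haa, conj_trivial,
    Submodule.coe_inner, Submodule.coe_norm] at *
  -- Only scalars remain once the inner products with `e` are evaluated. Replacing them by variables
  -- leaves a rational identity with the single relation `s ^ 2 = c ^ 2 - 1`.
  have hc := Real.cosh_sq r
  generalize Real.cosh r = c at *
  generalize Real.sinh r = s at *
  generalize inner ℝ (a : EuclideanSpace ℝ (Fin n)) u = A at *
  generalize inner ℝ (a : EuclideanSpace ℝ (Fin n)) v = B at *
  generalize inner ℝ (u : EuclideanSpace ℝ (Fin n)) v = U at *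
  generalize ‖(a : EuclideanSpace ℝ (Fin n))‖ ^ 2 = w at *
  have hs : s ^ 2 = c ^ 2 - 1 := by linarith
  have hs4 : s ^ 4 = (c ^ 2 - 1) ^ 2 := by rw [← hs]; ring
  have hs3 : s ^ 3 = (c ^ 2 - 1) * s := by rw [← hs]; ring
  field_simp
  ring_nf
  simp only [hs, hs3, hs4]
  ring

end

end TranslationH

namespace TranslationH

noncomputable section

variable {n : ℕ} {e : EuclideanSpace ℝ (Fin n)}

/-! ### Mean curvature -/

theorem hasDerivAt_fst_apply {E F : Type*} [NormedAddCommGroup E] [NormedSpace ℝ E]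
    [NormedAddCommGroup F] [NormedSpace ℝ F] {f : ℝ → E × F} {f' : E × F} {s : ℝ}
    (h : HasDerivAt f f' s) : HasDerivAt (fun s => (f s).1) f'.1 s :=
  (hasFDerivAt_fst (𝕜 := ℝ) (E := E) (F := F) (p := f s)).comp_hasDerivAt s h

theorem hasDerivAt_snd_apply {E F : Type*} [NormedAddCommGroup E] [NormedSpace ℝ E]
    [NormedAddCommGroup F] [NormedSpace ℝ F] {f : ℝ → E × F} {f' : E × F} {s : ℝ}
    (h : HasDerivAt f f' s) : HasDerivAt (fun s => (f s).2) f'.2 s :=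
  (hasFDerivAt_snd (𝕜 := ℝ) (E := E) (F := F) (p := f s)).comp_hasDerivAt s h

/-- The first summand comes from the conformal factor; in Koszul's formula it is matched with
`christoffel`. -/
theorem hasDerivAt_gHat {p U V : ℝ → Amb n} {p' U' V' : Amb n} {s : ℝ}
    (hp : HasDerivAt p p' s) (hU : HasDerivAt U U' s) (hV : HasDerivAt V V' s)
    (h1 : ‖(p s).1‖ < 1) :
    HasDerivAt (fun s => gHat (p s) (U s) (V s))
      (2 * (2 / (1 - ‖(p s).1‖ ^ 2)) ^ 3 * inner ℝ (p s).1 p'.1 * inner ℝ (U s).1 (V s).1 +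
        (2 / (1 - ‖(p s).1‖ ^ 2)) ^ 2 * (inner ℝ U'.1 (V s).1 + inner ℝ (U s).1 V'.1) +
        (U'.2 * (V s).2 + (U s).2 * V'.2)) s := by
  have hw : 0 < 1 - ‖(p s).1‖ ^ 2 := by nlinarith [norm_nonneg (p s).1]
  have hn : HasDerivAt (fun s => ‖(p s).1‖ ^ 2) (2 * inner ℝ (p s).1 p'.1) s :=
    (hasDerivAt_fst_apply hp).norm_sq
  have hl := ((hasDerivAt_const s (2 : ℝ)).div (hn.const_sub 1) hw.ne').pow 2
  have hi := (hasDerivAt_fst_apply hU).inner ℝ (hasDerivAt_fst_apply hV)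
  have h := (hl.mul hi).add ((hasDerivAt_snd_apply hU).mul (hasDerivAt_snd_apply hV))
  refine h.congr_deriv ?_
  simp only [Pi.div_apply, Pi.pow_apply, Nat.cast_ofNat, Nat.add_one_sub_one]
  field_simp
  ring

theorem hasDerivAt_add_smul {M : Type*} [NormedAddCommGroup M] [NormedSpace ℝ M] (q u : M) :
    HasDerivAt (fun s : ℝ => q + s • u) u 0 := by
  simpa using ((hasDerivAt_id (0 : ℝ)).smul_const u).const_add q

theorem hasDerivAt_comp_add_smul {M F : Type*} [NormedAddCommGroup M] [NormedSpace ℝ M]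
    [NormedAddCommGroup F] [NormedSpace ℝ F] {f : M → F} {q : M} (hf : DifferentiableAt ℝ f q)
    (u : M) : HasDerivAt (fun s : ℝ => f (q + s • u)) (fderiv ℝ f q u) 0 := by
  have h1 : HasFDerivAt f (fderiv ℝ f q) (q + (0 : ℝ) • u) := by simpa using hf.hasFDerivAt
  exact h1.comp_hasDerivAt (0 : ℝ) (hasDerivAt_add_smul q u)

theorem hasDerivAt_fderiv_add_smul {M F : Type*} [NormedAddCommGroup M] [NormedSpace ℝ M]
    [NormedAddCommGroup F] [NormedSpace ℝ F] {X : M → F} {q : M}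
    (hX : DifferentiableAt ℝ (fderiv ℝ X) q) (v x : M) :
    HasDerivAt (fun s : ℝ => fderiv ℝ X (q + s • v) x) (fderiv ℝ (fderiv ℝ X) q v x) 0 := by
  simpa using (hasDerivAt_comp_add_smul hX v).clm_apply (hasDerivAt_const (0 : ℝ) x)

theorem hasDerivAt_fderiv_comp {M F : Type*} [NormedAddCommGroup M] [NormedSpace ℝ M]
    [NormedAddCommGroup F] [NormedSpace ℝ F] {X : M → F} {p y : ℝ → M} {p' y' : M} {s : ℝ}
    (hX : DifferentiableAt ℝ (fderiv ℝ X) (p s)) (hp : HasDerivAt p p' s)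
    (hy : HasDerivAt y y' s) :
    HasDerivAt (fun s : ℝ => fderiv ℝ X (p s) (y s))
      (fderiv ℝ (fderiv ℝ X) (p s) p' (y s) + fderiv ℝ X (p s) y') s :=
  (hX.hasFDerivAt.comp_hasDerivAt s hp).clm_apply hy

/-- Koszul's formula for the second derivative of a map into `ℍⁿ × ℝ`. -/
theorem gHat_second_deriv {M : Type*} [NormedAddCommGroup M] [NormedSpace ℝ M] {X : M → Amb n}
    {q : M} (hX : ContDiffAt ℝ 2 X q) (h1 : ‖(X q).1‖ < 1) (u w : M) {A B : ℝ}
    (hA : HasDerivAt (fun s : ℝ => gHat (X (q + s • u)) (fderiv ℝ X (q + s • u) u)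
      (fderiv ℝ X (q + s • u) w)) A 0)
    (hB : HasDerivAt (fun s : ℝ => gHat (X (q + s • w)) (fderiv ℝ X (q + s • w) u)
      (fderiv ℝ X (q + s • w) u)) B 0) :
    gHat (X q) (fderiv ℝ (fderiv ℝ X) q u u +
      christoffel (X q) (fderiv ℝ X q u) (fderiv ℝ X q u)) (fderiv ℝ X q w) = A - B / 2 := by
  have hd : DifferentiableAt ℝ X q := hX.differentiableAt (by norm_num)
  have hdd : DifferentiableAt ℝ (fderiv ℝ X) q :=
    (hX.fderiv_right (m := 1) (by norm_num)).differentiableAt (by norm_num)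
  -- Torsion-freeness: the mixed second derivatives in `A` and in `B / 2` cancel.
  have hsymm : fderiv ℝ (fderiv ℝ X) q w u = fderiv ℝ (fderiv ℝ X) q u w :=
    (hX.isSymmSndFDerivAt (by simp)).eq w u
  have hD : ∀ v x : M, HasDerivAt (fun s : ℝ => fderiv ℝ X (q + s • v) x)
      (fderiv ℝ (fderiv ℝ X) q v x) 0 := hasDerivAt_fderiv_add_smul hdd
  have hA' := hasDerivAt_gHat (hasDerivAt_comp_add_smul hd u) (hD u u) (hD u w) (by simpa using h1)
  have hB' := hasDerivAt_gHat (hasDerivAt_comp_add_smul hd w) (hD w u) (hD w u) (by simpa using h1)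
  have hw : 0 < 1 - ‖(X q).1‖ ^ 2 := by nlinarith [norm_nonneg (X q).1]
  rw [hA.unique hA', hB.unique hB', hsymm]
  simp only [zero_smul, add_zero, gHat, christoffel, Prod.fst_add, Prod.snd_add, inner_add_left,
    inner_smul_left, inner_sub_left, conj_trivial]
  rw [real_inner_comm (fderiv ℝ (fderiv ℝ X) q u w).1]
  ring

theorem hasFDerivAt_prod_curve {V : Type*} [NormedAddCommGroup V] [NormedSpace ℝ V]
    {c : ℝ → ℝ × ℝ} {q : V × ℝ} (hc : DifferentiableAt ℝ c q.2) :
    HasFDerivAt (fun q : V × ℝ => (q.1, c q.2))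
      ((ContinuousLinearMap.fst ℝ V ℝ).prod
        ((ContinuousLinearMap.snd ℝ V ℝ).smulRight (deriv c q.2))) q := by
  refine hasFDerivAt_fst.prodMk ?_
  have h := hc.hasDerivAt.hasFDerivAt.comp q (hasFDerivAt_snd (𝕜 := ℝ) (E := V) (F := ℝ))
  refine h.congr_fderiv ?_
  ext <;> simp

theorem fderiv_translationMap (he : ‖e‖ = 1) {c : ℝ → ℝ × ℝ} {q : ↥(ℝ ∙ e)ᗮ × ℝ}
    (hc : DifferentiableAt ℝ c q.2) (u : ↥(ℝ ∙ e)ᗮ × ℝ) :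
    fderiv ℝ (translationMap e c) q u =
      fderiv ℝ (fermiMap e) (q.1, c q.2) (u.1, u.2 • deriv c q.2) := by
  have h0 : translationMap e c = fermiMap e ∘ fun q : ↥(ℝ ∙ e)ᗮ × ℝ => (q.1, c q.2) :=
    funext fun q => translationMap_eq he c q
  have h := (((contDiff_fermiMap (e := e)).differentiable (by simp)
    (q.1, c q.2)).hasFDerivAt).comp q (hasFDerivAt_prod_curve hc)
  rw [h0, h.fderiv]
  rfl

theorem fderiv_fermiMap_injective (he : ‖e‖ = 1) {q : ↥(ℝ ∙ e)ᗮ × (ℝ × ℝ)} (hq : ‖q.1‖ < 1) :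
    Function.Injective (fderiv ℝ (fermiMap e) q) := by
  refine (injective_iff_map_eq_zero _).2 fun u hu => ?_
  have h := gHat_fderiv_fermiMap he hq u u
  have h0 : gHat (fermiMap e q) 0 0 = 0 := by simp [gHat]
  rw [hu, h0, real_inner_self_eq_norm_sq] at h
  have hw : 0 < 1 - ‖q.1‖ ^ 2 := by nlinarith [norm_nonneg q.1]
  have hK : 0 < Real.cosh q.2.1 ^ 2 * (2 / (1 - ‖q.1‖ ^ 2)) ^ 2 := by
    have := Real.cosh_pos q.2.1; positivity
  have h1 : 0 ≤ Real.cosh q.2.1 ^ 2 * (2 / (1 - ‖q.1‖ ^ 2)) ^ 2 * ‖u.1‖ ^ 2 := by positivity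
  have h2 : u.2.1 = 0 := by nlinarith [mul_self_nonneg u.2.1, mul_self_nonneg u.2.2]
  have h3 : u.2.2 = 0 := by nlinarith [mul_self_nonneg u.2.1, mul_self_nonneg u.2.2]
  have h4 : ‖u.1‖ ^ 2 = 0 := by
    rw [h2, h3] at h
    have : Real.cosh q.2.1 ^ 2 * (2 / (1 - ‖q.1‖ ^ 2)) ^ 2 * ‖u.1‖ ^ 2 = 0 := by linarith
    exact (mul_eq_zero.1 this).resolve_left hK.ne'
  exact Prod.ext (norm_eq_zero.1 (pow_eq_zero_iff two_ne_zero |>.1 h4)) (Prod.ext h2 h3)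

theorem norm_fermiMap_lt (he : ‖e‖ = 1) {q : ↥(ℝ ∙ e)ᗮ × (ℝ × ℝ)} (hq : ‖q.1‖ < 1) :
    ‖(fermiMap e q).1‖ < 1 :=
  norm_fermi_lt he (inner_orthogonal q.1) hq _

/-- Covariant second derivative along `ℙ`. -/
theorem gHat_second_deriv_fermiMap_horizontal (he : ‖e‖ = 1) {q : ↥(ℝ ∙ e)ᗮ × (ℝ × ℝ)}
    (hq : ‖q.1‖ < 1) (v : ↥(ℝ ∙ e)ᗮ) (x : ℝ × ℝ) :
    gHat (fermiMap e q) (fderiv ℝ (fderiv ℝ (fermiMap e)) q (v, 0) (v, 0) +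
      christoffel (fermiMap e q) (fderiv ℝ (fermiMap e) q (v, 0)) (fderiv ℝ (fermiMap e) q (v, 0)))
      (fderiv ℝ (fermiMap e) q (0, x)) =
    -(Real.cosh q.2.1 * Real.sinh q.2.1 * x.1 * (2 / (1 - ‖q.1‖ ^ 2)) ^ 2 * ‖v‖ ^ 2) := by
  have hev : ∀ u : ↥(ℝ ∙ e)ᗮ × (ℝ × ℝ), ∀ᶠ s : ℝ in 𝓝 0, ‖(q + s • u).1‖ < 1 := fun u =>
    ((hasDerivAt_add_smul q u).continuousAt.fst.norm).eventually_lt_const (by simpa using hq)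
  -- Directions of `ℙ` stay orthogonal to the vertical plane, so this Koszul term is the derivative
  -- of zero.
  have hA : HasDerivAt (fun s : ℝ => gHat (fermiMap e (q + s • (v, (0 : ℝ × ℝ))))
      (fderiv ℝ (fermiMap e) (q + s • (v, (0 : ℝ × ℝ))) (v, 0))
      (fderiv ℝ (fermiMap e) (q + s • (v, (0 : ℝ × ℝ))) (0, x))) 0 0 := by
    refine (hasDerivAt_const (0 : ℝ) (0 : ℝ)).congr_of_eventuallyEq ?_
    filter_upwards [hev (v, 0)] with s hs
    rw [gHat_fderiv_fermiMap he hs]; simp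
  -- Moving in direction `x` changes the length of `v` only through the factor `cosh² ρ`.
  have hB : HasDerivAt (fun s : ℝ => gHat (fermiMap e (q + s • ((0 : ↥(ℝ ∙ e)ᗮ), x)))
      (fderiv ℝ (fermiMap e) (q + s • ((0 : ↥(ℝ ∙ e)ᗮ), x)) (v, 0))
      (fderiv ℝ (fermiMap e) (q + s • ((0 : ↥(ℝ ∙ e)ᗮ), x)) (v, 0)))
      (2 * Real.cosh q.2.1 * (Real.sinh q.2.1 * x.1) * (2 / (1 - ‖q.1‖ ^ 2)) ^ 2 * ‖v‖ ^ 2) 0 := by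
    have h1 : HasDerivAt (fun s : ℝ => q.2.1 + s * x.1) x.1 0 := by
      simpa using ((hasDerivAt_id (0 : ℝ)).mul_const x.1).const_add q.2.1
    have h2 := ((h1.cosh.pow 2).mul_const ((2 / (1 - ‖q.1‖ ^ 2)) ^ 2)).mul_const (‖v‖ ^ 2)
    have h3 : HasDerivAt (fun s : ℝ => Real.cosh (q.2.1 + s * x.1) ^ 2 *
      (2 / (1 - ‖q.1‖ ^ 2)) ^ 2 * ‖v‖ ^ 2) (2 * Real.cosh q.2.1 * (Real.sinh q.2.1 * x.1) *
        (2 / (1 - ‖q.1‖ ^ 2)) ^ 2 * ‖v‖ ^ 2) 0 := h2.congr_deriv (by simp)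
    refine h3.congr_of_eventuallyEq ?_
    filter_upwards [hev (0, x)] with s hs
    rw [gHat_fderiv_fermiMap he hs, real_inner_self_eq_norm_sq]; simp
  rw [gHat_second_deriv ((contDiff_fermiMap (e := e)).contDiffAt.of_le (by norm_cast))
    (norm_fermiMap_lt he hq) (v, 0) (0, x) hA hB]
  ring

/-- The vertical planes orthogonal to `ℙ × ℝ` are flat and totally geodesic. -/
theorem gHat_second_deriv_fermiMap_vertical (he : ‖e‖ = 1) {q : ↥(ℝ ∙ e)ᗮ × (ℝ × ℝ)}
    (hq : ‖q.1‖ < 1) (y x : ℝ × ℝ) :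
    gHat (fermiMap e q) (fderiv ℝ (fderiv ℝ (fermiMap e)) q (0, y) (0, y) +
      christoffel (fermiMap e q) (fderiv ℝ (fermiMap e) q (0, y)) (fderiv ℝ (fermiMap e) q (0, y)))
      (fderiv ℝ (fermiMap e) q (0, x)) = 0 := by
  have hev : ∀ u : ↥(ℝ ∙ e)ᗮ × (ℝ × ℝ), ∀ᶠ s : ℝ in 𝓝 0, ‖(q + s • u).1‖ < 1 := fun u =>
    ((hasDerivAt_add_smul q u).continuousAt.fst.norm).eventually_lt_const (by simpa using hq)
  -- Inner products within the plane are constant in these coordinates, so both Koszul terms vanish.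
  have hA : ∀ z u w : ℝ × ℝ, HasDerivAt (fun s : ℝ =>
      gHat (fermiMap e (q + s • ((0 : ↥(ℝ ∙ e)ᗮ), z)))
      (fderiv ℝ (fermiMap e) (q + s • ((0 : ↥(ℝ ∙ e)ᗮ), z)) (0, u))
      (fderiv ℝ (fermiMap e) (q + s • ((0 : ↥(ℝ ∙ e)ᗮ), z)) (0, w))) 0 0 := fun z u w => by
    refine (hasDerivAt_const (0 : ℝ) (u.1 * w.1 + u.2 * w.2)).congr_of_eventuallyEq ?_
    filter_upwards [hev (0, z)] with s hs
    rw [gHat_fderiv_fermiMap he hs]; simp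
  rw [gHat_second_deriv ((contDiff_fermiMap (e := e)).contDiffAt.of_le (by norm_cast))
    (norm_fermiMap_lt he hq) (0, y) (0, x) (hA _ _ _) (hA _ _ _)]
  ring

end

end TranslationH

/-! ### Second fundamental form and mean curvature of a translation hypersurface. -/

namespace TranslationH

noncomputable section

variable {n : ℕ} {e : EuclideanSpace ℝ (Fin n)}

/-- The unit normal of the translation hypersurface generated by `c`. -/
def translationNormal (e : EuclideanSpace ℝ (Fin n)) (c : ℝ → ℝ × ℝ) (q : ↥(ℝ ∙ e)ᗮ × ℝ) : Amb n :=
  fderiv ℝ (fermiMap e) (q.1, c q.2) (0, (-(deriv c q.2).2, (deriv c q.2).1))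

/-- Second fundamental form in the direction of `ℙ`. -/
theorem gHat_second_deriv_translationMap_horizontal (he : ‖e‖ = 1) {c : ℝ → ℝ × ℝ}
    {q : ↥(ℝ ∙ e)ᗮ × ℝ} (hq : ‖q.1‖ < 1) (hc : ContDiffAt ℝ ∞ c q.2)
    (hX : ContDiffAt ℝ ∞ (translationMap e c) q) (v : ↥(ℝ ∙ e)ᗮ) :
    gHat (translationMap e c q) (fderiv ℝ (fderiv ℝ (translationMap e c)) q (v, 0) (v, 0) +
      christoffel (translationMap e c q) (fderiv ℝ (translationMap e c) q (v, 0))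
        (fderiv ℝ (translationMap e c) q (v, 0))) (translationNormal e c q) =
    Real.cosh (c q.2).1 * Real.sinh (c q.2).1 * (deriv c q.2).2 * (2 / (1 - ‖q.1‖ ^ 2)) ^ 2 *
      ‖v‖ ^ 2 := by
  have hcd : DifferentiableAt ℝ c q.2 := hc.differentiableAt (by simp)
  have hXX : DifferentiableAt ℝ (fderiv ℝ (translationMap e c)) q :=
    (hX.fderiv_right (m := 1) (by norm_cast)).differentiableAt (by norm_num)
  have hFF : DifferentiableAt ℝ (fderiv ℝ (fermiMap e)) (q.1, c q.2) :=
    (((contDiff_fermiMap (e := e)).fderiv_right (m := 1) (by norm_cast)).differentiable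
      (by norm_num)) _
  have h1 : HasDerivAt (fun s : ℝ => fderiv ℝ (translationMap e c) (q + s • (v, (0 : ℝ))) (v, 0))
      (fderiv ℝ (fderiv ℝ (translationMap e c)) q (v, 0) (v, 0)) 0 :=
    hasDerivAt_fderiv_add_smul hXX _ _
  have h2 : HasDerivAt (fun s : ℝ => fderiv ℝ (fermiMap e) ((q.1, c q.2) + s • (v, (0 : ℝ × ℝ)))
      (v, 0)) (fderiv ℝ (fderiv ℝ (fermiMap e)) (q.1, c q.2) (v, 0) (v, 0)) 0 :=
    hasDerivAt_fderiv_add_smul hFF _ _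
  -- A line in direction `(v, 0)` keeps the curve parameter fixed, so no derivative of `c` enters
  -- and the second derivative is that of `fermiMap`.
  have h3 : (fun s : ℝ => fderiv ℝ (translationMap e c) (q + s • (v, (0 : ℝ))) (v, 0)) =
      fun s : ℝ => fderiv ℝ (fermiMap e) ((q.1, c q.2) + s • (v, (0 : ℝ × ℝ))) (v, 0) := by
    funext s
    rw [fderiv_translationMap he (by simpa using hcd)]
    simp
  rw [h3] at h1
  rw [h1.unique h2, fderiv_translationMap he hcd, translationMap_eq he, translationNormal]
  simp only [zero_smul]
  rw [gHat_second_deriv_fermiMap_horizontal he (q := (q.1, c q.2)) hq]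
  ring

/-- Second fundamental form in the direction of the generating curve. -/
theorem gHat_second_deriv_translationMap_vertical (he : ‖e‖ = 1) {c : ℝ → ℝ × ℝ}
    {q : ↥(ℝ ∙ e)ᗮ × ℝ} (hq : ‖q.1‖ < 1) (hc : ContDiffAt ℝ ∞ c q.2)
    (hX : ContDiffAt ℝ ∞ (translationMap e c) q) :
    gHat (translationMap e c q) (fderiv ℝ (fderiv ℝ (translationMap e c)) q (0, 1) (0, 1) +
      christoffel (translationMap e c q) (fderiv ℝ (translationMap e c) q (0, 1))
        (fderiv ℝ (translationMap e c) q (0, 1))) (translationNormal e c q) =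
    (deriv c q.2).1 * (deriv (deriv c) q.2).2 - (deriv c q.2).2 * (deriv (deriv c) q.2).1 := by
  have hcd : DifferentiableAt ℝ c q.2 := hc.differentiableAt (by simp)
  have hev : ∀ᶠ s in 𝓝 q.2, DifferentiableAt ℝ c s := by
    filter_upwards [(hc.of_le (m := 1) (by norm_cast)).eventually (by norm_num)] with s hs
    exact hs.differentiableAt (by norm_num)
  have hcdd : HasDerivAt (deriv c) (deriv (deriv c) q.2) q.2 := by
    have h := (hc.fderiv_right (m := 1) (by norm_cast)).differentiableAt (by norm_num)
    have h2 : deriv c = fun s => fderiv ℝ c s 1 := rfl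
    exact DifferentiableAt.hasDerivAt (by rw [h2]; exact h.clm_apply (differentiableAt_const _))
  have hXX : DifferentiableAt ℝ (fderiv ℝ (translationMap e c)) q :=
    (hX.fderiv_right (m := 1) (by norm_cast)).differentiableAt (by norm_num)
  have hFF : DifferentiableAt ℝ (fderiv ℝ (fermiMap e)) (q.1, c q.2) :=
    (((contDiff_fermiMap (e := e)).fderiv_right (m := 1) (by norm_cast)).differentiable
      (by norm_num)) _
  have h1 : HasDerivAt (fun s : ℝ => fderiv ℝ (translationMap e c)
      (q + s • ((0 : ↥(ℝ ∙ e)ᗮ), (1 : ℝ))) (0, 1))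
      (fderiv ℝ (fderiv ℝ (translationMap e c)) q (0, 1) (0, 1)) 0 :=
    hasDerivAt_fderiv_add_smul hXX _ _
  have hcs : HasDerivAt (fun s : ℝ => c (q.2 + s)) (deriv c q.2) 0 :=
    HasDerivAt.comp_const_add _ _ (by simpa using hcd.hasDerivAt)
  have hcds : HasDerivAt (fun s : ℝ => deriv c (q.2 + s)) (deriv (deriv c) q.2) 0 :=
    HasDerivAt.comp_const_add _ _ (by simpa using hcdd)
  -- The chain rule gives the Hessian of `fermiMap` in direction `c'` plus the image of `c''`. The
  -- Hessian together with the Christoffel term is orthogonal to the normal, which lies in a totally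
  -- geodesic flat plane, so only the plane curvature survives.
  have h2 : HasDerivAt (fun s : ℝ => fderiv ℝ (fermiMap e) (q.1, c (q.2 + s))
      (0, deriv c (q.2 + s)))
      (fderiv ℝ (fderiv ℝ (fermiMap e)) (q.1, c q.2) (0, deriv c q.2) (0, deriv c q.2) +
        fderiv ℝ (fermiMap e) (q.1, c q.2) (0, deriv (deriv c) q.2)) 0 := by
    have h := hasDerivAt_fderiv_comp (X := fermiMap e) (s := 0) (by simpa using hFF)
      ((hasDerivAt_const (0 : ℝ) q.1).prodMk hcs)
      ((hasDerivAt_const (0 : ℝ) (0 : ↥(ℝ ∙ e)ᗮ)).prodMk hcds)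
    rw [add_zero] at h
    exact h
  have h3 : (fun s : ℝ => fderiv ℝ (translationMap e c)
      (q + s • ((0 : ↥(ℝ ∙ e)ᗮ), (1 : ℝ))) (0, 1)) =ᶠ[𝓝 0]
      fun s : ℝ => fderiv ℝ (fermiMap e) (q.1, c (q.2 + s)) (0, deriv c (q.2 + s)) := by
    have : Tendsto (fun s : ℝ => q.2 + s) (𝓝 0) (𝓝 q.2) := by
      simpa using ((continuous_const_add q.2).tendsto (0 : ℝ))
    filter_upwards [this.eventually hev] with s hs
    rw [fderiv_translationMap he (by simpa using hs)]
    simp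
  rw [h1.unique (h2.congr_of_eventuallyEq h3), fderiv_translationMap he hcd, translationMap_eq he,
    translationNormal]
  simp only [one_smul]
  have hadd : ∀ p u v w : Amb n, gHat p (u + v) w = gHat p u w + gHat p v w := fun p u v w => by
    simp only [gHat, Prod.fst_add, Prod.snd_add, inner_add_left]; ring
  rw [add_right_comm, hadd, gHat_second_deriv_fermiMap_vertical he (q := (q.1, c q.2)) hq,
    gHat_fderiv_fermiMap he (q := (q.1, c q.2)) hq]
  simp
  ring

/-- A curve with `κ = (n - 1) (1 - t' tanh ρ)` generates a hypersurface with mean curvature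
`(n - 1) / n`. -/
theorem isImmersedHHypersurface_of_curvature (he : ‖e‖ = 1) (hn : n ≠ 0) {c : ℝ → ℝ × ℝ}
    {Z : Set ℝ}
    (hc : ∀ s ∉ Z, ContDiffAt ℝ ∞ c s)
    (hunit : ∀ s ∉ Z, (deriv c s).1 ^ 2 + (deriv c s).2 ^ 2 = 1)
    (hcurv : ∀ s ∉ Z, (deriv c s).1 * (deriv (deriv c) s).2 - (deriv c s).2 * (deriv (deriv c) s).1
      = ((n : ℝ) - 1) * (1 - (deriv c s).2 * Real.tanh (c s).1)) :
    IsImmersedHHypersurface e c Z (((n : ℝ) - 1) / n) := by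
  have hpair : ∀ q ∈ paramDomain e Z,
      ContDiffAt ℝ ∞ (fun q : ↥(ℝ ∙ e)ᗮ × ℝ => (q.1, c q.2)) q := fun q hq =>
    contDiffAt_fst.prodMk ((hc q.2 hq.2).comp q contDiffAt_snd)
  have hX : ∀ q ∈ paramDomain e Z, ContDiffAt ℝ ∞ (translationMap e c) q := fun q hq => by
    have h0 : translationMap e c = fermiMap e ∘ fun q : ↥(ℝ ∙ e)ᗮ × ℝ => (q.1, c q.2) :=
      funext fun q => translationMap_eq he c q
    rw [h0]
    exact (contDiff_fermiMap (e := e)).contDiffAt.comp q (hpair q hq)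
  have hderiv : ∀ q ∈ paramDomain e Z, ContDiffAt ℝ ∞ (fun q : ↥(ℝ ∙ e)ᗮ × ℝ => deriv c q.2) q :=
    fun q hq => by
    have h2 : deriv c = fun s => fderiv ℝ c s 1 := rfl
    have h3 : ContDiffAt ℝ ∞ (deriv c) q.2 := by
      rw [h2]
      exact ((hc q.2 hq.2).fderiv_right (by norm_cast)).clm_apply contDiffAt_const
    exact h3.comp q contDiffAt_snd
  refine ⟨fun q hq => (hX q hq).contDiffWithinAt, fun q hq => ?_, translationNormal e c,
    fun q hq => ContDiffAt.contDiffWithinAt ?_, fun q hq => ⟨⟨?_, fun v => ?_, ?_⟩, fun h => ?_⟩⟩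
  · have hcd : DifferentiableAt ℝ c q.2 := (hc q.2 hq.2).differentiableAt (by simp)
    refine (injective_iff_map_eq_zero _).2 fun u hu => ?_
    rw [fderiv_translationMap he hcd] at hu
    have h0 := (injective_iff_map_eq_zero _).1
      (fderiv_fermiMap_injective he (q := (q.1, c q.2)) hq.1) _ hu
    rw [Prod.mk_eq_zero] at h0
    have h1 : deriv c q.2 ≠ 0 := fun h => by have := hunit q.2 hq.2; rw [h] at this; simp at this
    exact Prod.ext h0.1 ((smul_eq_zero.1 h0.2).resolve_right h1)
  · have h1 : ContDiffAt ℝ ∞ (fun q : ↥(ℝ ∙ e)ᗮ × ℝ => fderiv ℝ (fermiMap e) (q.1, c q.2)) q :=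
      ((contDiff_fermiMap (e := e)).fderiv_right (m := ∞) (by norm_cast)).contDiffAt.comp q
        (hpair q hq)
    exact h1.clm_apply (contDiffAt_const.prodMk ((hderiv q hq).snd.neg.prodMk (hderiv q hq).fst))
  · rw [translationMap_eq he, translationNormal,
      gHat_fderiv_fermiMap he (q := (q.1, c q.2)) hq.1]
    have := hunit q.2 hq.2
    simp only [inner_zero_left, mul_zero, zero_add]
    linarith
  · have hcd : DifferentiableAt ℝ c q.2 := (hc q.2 hq.2).differentiableAt (by simp)
    rw [fderiv_translationMap he hcd, translationMap_eq he, translationNormal,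
      gHat_fderiv_fermiMap he (q := (q.1, c q.2)) hq.1]
    simp
    ring
  · obtain ⟨k, rfl⟩ := Nat.exists_eq_succ_of_ne_zero hn
    have hcd : DifferentiableAt ℝ c q.2 := (hc q.2 hq.2).differentiableAt (by simp)
    have hw : 0 < 1 - ‖q.1‖ ^ 2 := by nlinarith [norm_nonneg q.1, hq.1]
    have hch := Real.cosh_pos (c q.2).1
    have hfr : Module.finrank ℝ ↥(ℝ ∙ e)ᗮ = k := by
      have : Fact (Module.finrank ℝ (EuclideanSpace ℝ (Fin (k + 1))) = k + 1) := ⟨by simp⟩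
      exact Submodule.finrank_orthogonal_span_singleton (by
        intro h; rw [h] at he; simp at he)
    have B : OrthonormalBasis (Fin k) ℝ ↥(ℝ ∙ e)ᗮ :=
      (stdOrthonormalBasis ℝ _).reindex (finCongr hfr)
    have hB : ∀ i j, inner ℝ (B i) (B j) = if i = j then (1 : ℝ) else 0 :=
      orthonormal_iff_ite.1 B.orthonormal
    -- The metric stretches directions of `ℙ` by `cosh ρ · 2 / (1 - ‖a‖²)`; `μ` is the inverse
    -- factor, which normalizes a Euclidean orthonormal basis of `e^⟂`.
    set μ : ℝ := (1 - ‖q.1‖ ^ 2) / (2 * Real.cosh (c q.2).1) with hμ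
    have hμ1 : Real.cosh (c q.2).1 ^ 2 * (2 / (1 - ‖q.1‖ ^ 2)) ^ 2 * μ ^ 2 = 1 := by
      rw [hμ]; field_simp
    refine ⟨Fin.cons (0, 1) fun i => (μ • B i, 0), fun i j => ?_, ?_⟩
    · rw [fderiv_translationMap he hcd, fderiv_translationMap he hcd, translationMap_eq he,
        gHat_fderiv_fermiMap he (q := (q.1, c q.2)) hq.1]
      have := hunit q.2 hq.2
      refine Fin.cases ?_ (fun i => ?_) i <;> refine Fin.cases ?_ (fun j => ?_) j
      · simp; linarith
      · simp [(Fin.succ_ne_zero j).symm]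
      · simp
      · simp only [Fin.cons_succ, zero_smul, Prod.fst_zero, Prod.snd_zero, mul_zero, add_zero,
          inner_smul_left, inner_smul_right, conj_trivial, hB, Fin.succ_inj]
        split_ifs
        · linarith
        · simp
    · rw [Fin.sum_univ_succ]
      simp only [Fin.cons_zero, Fin.cons_succ]
      rw [gHat_second_deriv_translationMap_vertical he hq.1 (hc q.2 hq.2) (hX q hq)]
      simp only [gHat_second_deriv_translationMap_horizontal he hq.1 (hc q.2 hq.2) (hX q hq)]
      have h1 : ∀ i, ‖μ • B i‖ ^ 2 = μ ^ 2 := fun i => by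
        rw [norm_smul, B.orthonormal.1 i, mul_one, Real.norm_eq_abs, sq_abs]
      simp only [h1, Finset.sum_const, Finset.card_univ, Fintype.card_fin, nsmul_eq_mul]
      -- The trace is `κ + k t' tanh ρ`, and the hypothesis on `κ` makes it equal to `k = n - 1`.
      rw [hcurv q.2 hq.2, Real.tanh_eq_sinh_div_cosh]
      have h2 : Real.cosh (c q.2).1 * Real.sinh (c q.2).1 * (deriv c q.2).2 *
          (2 / (1 - ‖q.1‖ ^ 2)) ^ 2 * μ ^ 2 =
          Real.sinh (c q.2).1 / Real.cosh (c q.2).1 * (deriv c q.2).2 := by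
        have : Real.cosh (c q.2).1 * Real.sinh (c q.2).1 * (deriv c q.2).2 *
          (2 / (1 - ‖q.1‖ ^ 2)) ^ 2 * μ ^ 2 = Real.sinh (c q.2).1 / Real.cosh (c q.2).1 *
          (deriv c q.2).2 * (Real.cosh (c q.2).1 ^ 2 * (2 / (1 - ‖q.1‖ ^ 2)) ^ 2 * μ ^ 2) := by
          field_simp
        rw [this, hμ1, mul_one]
      rw [h2]
      have hk : ((k : ℝ) + 1) ≠ 0 := by positivity
      push_cast
      field_simp
      ring
  · rw [translationNormal, fderiv_fermiMap]
    exact h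

end

end TranslationH

namespace TranslationH

noncomputable section

variable {n : ℕ} {e : EuclideanSpace ℝ (Fin n)}

/-! ### Topology of translation hypersurfaces -/

theorem contDiffAt_signedDist {x : EuclideanSpace ℝ (Fin n)} (hx : ‖x‖ < 1) :
    ContDiffAt ℝ ∞ (signedDist e) x := by
  have hw : 0 < 1 - ‖x‖ ^ 2 := by nlinarith [norm_nonneg x]
  have h1 : ContDiffAt ℝ ∞ (fun x : EuclideanSpace ℝ (Fin n) => 2 * inner ℝ e x) x :=
    contDiffAt_const.mul (contDiffAt_const.inner ℝ contDiffAt_id)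
  have h2 : ContDiffAt ℝ ∞ (fun x : EuclideanSpace ℝ (Fin n) => 1 - ‖x‖ ^ 2) x :=
    contDiffAt_const.sub (contDiffAt_id.norm_sq ℝ)
  exact Real.contDiff_arsinh.contDiffAt.comp x (h1.div h2 hw.ne')

theorem contDiffAt_footPoint {x : EuclideanSpace ℝ (Fin n)} (hx : ‖x‖ < 1) :
    ContDiffAt ℝ ∞ (footPoint e) x := by
  have hw : 0 < 1 - ‖x‖ ^ 2 := by nlinarith [norm_nonneg x]
  have hD : 0 < Real.cosh (signedDist e x) * (1 - ‖x‖ ^ 2) + (1 + ‖x‖ ^ 2) := by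
    have := Real.cosh_pos (signedDist e x); positivity
  have h1 : ContDiffAt ℝ ∞ (fun x : EuclideanSpace ℝ (Fin n) => ‖x‖ ^ 2) x :=
    contDiffAt_id.norm_sq ℝ
  have h2 : ContDiffAt ℝ ∞ (fun x => Real.cosh (signedDist e x)) x :=
    Real.contDiff_cosh.contDiffAt.comp x (contDiffAt_signedDist hx)
  have h3 : ContDiffAt ℝ ∞ (fun x : EuclideanSpace ℝ (Fin n) => x - inner ℝ e x • e) x :=
    contDiffAt_id.sub ((contDiffAt_const.inner ℝ contDiffAt_id).smul contDiffAt_const)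
  have h4 : ContDiffAt ℝ ∞
      (fun x : EuclideanSpace ℝ (Fin n) => (2 : ℝ) • (x - inner ℝ e x • e)) x :=
    h3.const_smul 2
  exact (((h2.mul (contDiffAt_const.sub h1)).add (contDiffAt_const.add h1)).inv hD.ne').smul h4

theorem mem_orthogonal_footPoint (he : ‖e‖ = 1) (x : EuclideanSpace ℝ (Fin n)) :
    footPoint e x ∈ (ℝ ∙ e)ᗮ :=
  Submodule.mem_orthogonal_singleton_iff_inner_right.2 (inner_footPoint he x)

/-- Fermi coordinates are a bijection onto the ball, so the foot point drops out. Symmetry, graph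
and closedness statements about the hypersurface thereby become statements about `C`. -/
theorem mem_translationHypersurface (he : ‖e‖ = 1) {C : Set (ℝ × ℝ)} {p : Amb n} :
    p ∈ translationHypersurface e C ↔ ‖p.1‖ < 1 ∧ (signedDist e p.1, p.2) ∈ C := by
  constructor
  · rintro ⟨a, ha, hea, z, hz, rfl⟩
    simp only [hypTranslate_tanh_half he hea, signedDist_fermi he hea ha]
    exact ⟨norm_fermi_lt he hea ha _, hz⟩
  · rintro ⟨hp, hC⟩
    refine ⟨footPoint e p.1, norm_footPoint_lt he hp, inner_footPoint he _, _, hC, ?_⟩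
    rw [hypTranslate_tanh_half he (inner_footPoint he _), fermi_footPoint he hp]

theorem signedDist_reflection (he : ‖e‖ = 1) (x : EuclideanSpace ℝ (Fin n)) :
    ‖x - (2 * inner ℝ e x) • e‖ = ‖x‖ ∧
      signedDist e (x - (2 * inner ℝ e x) • e) = -signedDist e x := by
  have h : ‖x - (2 * inner ℝ e x) • e‖ = ‖x‖ := by
    have h2 : ‖x - (2 * inner ℝ e x) • e‖ ^ 2 = ‖x‖ ^ 2 := by
      rw [norm_sub_sq_real, inner_smul_right, norm_smul, he, Real.norm_eq_abs, mul_one, sq_abs,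
        real_inner_comm]; ring
    exact (sq_eq_sq₀ (norm_nonneg _) (norm_nonneg _)).1 h2
  refine ⟨h, ?_⟩
  rw [signedDist, signedDist, h, inner_sub_right, inner_smul_right, real_inner_self_eq_norm_sq, he,
    ← Real.arsinh_neg]
  congr 1; ring

theorem signedDist_eq_zero_iff {x : EuclideanSpace ℝ (Fin n)} (hx : ‖x‖ < 1) :
    signedDist e x = 0 ↔ inner ℝ e x = 0 := by
  have hw : 0 < 1 - ‖x‖ ^ 2 := by nlinarith [norm_nonneg x]
  rw [signedDist, Real.arsinh_eq_zero_iff, div_eq_zero_iff]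
  simp [hw.ne']

/-- The asymptotic boundary of the hypersurface generated by a closed curve that stays at bounded
distance from `ℙ × ℝ`. -/
theorem asymptoticBoundary_eq (he : ‖e‖ = 1) {C : Set (ℝ × ℝ)} (hC : IsClosed C) {M : ℝ}
    (hM : ∀ z ∈ C, |z.1| ≤ M) :
    asymptoticBoundary (translationHypersurface e C) =
      {p | ‖p.1‖ = 1 ∧ inner ℝ e p.1 = 0 ∧ p.2 ∈ Prod.snd '' C} := by
  ext p
  constructor
  · rintro ⟨hp, hp1 : ‖p.1‖ = 1⟩
    -- Fermi coordinates with ideal foot points `‖a‖ = 1` allowed. The bound on `ρ` and the window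
    -- of heights around `p.2` make `K` compact even if `C` is unbounded in `t`.
    set K : Set (EuclideanSpace ℝ (Fin n) × (ℝ × ℝ)) :=
      {q | ‖q.1‖ ≤ 1 ∧ inner ℝ e q.1 = 0 ∧ q.2 ∈ C ∧ |q.2.2 - p.2| ≤ 1} with hK
    have hKc : IsCompact K := by
      refine Metric.isCompact_of_isClosed_isBounded ?_ ?_
      · have k1 : IsClosed {q : EuclideanSpace ℝ (Fin n) × (ℝ × ℝ) | ‖q.1‖ ≤ 1} :=
          isClosed_le (by fun_prop) continuous_const
        have k2 : IsClosed {q : EuclideanSpace ℝ (Fin n) × (ℝ × ℝ) | inner ℝ e q.1 = 0} :=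
          isClosed_eq (by fun_prop) continuous_const
        have k3 : IsClosed {q : EuclideanSpace ℝ (Fin n) × (ℝ × ℝ) | |q.2.2 - p.2| ≤ 1} :=
          isClosed_le (by fun_prop) continuous_const
        exact k1.inter (k2.inter ((hC.preimage continuous_snd).inter k3))
      · refine Bornology.IsBounded.subset ((Metric.isBounded_closedBall
          (x := (0 : EuclideanSpace ℝ (Fin n))) (r := 1)).prod ((Metric.isBounded_closedBall
          (x := (0 : ℝ)) (r := M)).prod (Metric.isBounded_closedBall (x := p.2) (r := 1)))) ?_
        rintro ⟨a, r, t⟩ ⟨h1, -, h2, h3⟩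
        exact ⟨by simpa using h1, by simpa using hM _ h2, by simpa [Real.dist_eq] using h3⟩
    have hF : Continuous (fun q : EuclideanSpace ℝ (Fin n) × (ℝ × ℝ) =>
        (fermi e q.1 q.2.1, q.2.2)) :=
      ((contDiff_fermi (e := e)).continuous.comp
        (continuous_fst.prodMk (continuous_fst.comp continuous_snd))).prodMk
        (continuous_snd.comp continuous_snd)
    have hcl := (hKc.image hF).isClosed
    have hmem : p ∈ closure (translationHypersurface e C ∩ {x | |x.2 - p.2| < 1}) := by
      have ho : IsOpen {x : Amb n | |x.2 - p.2| < 1} := isOpen_lt (by fun_prop) continuous_const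
      rw [inter_comm]
      exact ho.inter_closure ⟨by simp, hp⟩
    have hsub : translationHypersurface e C ∩ {x | |x.2 - p.2| < 1} ⊆
        (fun q : EuclideanSpace ℝ (Fin n) × (ℝ × ℝ) => (fermi e q.1 q.2.1, q.2.2)) '' K := by
      rintro _ ⟨⟨a, ha, hea, z, hz, rfl⟩, hx⟩
      exact ⟨(a, z), ⟨ha.le, hea, hz, le_of_lt hx⟩, by
        simp only [hypTranslate_tanh_half he hea]⟩
    obtain ⟨⟨a, z⟩, ⟨ha, hea, hz, -⟩, rfl⟩ := hcl.closure_subset_iff.2 hsub hmem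
    -- A foot point with `‖a‖ < 1` would put the limit inside the ball. It is therefore ideal, and
    -- there `fermi` forgets `ρ`.
    have ha1 : ‖a‖ = 1 := by
      refine le_antisymm ha (not_lt.1 fun h => ?_)
      exact absurd hp1 (norm_fermi_lt he hea h _).ne
    simp only [fermi_of_norm_eq_one ha1]
    exact ⟨ha1, hea, _, hz, rfl⟩
  · rintro ⟨hp1, hp2, z, hz, hz2⟩
    refine ⟨?_, hp1⟩
    have hF : Continuous (fun s : ℝ => ((fermi e (s • p.1) z.1, z.2) : Amb n)) :=
      ((contDiff_fermi (e := e)).continuous.comp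
        ((continuous_id.smul continuous_const).prodMk continuous_const)).prodMk continuous_const
    -- Conversely, the foot point is pushed radially to the ideal point while the curve point `z` is
    -- held fixed.
    have h1 : Tendsto (fun s : ℝ => ((fermi e (s • p.1) z.1, z.2) : Amb n))
        (𝓝[Ioo 0 1] 1) (𝓝 p) := by
      have := (hF.tendsto 1).mono_left (nhdsWithin_le_nhds (s := Ioo (0 : ℝ) 1))
      rw [one_smul, fermi_of_norm_eq_one hp1, show (p.1, z.2) = p from Prod.ext rfl hz2] at this
      exact this
    have hne : (𝓝[Ioo (0 : ℝ) 1] 1).NeBot := by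
      rw [← mem_closure_iff_nhdsWithin_neBot, closure_Ioo (by norm_num)]; simp
    refine mem_closure_of_tendsto h1 ?_
    filter_upwards [self_mem_nhdsWithin] with s hs
    have hea : inner ℝ e (s • p.1) = 0 := by rw [inner_smul_right, hp2, mul_zero]
    refine ⟨s • p.1, ?_, hea, z, hz, ?_⟩
    · rw [norm_smul, hp1, mul_one, Real.norm_eq_abs, abs_of_pos hs.1]; exact hs.2
    · rw [hypTranslate_tanh_half he hea]

theorem finrank_orthogonal_singleton (he : ‖e‖ = 1) :
    Module.finrank ℝ ↥(ℝ ∙ e)ᗮ = n - 1 := by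
  have hne : e ≠ 0 := by intro h; rw [h] at he; simp at he
  rcases n with _ | k
  · exact absurd (Subsingleton.elim e 0) hne
  · have : Fact (Module.finrank ℝ (EuclideanSpace ℝ (Fin (k + 1))) = k + 1) := ⟨by simp⟩
    have h : Module.finrank ℝ ↥(ℝ ∙ e)ᗮ = k := Submodule.finrank_orthogonal_span_singleton hne
    simpa using h

/-- A cylinder over the asymptotic boundary of `ℙ`. -/
def cylinderHomeomorph (he : ‖e‖ = 1) (I : Set ℝ) :
    {p : Amb n | ‖p.1‖ = 1 ∧ inner ℝ e p.1 = 0 ∧ p.2 ∈ I} ≃ₜ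
      ↥(Metric.sphere (0 : EuclideanSpace ℝ (Fin (n - 1))) 1) × I :=
  let Ψ : ↥(ℝ ∙ e)ᗮ ≃ₗᵢ[ℝ] EuclideanSpace ℝ (Fin (n - 1)) :=
    ((stdOrthonormalBasis ℝ ↥(ℝ ∙ e)ᗮ).reindex (finCongr (finrank_orthogonal_singleton he))).repr
  { toFun := fun p => (⟨Ψ ⟨p.1.1, Submodule.mem_orthogonal_singleton_iff_inner_right.2 p.2.2.1⟩, by
      rw [mem_sphere_zero_iff_norm, LinearIsometryEquiv.norm_map]; exact p.2.1⟩, ⟨p.1.2, p.2.2.2⟩)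
    invFun := fun q => ⟨((Ψ.symm q.1 : ↥(ℝ ∙ e)ᗮ), q.2), by
      refine ⟨?_, inner_orthogonal _, q.2.2⟩
      have := q.1.2
      rw [mem_sphere_zero_iff_norm] at this
      exact (Ψ.symm.norm_map q.1).trans this⟩
    left_inv := fun p => by simp
    right_inv := fun q => by simp
    continuous_toFun := by
      refine Continuous.prodMk (Continuous.subtype_mk (Ψ.continuous.comp
        (Continuous.subtype_mk (continuous_fst.comp continuous_subtype_val) _)) _)
        (Continuous.subtype_mk (continuous_snd.comp continuous_subtype_val) _)
    continuous_invFun := by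
      refine Continuous.subtype_mk (Continuous.prodMk (continuous_subtype_val.comp
        (Ψ.symm.continuous.comp (continuous_subtype_val.comp continuous_fst)))
        (continuous_subtype_val.comp continuous_snd)) _ }

/-- A graph `t = f ρ` lifts to the graph of `f ∘ signedDist`, which is as regular as `f`, up to
class `∞`, because the signed distance is smooth. -/
theorem isVerticalGraph_of_signedDist (he : ‖e‖ = 1) {k : WithTop ℕ∞} (hk : k ≤ ∞)
    {C : Set (ℝ × ℝ)} {P : ℝ → Prop} {U : Set ℝ} (hU : IsOpen U) {f : ℝ → ℝ}
    (hf : ContDiffOn ℝ k f U) (hC : ∀ z : ℝ × ℝ, z ∈ C ∧ P z.2 ↔ z.1 ∈ U ∧ z.2 = f z.1) :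
    IsVerticalGraph k (translationHypersurface e C ∩ {p | P p.2}) := by
  have hcont : ContDiffOn ℝ ∞ (signedDist e) (Metric.ball 0 1) := fun x hx =>
    (contDiffAt_signedDist (mem_ball_zero_iff.1 hx)).contDiffWithinAt
  refine ⟨Metric.ball 0 1 ∩ signedDist e ⁻¹' U, fun x => f (signedDist e x),
    hcont.continuousOn.isOpen_inter_preimage Metric.isOpen_ball hU, inter_subset_left, ?_, ?_⟩
  · exact hf.comp ((hcont.of_le hk).mono inter_subset_left) inter_subset_right
  · ext p
    have := hC (signedDist e p.1, p.2)
    simp only [mem_inter_iff, mem_translationHypersurface he, mem_ofPred_eq, mem_ball_zero_iff,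
      mem_preimage] at this ⊢
    rw [and_assoc, this, and_assoc]

/-- The hypersurface generated by an embedded curve is embedded. -/
theorem isEmbedding_fermiMap_comp (he : ‖e‖ = 1) {S : Type*} [TopologicalSpace S]
    {c : S → ℝ × ℝ} (hc : IsEmbedding c) :
    IsEmbedding (fun q : ↥(Metric.ball (0 : ↥(ℝ ∙ e)ᗮ) 1) × S =>
      translationMap e c ((q.1 : ↥(ℝ ∙ e)ᗮ), q.2)) := by
  have hlt : ∀ q : ↥(Metric.ball (0 : ↥(ℝ ∙ e)ᗮ) 1) × S,
      ‖(translationMap e c ((q.1 : ↥(ℝ ∙ e)ᗮ), q.2)).1‖ < 1 := fun q => by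
    rw [translationMap_eq he]
    exact norm_fermiMap_lt he (mem_ball_zero_iff.1 q.1.2)
  have hX : Continuous (fun q : ↥(Metric.ball (0 : ↥(ℝ ∙ e)ᗮ) 1) × S =>
      translationMap e c ((q.1 : ↥(ℝ ∙ e)ᗮ), q.2)) := by
    have h0 : (fun q : ↥(Metric.ball (0 : ↥(ℝ ∙ e)ᗮ) 1) × S =>
      translationMap e c ((q.1 : ↥(ℝ ∙ e)ᗮ), q.2)) = fun q => fermiMap e (q.1, c q.2) :=
      funext fun q => translationMap_eq he c _
    rw [h0]
    exact (contDiff_fermiMap (e := e)).continuous.comp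
      ((continuous_subtype_val.comp continuous_fst).prodMk (hc.continuous.comp continuous_snd))
  let X' : ↥(Metric.ball (0 : ↥(ℝ ∙ e)ᗮ) 1) × S → {p : Amb n | ‖p.1‖ < 1} :=
    fun q => ⟨translationMap e c ((q.1 : ↥(ℝ ∙ e)ᗮ), q.2), hlt q⟩
  -- Inverse Fermi coordinates, continuous on the open ball. After them the parametrization is the
  -- product of an inclusion with `c`; since this composite is an embedding, so is the first factor.
  let G : {p : Amb n | ‖p.1‖ < 1} → EuclideanSpace ℝ (Fin n) × (ℝ × ℝ) :=
    fun p => (footPoint e p.1.1, (signedDist e p.1.1, p.1.2))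
  have hG : Continuous G := by
    have h1 : Continuous fun p : {p : Amb n | ‖p.1‖ < 1} => footPoint e p.1.1 :=
      continuous_iff_continuousAt.2 fun p => ContinuousAt.comp
        (f := fun p : {p : Amb n | ‖p.1‖ < 1} => p.1.1) (contDiffAt_footPoint p.2).continuousAt
        (continuous_fst.comp continuous_subtype_val).continuousAt
    have h2 : Continuous fun p : {p : Amb n | ‖p.1‖ < 1} => signedDist e p.1.1 :=
      continuous_iff_continuousAt.2 fun p => ContinuousAt.comp
        (f := fun p : {p : Amb n | ‖p.1‖ < 1} => p.1.1) (contDiffAt_signedDist p.2).continuousAt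
        (continuous_fst.comp continuous_subtype_val).continuousAt
    exact h1.prodMk (h2.prodMk (continuous_snd.comp continuous_subtype_val))
  have hX' : Continuous X' := hX.subtype_mk _
  have hGX : IsEmbedding (G ∘ X') := by
    have h : G ∘ X' = Prod.map (fun a : ↥(Metric.ball (0 : ↥(ℝ ∙ e)ᗮ) 1) =>
        ((a : ↥(ℝ ∙ e)ᗮ) : EuclideanSpace ℝ (Fin n))) c := by
      funext q
      have ha := mem_ball_zero_iff.1 q.1.2
      simp only [G, X', Function.comp, translationMap_eq he, fermiMap, Prod.map]
      rw [footPoint_fermi he (inner_orthogonal _) ha, signedDist_fermi he (inner_orthogonal _) ha]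
    rw [h]
    exact (IsEmbedding.subtypeVal.comp IsEmbedding.subtypeVal).prodMap hc
  exact IsEmbedding.subtypeVal.comp (IsEmbedding.of_comp hX' hG hGX)

end

end TranslationH

namespace TranslationH

noncomputable section

variable {n : ℕ} {e : EuclideanSpace ℝ (Fin n)}

/-! ### Completeness -/

theorem continuousAt_gHat {p u v : Amb n} (hp : ‖p.1‖ < 1) :
    ContinuousAt (fun q : Amb n × Amb n × Amb n => gHat q.1 q.2.1 q.2.2) (p, u, v) := by
  have hw : 1 - ‖p.1‖ ^ 2 ≠ 0 := by nlinarith [norm_nonneg p.1]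
  have h1 : ContinuousAt (fun q : Amb n × Amb n × Amb n => 2 / (1 - ‖q.1.1‖ ^ 2)) (p, u, v) :=
    ContinuousAt.div continuousAt_const (by fun_prop) hw
  exact ((h1.pow 2).mul (by fun_prop)).add (by fun_prop)

/-- The conformal factor exceeds `1` on the ball, so Euclidean speed never exceeds Riemannian speed;
the product norm is a maximum. -/
theorem norm_le_sqrt_gHat {p u : Amb n} (hp : ‖p.1‖ < 1) : ‖u‖ ≤ √(gHat p u u) := by
  have hw : 0 < 1 - ‖p.1‖ ^ 2 := by nlinarith [norm_nonneg p.1]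
  have h2 : 1 ≤ (2 / (1 - ‖p.1‖ ^ 2)) ^ 2 := by
    rw [one_le_sq_iff_one_le_abs, abs_of_pos (by positivity), one_le_div hw]
    nlinarith [sq_nonneg ‖p.1‖]
  have hg : gHat p u u = (2 / (1 - ‖p.1‖ ^ 2)) ^ 2 * ‖u.1‖ ^ 2 + u.2 ^ 2 := by
    rw [gHat, real_inner_self_eq_norm_sq]; ring
  refine Real.le_sqrt_of_sq_le ?_
  rw [hg, Prod.norm_def]
  rcases le_total ‖u.1‖ ‖u.2‖ with h | h
  · rw [max_eq_right h, Real.norm_eq_abs, sq_abs]; nlinarith [sq_nonneg ‖u.1‖]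
  · rw [max_eq_left h]; nlinarith [sq_nonneg ‖u.1‖, sq_nonneg u.2]

/-- The left side is the derivative of `-log (1 - ‖x‖²)` in direction `u`. This function is
unbounded at the ideal boundary but Lipschitz for the metric, so short paths cannot escape to
infinity. -/
theorem inner_div_le_sqrt_gHat {p u : Amb n} (hp : ‖p.1‖ < 1) :
    2 * inner ℝ p.1 u.1 / (1 - ‖p.1‖ ^ 2) ≤ √(gHat p u u) := by
  have hw : 0 < 1 - ‖p.1‖ ^ 2 := by nlinarith [norm_nonneg p.1]
  have hg : gHat p u u = (2 / (1 - ‖p.1‖ ^ 2) * ‖u.1‖) ^ 2 + u.2 ^ 2 := by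
    rw [gHat, real_inner_self_eq_norm_sq]; ring
  have h1 : 2 / (1 - ‖p.1‖ ^ 2) * ‖u.1‖ ≤ √(gHat p u u) := by
    refine Real.le_sqrt_of_sq_le ?_
    rw [hg]; nlinarith [sq_nonneg u.2]
  refine le_trans ?_ h1
  have h2 : inner ℝ p.1 u.1 ≤ ‖u.1‖ :=
    (real_inner_le_norm _ _).trans (by nlinarith [norm_nonneg u.1])
  rw [div_mul_eq_mul_div]
  gcongr

theorem continuous_speed {β : ℝ → Amb n} (hβ : ContDiff ℝ 1 β) (h1 : ∀ t, ‖(β t).1‖ < 1) :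
    Continuous fun t => √(gHat (β t) (deriv β t) (deriv β t)) := by
  have hd : Continuous (deriv β) := hβ.continuous_deriv (by norm_num)
  refine Real.continuous_sqrt.comp (continuous_iff_continuousAt.2 fun t => ?_)
  exact ContinuousAt.comp (f := fun t => (β t, deriv β t, deriv β t)) (continuousAt_gHat (h1 t))
    (hβ.continuous.prodMk (hd.prodMk hd)).continuousAt

/-- A path of length `< ε` stays close to its starting point, and does not come much closer to
infinity. -/
theorem path_bounds {β : ℝ → Amb n} (hβ : ContDiff ℝ 1 β) (h1 : ∀ t, ‖(β t).1‖ < 1) {ε : ℝ}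
    (hε : ∫ t in (0 : ℝ)..1, √(gHat (β t) (deriv β t) (deriv β t)) < ε) {s : ℝ}
    (hs : s ∈ Icc (0 : ℝ) 1) :
    dist (β s) (β 0) < ε ∧
      -Real.log (1 - ‖(β s).1‖ ^ 2) < -Real.log (1 - ‖(β 0).1‖ ^ 2) + ε := by
  have hsp := continuous_speed hβ h1
  have hd : Continuous (deriv β) := hβ.continuous_deriv (by norm_num)
  have hder : ∀ t, HasDerivAt β (deriv β t) t := fun t =>
    (hβ.differentiable (by norm_num) t).hasDerivAt
  have hle : ∫ t in (0 : ℝ)..s, √(gHat (β t) (deriv β t) (deriv β t)) < ε := by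
    refine lt_of_le_of_lt ?_ hε
    exact intervalIntegral.integral_mono_interval (μ := volume) le_rfl hs.1 hs.2
      (Eventually.of_forall fun t => Real.sqrt_nonneg _) (hsp.intervalIntegrable _ _)
  constructor
  · rw [dist_eq_norm, ← intervalIntegral.integral_eq_sub_of_hasDerivAt (fun t _ => hder t)
      (hd.intervalIntegrable _ _)]
    refine lt_of_le_of_lt (intervalIntegral.norm_integral_le_integral_norm hs.1) ?_
    refine lt_of_le_of_lt (intervalIntegral.integral_mono_on hs.1
      (hd.norm.intervalIntegrable _ _) (hsp.intervalIntegrable _ _)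
      fun t _ => norm_le_sqrt_gHat (h1 t)) hle
  · have hw : ∀ t, 0 < 1 - ‖(β t).1‖ ^ 2 := fun t => by nlinarith [norm_nonneg (β t).1, h1 t]
    have hlog : ∀ t, HasDerivAt (fun t => -Real.log (1 - ‖(β t).1‖ ^ 2))
        (2 * inner ℝ (β t).1 (deriv β t).1 / (1 - ‖(β t).1‖ ^ 2)) t := fun t => by
      have hn : HasDerivAt (fun t => ‖(β t).1‖ ^ 2) (2 * inner ℝ (β t).1 (deriv β t).1) t :=
        (hasDerivAt_fst_apply (hder t)).norm_sq
      refine ((hn.const_sub 1).log (hw t).ne').neg.congr_deriv ?_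
      ring
    have hc : Continuous fun t => 2 * inner ℝ (β t).1 (deriv β t).1 / (1 - ‖(β t).1‖ ^ 2) := by
      have := hβ.continuous
      refine Continuous.div (by fun_prop) (by fun_prop) fun t => (hw t).ne'
    have h := intervalIntegral.integral_eq_sub_of_hasDerivAt (fun t _ => hlog t)
      (hc.intervalIntegrable 0 s)
    have h2 := intervalIntegral.integral_mono_on (μ := volume) hs.1
      (hc.intervalIntegrable 0 s) (hsp.intervalIntegrable _ _)
      fun t _ => inner_div_le_sqrt_gHat (h1 t)
    linarith

/-- A Cauchy sequence for the induced length distance converges in `ℍⁿ × ℝ`. -/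
theorem exists_tendsto_of_joinedWithin {M : Type*} [TopologicalSpace M] {D : Set M} {X : M → Amb n}
    (hX : ∀ q ∈ D, ‖(X q).1‖ < 1) {u : ℕ → M} (hu : ∀ k, u k ∈ D)
    (hC : ∀ ε > 0, ∃ K : ℕ, ∀ k ≥ K, ∀ l ≥ K, JoinedWithin D X ε (u k) (u l)) :
    ∃ p : Amb n, ‖p.1‖ < 1 ∧ Tendsto (fun k => X (u k)) atTop (𝓝 p) := by
  have hcau : CauchySeq fun k => X (u k) := by
    refine Metric.cauchySeq_iff.2 fun ε hε => ?_
    obtain ⟨K, hK⟩ := hC ε hε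
    refine ⟨K, fun k hk l hl => ?_⟩
    obtain ⟨σ, -, hσD, h0, h1, hσ, hlen⟩ := hK l hl k hk
    have := (path_bounds hσ (fun t => hX _ (hσD t)) hlen (s := 1) (by simp)).1
    simpa [h0, h1] using this
  obtain ⟨p, hp⟩ := cauchySeq_tendsto_of_complete hcau
  refine ⟨p, ?_, hp⟩
  obtain ⟨K, hK⟩ := hC 1 one_pos
  -- A uniform bound for `-log (1 - ‖x‖²)` on the tail; exponentiated, it keeps the limit off the
  -- ideal boundary.
  set m := -Real.log (1 - ‖(X (u K)).1‖ ^ 2) + 1 with hm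
  have hb : ∀ k ≥ K, ‖(X (u k)).1‖ ^ 2 ≤ 1 - Real.exp (-m) := fun k hk => by
    obtain ⟨σ, -, hσD, h0, h1, hσ, hlen⟩ := hK K le_rfl k hk
    have := (path_bounds hσ (fun t => hX _ (hσD t)) hlen (s := 1) (by simp)).2
    simp only [Function.comp, h0, h1] at this
    have hw : 0 < 1 - ‖(X (u k)).1‖ ^ 2 := by
      nlinarith [norm_nonneg (X (u k)).1, hX _ (hu k)]
    have h2 : Real.exp (-m) < 1 - ‖(X (u k)).1‖ ^ 2 :=
      (Real.lt_log_iff_exp_lt hw).1 (by linarith)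
    linarith
  have hlim : Tendsto (fun k => ‖(X (u k)).1‖ ^ 2) atTop (𝓝 (‖p.1‖ ^ 2)) :=
    (((continuous_fst.tendsto p).comp hp).norm).pow 2
  have h3 : ‖p.1‖ ^ 2 ≤ 1 - Real.exp (-m) :=
    le_of_tendsto hlim (eventually_atTop.2 ⟨K, hb⟩)
  nlinarith [norm_nonneg p.1, Real.exp_pos (-m)]

/-- `c` agrees near every parameter, on each side, with a smooth curve. -/
def IsPiecewiseSmooth (c : ℝ → ℝ × ℝ) : Prop :=
  ∀ s, ∃ c₁ c₂ : ℝ → ℝ × ℝ, ContDiff ℝ ∞ c₁ ∧ ContDiff ℝ ∞ c₂ ∧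
    ∃ δ > 0, EqOn c c₁ (Icc (s - δ) s) ∧ EqOn c c₂ (Icc s (s + δ))

/-- For `q = q₀` the path is constant and its speed zero. The speed is continuous in `(q, t)`, so
compactness of `[0, 1]` makes it uniformly small for `q` near `q₀`. -/
theorem eventually_length_lt {M : Type*} [NormedAddCommGroup M] [NormedSpace ℝ M] {F : M → Amb n}
    (hFs : ContDiff ℝ ∞ F) {φ : ℝ → ℝ} (hφs : ContDiff ℝ ∞ φ) {q₀ : M} (hq₀ : ‖(F q₀).1‖ < 1)
    {ε : ℝ} (hε : 0 < ε) :
    ∀ᶠ q in 𝓝 q₀, ∫ t in (0 : ℝ)..1, √(gHat (F (q + φ t • (q₀ - q)))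
      (deriv (fun t => F (q + φ t • (q₀ - q))) t) (deriv (fun t => F (q + φ t • (q₀ - q))) t))
      < ε := by
  set σ : M → ℝ → M := fun q t => q + φ t • (q₀ - q) with hσ
  have hσd : ∀ q t, HasDerivAt (σ q) (deriv φ t • (q₀ - q)) t := fun q t =>
    (((hφs.differentiable (by simp) t).hasDerivAt).smul_const (q₀ - q)).const_add q
  set g : M × ℝ → ℝ := fun y => √(gHat (F (σ y.1 y.2))
    (fderiv ℝ F (σ y.1 y.2) (deriv φ y.2 • (q₀ - y.1)))
    (fderiv ℝ F (σ y.1 y.2) (deriv φ y.2 • (q₀ - y.1)))) with hg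
  have hσ0 : ∀ t, σ q₀ t = q₀ := fun t => by simp [hσ]
  have hgev : ∀ t, ∀ᶠ y in 𝓝 (q₀, t), g y < ε / 2 := fun t => by
    have hσc : Continuous fun y : M × ℝ => σ y.1 y.2 :=
      continuous_fst.add ((hφs.continuous.comp continuous_snd).smul
        (continuous_const.sub continuous_fst))
    have hFc : Continuous (fderiv ℝ F) := hFs.continuous_fderiv (by simp)
    have hφc : Continuous (deriv φ) := hφs.continuous_deriv (by norm_cast)
    have hDc : Continuous fun y : M × ℝ =>
        fderiv ℝ F (σ y.1 y.2) (deriv φ y.2 • (q₀ - y.1)) :=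
      (hFc.comp hσc).clm_apply ((hφc.comp continuous_snd).smul
        (continuous_const.sub continuous_fst))
    have hlt : ‖(F (σ q₀ t)).1‖ < 1 := by rw [hσ0]; exact hq₀
    have hgc : ContinuousAt g (q₀, t) := by
      have hFσ : Continuous fun y : M × ℝ => F (σ y.1 y.2) := hFs.continuous.comp hσc
      have h1 := continuousAt_gHat (u := fderiv ℝ F (σ q₀ t) (deriv φ t • (q₀ - q₀)))
        (v := fderiv ℝ F (σ q₀ t) (deriv φ t • (q₀ - q₀))) hlt
      have h2 := (hFσ.prodMk (hDc.prodMk hDc)).continuousAt (x := (q₀, t))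
      have h3 := ContinuousAt.comp (x := (q₀, t)) h1 h2
      exact Real.continuous_sqrt.continuousAt.comp h3
    have hg0 : g (q₀, t) = 0 := by simp [hg, gHat]
    exact hgc.eventually_lt_const (by rw [hg0]; positivity)
  have htube : ∀ᶠ q in 𝓝 q₀, ∀ t ∈ Icc (0 : ℝ) 1, g (q, t) < ε / 2 :=
    isCompact_Icc.eventually_forall_of_forall_eventually fun t _ => hgev t
  filter_upwards [htube] with q hq1
  have hd : ∀ t, deriv (fun t => F (σ q t)) t = fderiv ℝ F (σ q t) (deriv φ t • (q₀ - q)) :=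
    fun t => ((hFs.differentiable (by simp) (σ q t)).hasFDerivAt.comp_hasDerivAt t (hσd q t)).deriv
  change ∫ t in (0 : ℝ)..1, √(gHat (F (σ q t)) (deriv (fun t => F (σ q t)) t)
    (deriv (fun t => F (σ q t)) t)) < ε
  simp only [hd]
  have hb := intervalIntegral.norm_integral_le_of_norm_le_const (a := 0) (b := 1) (C := ε / 2)
    (f := fun t => g (q, t)) fun t ht => by
      rw [uIoc_of_le zero_le_one] at ht
      rw [Real.norm_eq_abs, abs_of_nonneg (Real.sqrt_nonneg _)]
      exact (hq1 t ⟨ht.1.le, ht.2⟩).le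
  have := (le_abs_self _).trans hb
  simp only [sub_zero, abs_one, mul_one] at this
  exact lt_of_le_of_lt this (by linarith)

/-- On one side of a corner `c` agrees with a globally smooth curve. A segment in parameter space
between two points on that side stays there by convexity, and its image is smooth. -/
theorem eventually_joinedWithin_of_eqOn (he : ‖e‖ = 1) {c c₁ : ℝ → ℝ × ℝ} {I : Set ℝ}
    (hI : Convex ℝ I) (hc₁ : ContDiff ℝ ∞ c₁) (hcc : EqOn c c₁ I) {q₀ : ↥(ℝ ∙ e)ᗮ × ℝ}
    (hq₀ : ‖q₀.1‖ < 1) (hq₀I : q₀.2 ∈ I) {ε : ℝ} (hε : 0 < ε) :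
    ∀ᶠ q in 𝓝 q₀, q.2 ∈ I → JoinedWithin (paramDomain e ∅) (translationMap e c) ε q q₀ := by
  set F : ↥(ℝ ∙ e)ᗮ × ℝ → Amb n := fun q => fermiMap e (q.1, c₁ q.2) with hF
  have hFs : ContDiff ℝ ∞ F := (contDiff_fermiMap (e := e)).comp
    (contDiff_fst.prodMk (hc₁.comp contDiff_snd))
  -- `JoinedWithin` asks for a `C¹` image defined on all of `ℝ` and staying in the domain. With
  -- values in `[0, 1]` and the right endpoint values, this function never overshoots the segment.
  set φ := Real.smoothTransition with hφ
  have hφs : ContDiff ℝ ∞ φ := Real.smoothTransition.contDiff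
  have hball : ∀ᶠ q in 𝓝 q₀, ‖q.1‖ < 1 :=
    (continuous_fst.norm.tendsto q₀).eventually_lt_const hq₀
  have hlen := eventually_length_lt hFs hφs (q₀ := q₀) (norm_fermiMap_lt he (q := (_, _)) hq₀) hε
  filter_upwards [hlen, hball] with q hq1 hq2 hqI
  have hφ01 : ∀ t, 0 ≤ φ t ∧ φ t ≤ 1 := fun t =>
    ⟨Real.smoothTransition.nonneg t, Real.smoothTransition.le_one t⟩
  set σ : ℝ → ↥(ℝ ∙ e)ᗮ × ℝ := fun t => q + φ t • (q₀ - q) with hσ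
  have hσ1 : ∀ t, ‖(σ t).1‖ < 1 := fun t => by
    have := (convex_ball (0 : ↥(ℝ ∙ e)ᗮ) 1).add_smul_sub_mem (mem_ball_zero_iff.2 hq2)
      (mem_ball_zero_iff.2 hq₀) (hφ01 t)
    exact mem_ball_zero_iff.1 this
  have hσ2 : ∀ t, (σ t).2 ∈ I := fun t => hI.add_smul_sub_mem hqI hq₀I (hφ01 t)
  have heq : translationMap e c ∘ σ = fun t => F (σ t) := by
    funext t
    simp only [Function.comp, translationMap_eq he, hF, hcc (hσ2 t)]
  have hX : ∀ t, translationMap e c (σ t) = F (σ t) := fun t => congrFun heq t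
  have hσs : ContDiff ℝ ∞ σ := contDiff_const.add (hφs.smul contDiff_const)
  refine ⟨σ, hσs.continuous, fun t => ⟨hσ1 t, notMem_empty _⟩, ?_, ?_, ?_, ?_⟩
  · simp only [hσ, hφ, Real.smoothTransition.zero, zero_smul, add_zero]
  · simp only [hσ, hφ, Real.smoothTransition.one, one_smul, add_sub_cancel]
  · rw [heq]; exact (hFs.comp hσs).of_le (by norm_cast)
  · rw [heq]
    simp only [hX]
    exact hq1

theorem eventually_joinedWithin (he : ‖e‖ = 1) {c : ℝ → ℝ × ℝ} (hc : IsPiecewiseSmooth c)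
    {q₀ : ↥(ℝ ∙ e)ᗮ × ℝ} (hq₀ : ‖q₀.1‖ < 1) {ε : ℝ} (hε : 0 < ε) :
    ∀ᶠ q in 𝓝 q₀, JoinedWithin (paramDomain e ∅) (translationMap e c) ε q q₀ := by
  obtain ⟨c₁, c₂, h1, h2, δ, hδ, e1, e2⟩ := hc q₀.2
  have hs : ∀ᶠ q in 𝓝 q₀, q.2 ∈ Ioo (q₀.2 - δ) (q₀.2 + δ) :=
    (continuous_snd.tendsto q₀).eventually (Ioo_mem_nhds (by linarith) (by linarith))
  filter_upwards [hs, eventually_joinedWithin_of_eqOn he (convex_Icc _ _) h1 e1 hq₀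
    ⟨by linarith, le_rfl⟩ hε, eventually_joinedWithin_of_eqOn he (convex_Icc _ _) h2 e2 hq₀
    ⟨le_rfl, by linarith⟩ hε] with q hq k1 k2
  rcases le_total q.2 q₀.2 with h | h
  · exact k1 ⟨hq.1.le, h⟩
  · exact k2 ⟨h, hq.2.le⟩

theorem translationMap_mem (he : ‖e‖ = 1) {S : Type*} (c : S → ℝ × ℝ) {q : ↥(ℝ ∙ e)ᗮ × S}
    (hq : ‖q.1‖ < 1) : ‖(translationMap e c q).1‖ < 1 ∧
      footPoint e (translationMap e c q).1 = q.1 ∧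
      (signedDist e (translationMap e c q).1, (translationMap e c q).2) = c q.2 := by
  rw [translationMap_eq he]
  exact ⟨norm_fermiMap_lt he hq, footPoint_fermi he (inner_orthogonal _) hq _,
    Prod.ext (signedDist_fermi he (inner_orthogonal _) hq _) rfl⟩

/-- The hypersurface with boundary-free parameter domain is complete if the parameter along the
curve is controlled by the curve. -/
theorem isInducedComplete_paramDomain (he : ‖e‖ = 1) {c : ℝ → ℝ × ℝ} (hc : IsPiecewiseSmooth c)
    {δ₀ : ℝ} (hδ₀ : 0 < δ₀) (hsep : ∀ δ, 0 < δ → δ ≤ δ₀ → ∃ η > 0, ∀ s s', |s - s'| = δ →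
      η ≤ dist (c s) (c s')) :
    IsInducedComplete (paramDomain e ∅) (translationMap e c) := by
  intro u hu hC
  have hX : ∀ q ∈ paramDomain e ∅, ‖(translationMap e c q).1‖ < 1 := fun q hq =>
    (translationMap_mem he c hq.1).1
  obtain ⟨p, hp, hlim⟩ := exists_tendsto_of_joinedWithin hX hu hC
  have hz : ContinuousAt (fun x : Amb n => (signedDist e x.1, x.2)) p :=
    ((ContinuousAt.comp (f := Prod.fst) (contDiffAt_signedDist hp).continuousAt
      continuousAt_fst)).prodMk continuousAt_snd
  -- If the parameter moved by `min δ' δ₀` along a short path, the intermediate value theorem would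
  -- give two parameters exactly that far apart whose curve points both lie within `η / 2` of the
  -- limit, against the separation.
  have hcau : CauchySeq fun k => (u k).2 := by
    refine Metric.cauchySeq_iff.2 fun δ' hδ' => ?_
    obtain ⟨η, hη, hη'⟩ := hsep (min δ' δ₀) (lt_min hδ' hδ₀) (min_le_right _ _)
    obtain ⟨r, hr, hball⟩ := Metric.continuousAt_iff.1 hz (η / 2) (by positivity)
    obtain ⟨K, hK⟩ := hC (r / 2) (by positivity)
    obtain ⟨K', hK'⟩ := Metric.tendsto_atTop.1 hlim (r / 2) (by positivity)
    refine ⟨max K K', fun k hk l hl => ?_⟩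
    obtain ⟨σ, hσc, hσD, h0, h1, hσ, hlen⟩ :=
      hK l (le_of_max_le_left hl) k (le_of_max_le_left hk)
    have hnear : ∀ t ∈ Icc (0 : ℝ) 1, dist (c (σ t).2) (signedDist e p.1, p.2) < η / 2 :=
      fun t ht => by
      have hb := (path_bounds hσ (fun t => hX _ (hσD t)) hlen ht).1
      have h3 : dist (translationMap e c (σ t)) p < r := by
        have h4 := dist_triangle (translationMap e c (σ t)) (translationMap e c (u l)) p
        have h5 := hK' l (le_of_max_le_right hl)
        simp only [Function.comp, h0] at hb
        linarith
      have := hball h3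
      rwa [(translationMap_mem he c (hσD t).1).2.2] at this
    have hne : ∀ t ∈ Icc (0 : ℝ) 1, |(σ t).2 - (σ 0).2| ≠ min δ' δ₀ := fun t ht h => by
      have h3 := hη' _ _ h
      have h4 := dist_triangle_right (c (σ t).2) (c (σ 0).2) (signedDist e p.1, p.2)
      have h5 := hnear t ht
      have h6 := hnear 0 (by simp)
      linarith
    have hlt : |(σ 1).2 - (σ 0).2| < min δ' δ₀ := by
      by_contra hcon
      have hcont : ContinuousOn (fun t => |(σ t).2 - (σ 0).2|) (Icc 0 1) := by fun_prop
      obtain ⟨t, ht, ht'⟩ := intermediate_value_Icc zero_le_one hcont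
        (show min δ' δ₀ ∈ Icc _ _ from ⟨by simpa using (lt_min hδ' hδ₀).le, not_lt.1 hcon⟩)
      exact hne t ht ht'
    rw [h1, h0] at hlt
    exact lt_of_lt_of_le hlt (min_le_left _ _)
  obtain ⟨s, hs⟩ := cauchySeq_tendsto_of_complete hcau
  set a : ↥(ℝ ∙ e)ᗮ := ⟨footPoint e p.1, mem_orthogonal_footPoint he _⟩ with ha
  have ha1 : ‖a‖ < 1 := norm_footPoint_lt he hp
  have hua : Tendsto (fun k => (u k).1) atTop (𝓝 a) := by
    refine tendsto_subtype_rng.2 ?_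
    have h2 : ContinuousAt (fun x : Amb n => footPoint e x.1) p :=
      ContinuousAt.comp (f := Prod.fst) (contDiffAt_footPoint hp).continuousAt continuousAt_fst
    refine (h2.tendsto.comp hlim).congr fun k => ?_
    exact (translationMap_mem he c (hu k).1).2.1
  refine ⟨(a, s), ⟨ha1, by simp⟩, fun ε hε => ?_⟩
  have hut : Tendsto u atTop (𝓝 (a, s)) := by
    simpa using hua.prodMk_nhds hs
  exact eventually_atTop.1 (hut.eventually (eventually_joinedWithin he hc (q₀ := (a, s)) ha1 hε))

/-- By local injectivity and a Lebesgue number for one period, `c s ≠ c (s + δ)` for all small `δ >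
0`. The distance of these points is continuous and, up to the translation `w`, periodic in `s`, so
it attains a positive minimum. Self-intersections at larger parameter distance do no harm. -/
theorem exists_separation {c : ℝ → ℝ × ℝ} (hc : Continuous c) {L : ℝ} (hL : 0 < L) {w : ℝ × ℝ}
    (hper : ∀ s, c (s + L) = c s + w) (hinj : ∀ s, ∃ U ∈ 𝓝 s, InjOn c U) :
    ∃ δ₀ > 0, ∀ δ, 0 < δ → δ ≤ δ₀ → ∃ η > 0, ∀ s s', |s - s'| = δ →
      η ≤ dist (c s) (c s') := by
  have hperz : ∀ (k : ℤ) s, c (s + k * L) = c s + k • w := fun k => by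
    induction k using Int.induction_on with
    | zero => intro s; simp
    | succ k ih =>
      intro s
      rw [show s + ((k : ℤ) + 1 : ℤ) * L = (s + (k : ℤ) * L) + L by push_cast; ring, hper, ih,
        add_smul, one_smul, add_assoc]
    | pred k ih =>
      intro s
      have h := hper (s + (-(k : ℤ) - 1 : ℤ) * L)
      rw [show s + (-(k : ℤ) - 1 : ℤ) * L + L = s + (-(k : ℤ) : ℤ) * L by push_cast; ring, ih] at h
      rw [sub_smul, one_smul, ← add_sub_assoc, h, add_sub_cancel_right]
  choose U hU hUinj using hinj
  obtain ⟨r, hr, hrU⟩ := Metric.uniformity_basis_dist.lebesgue_number_lemma_nhds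
    (K := Icc (0 : ℝ) L) isCompact_Icc (U := U) fun s _ => hU s
  have hdist : ∀ (k : ℤ) s s', dist (c (s + k * L)) (c (s' + k * L)) = dist (c s) (c s') :=
    fun k s s' => by rw [hperz, hperz, dist_add_right]
  refine ⟨r / 2, by positivity, fun δ hδ hδr => ?_⟩
  obtain ⟨x, hx, hmin⟩ := isCompact_Icc.exists_isMinOn (nonempty_Icc.2 hL.le)
    (f := fun s => dist (c s) (c (s + δ))) (by fun_prop)
  refine ⟨dist (c x) (c (x + δ)), ?_, ?_⟩
  · refine dist_pos.2 fun h => ?_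
    obtain ⟨y, hy⟩ := hrU x hx
    have h1 : x ∈ U y := hy (by simpa [UniformSpace.ball] using hr)
    have h2 : x + δ ∈ U y := hy (by
      simp only [UniformSpace.ball, mem_preimage, mem_ofPred_eq, dist_self_add_right,
        Real.norm_eq_abs, abs_of_pos hδ]
      linarith)
    have := hUinj y h1 h2 h
    linarith
  · have key : ∀ s, dist (c x) (c (x + δ)) ≤ dist (c s) (c (s + δ)) := fun s => by
      have hk := toIcoMod_mem_Ico hL 0 s
      have h1 : s = toIcoMod hL 0 s + (toIcoDiv hL 0 s : ℤ) * L := by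
        have := toIcoMod_add_toIcoDiv_zsmul hL 0 s
        rw [zsmul_eq_mul] at this
        exact this.symm
      rw [h1, add_right_comm, hdist]
      exact hmin ⟨hk.1, by linarith [hk.2]⟩
    intro s s' hs
    rcases abs_cases (s - s') with ⟨h, -⟩ | ⟨h, -⟩
    · have : s = s' + δ := by linarith
      rw [this, dist_comm (c (s' + δ))]; exact key s'
    · have : s' = s + δ := by linarith
      rw [this]; exact key s

/-- A closed curve generates a complete set. -/
theorem isInducedComplete_translationHypersurface (he : ‖e‖ = 1) {C : Set (ℝ × ℝ)}
    (hC : IsClosed C) (hj : ∀ p ∈ translationHypersurface e C, ∀ ε > 0,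
      ∀ᶠ p' in 𝓝[translationHypersurface e C] p,
        JoinedWithin (translationHypersurface e C) id ε p' p) :
    IsInducedComplete (translationHypersurface e C) id := by
  intro u hu hCau
  have hX : ∀ q ∈ translationHypersurface e C, ‖(id q : Amb n).1‖ < 1 := fun q hq =>
    ((mem_translationHypersurface he).1 hq).1
  obtain ⟨p, hp, hlim⟩ := exists_tendsto_of_joinedWithin hX hu hCau
  have hz : ContinuousAt (fun x : Amb n => (signedDist e x.1, x.2)) p :=
    ((ContinuousAt.comp (f := Prod.fst) (contDiffAt_signedDist hp).continuousAt
      continuousAt_fst)).prodMk continuousAt_snd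
  have hpT : p ∈ translationHypersurface e C := by
    refine (mem_translationHypersurface he).2 ⟨hp, ?_⟩
    exact hC.mem_of_tendsto (hz.tendsto.comp hlim)
      (Eventually.of_forall fun k => ((mem_translationHypersurface he).1 (hu k)).2)
  refine ⟨p, hpT, fun ε hε => ?_⟩
  exact eventually_atTop.1 ((tendsto_nhdsWithin_iff.2
    ⟨hlim, Eventually.of_forall hu⟩).eventually (hj p hpT ε hε))

theorem joinedWithin_translationHypersurface {c : ℝ → ℝ × ℝ} {ε : ℝ} {q q' : ↥(ℝ ∙ e)ᗮ × ℝ}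
    (h : JoinedWithin (paramDomain e ∅) (translationMap e c) ε q q') :
    JoinedWithin (translationHypersurface e (range c)) id ε (translationMap e c q)
      (translationMap e c q') := by
  obtain ⟨σ, hσc, hσD, h0, h1, hσ, hlen⟩ := h
  refine ⟨translationMap e c ∘ σ, hσ.continuous, fun t => ?_, by simp [h0], by simp [h1], hσ, hlen⟩
  exact ⟨_, (hσD t).1, inner_orthogonal _, _, mem_range_self _, rfl⟩

end

end TranslationH

namespace TranslationH

noncomputable section

variable {n : ℕ} {e : EuclideanSpace ℝ (Fin n)}

/-! ### Singular points and self-intersections -/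

/-- The derivative of the foot point of a patch maps an `n`-dimensional space into `e^⟂`, of
dimension `n - 1`, and so kills some `v ≠ 0`. Along `s • v` the motion to first order takes place in
the profile curve alone. If differentiable curves in `C` must stop at this point, the derivative of
the patch kills `v` as well. -/
theorem not_hasImmersedPatchAt (he : ‖e‖ = 1) {C : Set (ℝ × ℝ)} {p : Amb n} (hp : ‖p.1‖ < 1)
    (hC : ∀ (ζ : ℝ → ℝ × ℝ) (ζ' : ℝ × ℝ), HasDerivAt ζ ζ' 0 → ζ 0 = (signedDist e p.1, p.2) →
      (∀ᶠ s in 𝓝 0, ζ s ∈ C) → ζ' = 0) :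
    ¬ HasImmersedPatchAt (translationHypersurface e C) p := by
  rintro ⟨f, hf, hf0, hinj, hev⟩
  have hfd : DifferentiableAt ℝ f 0 := hf.differentiableAt (by norm_num)
  set A : EuclideanSpace ℝ (Fin n) → EuclideanSpace ℝ (Fin n) := fun x => footPoint e (f x).1
    with hA
  have hAd : DifferentiableAt ℝ A 0 := by
    have h1 : DifferentiableAt ℝ (footPoint e) (f 0).1 :=
      (contDiffAt_footPoint (by rw [hf0]; exact hp)).differentiableAt (by simp)
    exact DifferentiableAt.comp (g := footPoint e) (f := fun x => (f x).1) 0 h1 hfd.fst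
  -- The derivative of the foot point already takes values in `e^⟂`; the projection only records
  -- this in the type, so that dimensions can be compared.
  set B : EuclideanSpace ℝ (Fin n) →ₗ[ℝ] ↥(ℝ ∙ e)ᗮ :=
    ((ℝ ∙ e)ᗮ.orthogonalProjectionOnto.comp (fderiv ℝ A 0)).toLinearMap with hB
  have hn : 0 < n := by
    rcases Nat.eq_zero_or_pos n with rfl | h
    · rw [Subsingleton.elim e 0, norm_zero] at he; exact absurd he zero_ne_one
    · exact h
  obtain ⟨v, hv, hv0⟩ : ∃ v ∈ LinearMap.ker B, v ≠ 0 := by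
    refine (Submodule.ne_bot_iff _).1 (LinearMap.ker_ne_bot_of_finrank_lt ?_)
    rw [finrank_orthogonal_singleton he]
    simp only [finrank_euclideanSpace, Fintype.card_fin]; omega
  have hline : HasDerivAt (fun s : ℝ => s • v) v 0 := by
    simpa using (hasDerivAt_id (0 : ℝ)).smul_const v
  have hfl : HasDerivAt (fun s : ℝ => f (s • v)) (fderiv ℝ f 0 v) 0 := by
    have h : HasFDerivAt f (fderiv ℝ f 0) ((0 : ℝ) • v) := by simpa using hfd.hasFDerivAt
    exact h.comp_hasDerivAt (0 : ℝ) hline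
  have hAl : HasDerivAt (fun s : ℝ => A (s • v)) (fderiv ℝ A 0 v) 0 := by
    have h : HasFDerivAt A (fderiv ℝ A 0) ((0 : ℝ) • v) := by simpa using hAd.hasFDerivAt
    exact h.comp_hasDerivAt (0 : ℝ) hline
  have hAv : fderiv ℝ A 0 v = 0 := by
    have h1 : HasDerivAt (fun s : ℝ => inner ℝ e (A (s • v))) (inner ℝ e (fderiv ℝ A 0 v)) 0 := by
      simpa using (hasDerivAt_const (0 : ℝ) e).inner ℝ hAl
    have h2 : (fun s : ℝ => inner ℝ e (A (s • v))) = fun _ => (0 : ℝ) :=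
      funext fun s => inner_footPoint he _
    rw [h2] at h1
    have h3 : inner ℝ e (fderiv ℝ A 0 v) = 0 := h1.unique (hasDerivAt_const _ _)
    have h4 : fderiv ℝ A 0 v ∈ (ℝ ∙ e)ᗮ :=
      Submodule.mem_orthogonal_singleton_iff_inner_right.2 h3
    have h5 : (ℝ ∙ e)ᗮ.orthogonalProjectionOnto (fderiv ℝ A 0 v) = 0 := hv
    have h6 := Submodule.starProjection_eq_self_iff.2 h4
    rw [← h6, Submodule.starProjection_apply, h5]; rfl
  have hx0 : ‖(f ((0 : ℝ) • v)).1‖ < 1 := by rw [zero_smul, hf0]; exact hp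
  have hρ : HasDerivAt (fun s : ℝ => signedDist e (f (s • v)).1)
      (fderiv ℝ (signedDist e) (f ((0 : ℝ) • v)).1 (fderiv ℝ f 0 v).1) 0 :=
    HasFDerivAt.comp_hasDerivAt (l := signedDist e) (f := fun s : ℝ => (f (s • v)).1) (0 : ℝ)
      ((contDiffAt_signedDist hx0).differentiableAt (by simp)).hasFDerivAt
      (hasDerivAt_fst_apply hfl)
  have hev' : ∀ᶠ s : ℝ in 𝓝 0, f (s • v) ∈ translationHypersurface e C := by
    have : Tendsto (fun s : ℝ => s • v) (𝓝 0) (𝓝 0) := by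
      simpa using hline.continuousAt.tendsto
    exact this.eventually hev
  have hz := hC (fun s => (signedDist e (f (s • v)).1, (f (s • v)).2)) _
    (hρ.prodMk (hasDerivAt_snd_apply hfl)) (by simp [hf0])
    (hev'.mono fun s hs => ((mem_translationHypersurface he).1 hs).2)
  rw [Prod.mk_eq_zero] at hz
  rw [hz.1] at hρ
  rw [hAv] at hAl
  have hfer := hasDerivAt_fermi (e := e) hAl hρ
  have h1 : (fun s : ℝ => fermi e (A (s • v)) (signedDist e (f (s • v)).1)) =ᶠ[𝓝 0]
      fun s => (f (s • v)).1 := hev'.mono fun s hs =>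
    fermi_footPoint he ((mem_translationHypersurface he).1 hs).1
  have h2 : (fderiv ℝ f 0 v).1 = 0 := by
    rw [(hasDerivAt_fst_apply hfl).unique (hfer.congr_of_eventuallyEq h1.symm)]
    simp [fermiDeriv]
  exact hv0 ((injective_iff_map_eq_zero _).1 hinj v (Prod.ext h2 hz.2))

theorem fderiv_translationMap_injective (he : ‖e‖ = 1) {c : ℝ → ℝ × ℝ} {q : ↥(ℝ ∙ e)ᗮ × ℝ}
    (hq : ‖q.1‖ < 1) (hc : DifferentiableAt ℝ c q.2) (h1 : deriv c q.2 ≠ 0) :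
    Function.Injective (fderiv ℝ (translationMap e c) q) := by
  refine (injective_iff_map_eq_zero _).2 fun u hu => ?_
  rw [fderiv_translationMap he hc] at hu
  have h0 := (injective_iff_map_eq_zero _).1
    (fderiv_fermiMap_injective he (q := (q.1, c q.2)) hq) _ hu
  rw [Prod.mk_eq_zero] at h0
  exact Prod.ext h0.1 ((smul_eq_zero.1 h0.2).resolve_right h1)

theorem contDiffAt_translationMap (he : ‖e‖ = 1) {c : ℝ → ℝ × ℝ} {q : ↥(ℝ ∙ e)ᗮ × ℝ}
    (hc : ContDiffAt ℝ ∞ c q.2) : ContDiffAt ℝ ∞ (translationMap e c) q := by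
  have h0 : translationMap e c = fermiMap e ∘ fun q : ↥(ℝ ∙ e)ᗮ × ℝ => (q.1, c q.2) :=
    funext fun q => translationMap_eq he c q
  rw [h0]
  exact (contDiff_fermiMap (e := e)).contDiffAt.comp q
    (contDiffAt_fst.prodMk (hc.comp q contDiffAt_snd))

theorem hasImmersedPatchAt_translationMap (he : ‖e‖ = 1) (hn : n ≠ 0) {c : ℝ → ℝ × ℝ}
    {q : ↥(ℝ ∙ e)ᗮ × ℝ} (hq : ‖q.1‖ < 1) (hc : ContDiffAt ℝ ∞ c q.2) (h1 : deriv c q.2 ≠ 0) :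
    HasImmersedPatchAt (translationHypersurface e (range c)) (translationMap e c q) := by
  let Ψ : EuclideanSpace ℝ (Fin n) ≃L[ℝ] ↥(ℝ ∙ e)ᗮ × ℝ :=
    ContinuousLinearEquiv.ofFinrankEq (by
      rw [Module.finrank_prod, finrank_orthogonal_singleton he]
      simp only [finrank_euclideanSpace, Fintype.card_fin, Module.finrank_self]; omega)
  have hX := contDiffAt_translationMap he hc
  have hΨ0 : q + Ψ 0 = q := by simp
  have hΨ : ContDiff ℝ 1 (fun x => q + Ψ x) := contDiff_const.add Ψ.contDiff
  refine ⟨fun x => translationMap e c (q + Ψ x), ?_, by simp, ?_, ?_⟩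
  · have hg : ContDiffAt ℝ 1 (translationMap e c) (q + Ψ 0) := by
      rw [hΨ0]; exact hX.of_le (by norm_cast)
    exact ContDiffAt.comp (g := translationMap e c) (f := fun x => q + Ψ x)
      (0 : EuclideanSpace ℝ (Fin n)) hg hΨ.contDiffAt
  · have h2 : HasFDerivAt (translationMap e c) (fderiv ℝ (translationMap e c) q) (q + Ψ 0) := by
      rw [hΨ0]; exact (hX.differentiableAt (by simp)).hasFDerivAt
    have h3 := h2.comp (0 : EuclideanSpace ℝ (Fin n))
      (Ψ.hasFDerivAt.const_add q)
    change Function.Injective (fderiv ℝ (translationMap e c ∘ fun x => q + Ψ x) 0)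
    rw [HasFDerivAt.fderiv h3]
    exact (fderiv_translationMap_injective he hq (hc.differentiableAt (by simp)) h1).comp
      Ψ.injective
  · have h4 : ∀ᶠ x in 𝓝 (0 : EuclideanSpace ℝ (Fin n)), ‖(q + Ψ x).1‖ < 1 :=
      (hΨ.continuous.fst.norm.tendsto 0).eventually_lt_const (by simpa using hq)
    filter_upwards [h4] with x hx
    exact ⟨_, hx, inner_orthogonal (q + Ψ x).1, _, mem_range_self _, rfl⟩

theorem exists_translationMap_eq {c : ℝ → ℝ × ℝ} {p : Amb n}
    (hp : p ∈ translationHypersurface e (range c)) :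
    ∃ q : ↥(ℝ ∙ e)ᗮ × ℝ, ‖q.1‖ < 1 ∧ translationMap e c q = p := by
  obtain ⟨a, ha, hea, _, ⟨s, rfl⟩, rfl⟩ := hp
  exact ⟨(⟨a, Submodule.mem_orthogonal_singleton_iff_inner_right.2 hea⟩, s), ha, rfl⟩

/-- Off `ρ = 0` the parametrization itself provides the patch; on `ρ = 0` the hypothesis `hC` on
velocities excludes every patch. -/
theorem isSingularAlong_of_corners (he : ‖e‖ = 1) (hn : n ≠ 0) {c : ℝ → ℝ × ℝ}
    (hc : ∀ s, (c s).1 ≠ 0 → ContDiffAt ℝ ∞ c s ∧ deriv c s ≠ 0) (h0 : ∃ s, (c s).1 = 0)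
    (hC : ∀ z ∈ range c, z.1 = 0 → ∀ (ζ : ℝ → ℝ × ℝ) (ζ' : ℝ × ℝ), HasDerivAt ζ ζ' 0 → ζ 0 = z →
      (∀ᶠ s in 𝓝 0, ζ s ∈ range c) → ζ' = 0) :
    IsSingularAlong e (translationHypersurface e (range c)) := by
  constructor
  · obtain ⟨s, hs⟩ := h0
    have h := translationMap_mem he c (q := ((0 : ↥(ℝ ∙ e)ᗮ), s)) (by simp)
    have h1 : signedDist e (translationMap e c ((0 : ↥(ℝ ∙ e)ᗮ), s)).1 = 0 := by
      rw [← hs, ← h.2.2]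
    exact ⟨_, (mem_translationHypersurface he).2 ⟨h.1, by rw [h.2.2]; exact mem_range_self _⟩,
      (signedDist_eq_zero_iff h.1).1 h1⟩
  · intro p hp
    have hp' := (mem_translationHypersurface he).1 hp
    rw [← signedDist_eq_zero_iff hp'.1]
    constructor
    · intro hnot
      by_contra hne
      obtain ⟨q, hq, rfl⟩ := exists_translationMap_eq hp
      have h2 := (translationMap_mem he c hq).2.2
      have h3 : (c q.2).1 ≠ 0 := by rw [← h2]; exact hne
      exact hnot (hasImmersedPatchAt_translationMap he hn hq (hc _ h3).1 (hc _ h3).2)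
    · intro hz
      exact not_hasImmersedPatchAt he hp'.1 (hC _ hp'.2 hz)

/-- The derivative of `fermiMap` is injective at the common point, so equal tangent spaces would
make the two curve velocities proportional. -/
theorem range_fderiv_translationMap_ne (he : ‖e‖ = 1) {c : ℝ → ℝ × ℝ} {a : ↥(ℝ ∙ e)ᗮ}
    (ha : ‖a‖ < 1) {s s' : ℝ} (hs : DifferentiableAt ℝ c s) (hs' : DifferentiableAt ℝ c s')
    (hcs : c s = c s')
    (hdet : (deriv c s).1 * (deriv c s').2 - (deriv c s).2 * (deriv c s').1 ≠ 0) :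
    (fderiv ℝ (translationMap e c) (a, s)).range ≠
      (fderiv ℝ (translationMap e c) (a, s')).range := by
  intro h
  have h1 : fderiv ℝ (translationMap e c) (a, s) (0, 1) ∈
      (fderiv ℝ (translationMap e c) (a, s)).range := LinearMap.mem_range_self _ _
  rw [h] at h1
  obtain ⟨u, hu⟩ := h1
  have hu' : fderiv ℝ (translationMap e c) (a, s') u =
    fderiv ℝ (translationMap e c) (a, s) (0, 1) := hu
  rw [fderiv_translationMap he (q := (a, s)) hs,
    fderiv_translationMap he (q := (a, s')) hs'] at hu'
  simp only [hcs] at hu'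
  have h2 := fderiv_fermiMap_injective he (q := (a, c s')) ha hu'
  have h3 : u.2 • deriv c s' = (1 : ℝ) • deriv c s := congrArg Prod.snd h2
  rw [one_smul] at h3
  refine hdet ?_
  rw [← h3]
  simp only [Prod.smul_fst, Prod.smul_snd, smul_eq_mul]
  ring

theorem locally_injective_translationMap (he : ‖e‖ = 1) {c : ℝ → ℝ × ℝ}
    (hinj : ∀ s, ∃ U ∈ 𝓝 s, InjOn c U) {q : ↥(ℝ ∙ e)ᗮ × ℝ} (hq : ‖q.1‖ < 1) :
    ∃ U ∈ 𝓝 q, InjOn (translationMap e c) U := by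
  obtain ⟨U, hU, hUi⟩ := hinj q.2
  refine ⟨Metric.ball 0 1 ×ˢ U, prod_mem_nhds (Metric.isOpen_ball.mem_nhds
    (mem_ball_zero_iff.2 hq)) hU, fun x hx y hy hxy => ?_⟩
  have hx1 := translationMap_mem he c (q := x) (mem_ball_zero_iff.1 hx.1)
  have hy1 := translationMap_mem he c (q := y) (mem_ball_zero_iff.1 hy.1)
  refine Prod.ext (Subtype.ext ?_) (hUi hx.2 hy.2 ?_)
  · rw [← hx1.2.1, hxy, hy1.2.1]
  · rw [← hx1.2.2, hxy, hy1.2.2]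

end

end TranslationH

namespace TranslationH

noncomputable section

/-! ### The generating curve in terms of its tangent angle -/

theorem hasDerivAt_J (m : ℕ) (r : ℝ) : HasDerivAt (J m) (Real.cosh r ^ m) r :=
  ((Real.continuous_cosh.pow m).integral_hasStrictDerivAt 0 r).hasDerivAt

theorem J_zero (m : ℕ) : J m 0 = 0 := intervalIntegral.integral_same

theorem contDiff_J (m : ℕ) : ContDiff ℝ ∞ (J m) := by
  refine contDiff_infty_iff_deriv.2 ⟨fun r => (hasDerivAt_J m r).differentiableAt, ?_⟩
  rw [funext fun r => (hasDerivAt_J m r).deriv]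
  exact Real.contDiff_cosh.pow m

theorem J_neg (m : ℕ) (r : ℝ) : J m (-r) = -J m r := by
  have h := intervalIntegral.integral_comp_neg (a := 0) (b := r) (fun t => Real.cosh t ^ m)
  simp only [Real.cosh_neg, neg_zero] at h
  rw [J, J, h, intervalIntegral.integral_symm]

theorem abs_tanh_lt_one (r : ℝ) : |Real.tanh r| < 1 :=
  abs_lt.2 ⟨Real.neg_one_lt_tanh r, Real.tanh_lt_one r⟩

theorem contDiff_tanh : ContDiff ℝ ∞ Real.tanh := by
  rw [funext Real.tanh_eq_sinh_div_cosh]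
  exact Real.contDiff_sinh.div Real.contDiff_cosh fun x => (Real.cosh_pos x).ne'

theorem sin_mul_tanh_lt_one (θ r : ℝ) : |Real.sin θ * Real.tanh r| < 1 := by
  rw [abs_mul]
  calc |Real.sin θ| * |Real.tanh r| ≤ 1 * |Real.tanh r| :=
        mul_le_mul_of_nonneg_right (Real.abs_sin_le_one θ) (abs_nonneg _)
    _ < 1 := by rw [one_mul]; exact abs_tanh_lt_one r

/-- The flux of a generating curve with tangent angle `θ` at distance `r`. -/
def flux (m : ℕ) (θ r : ℝ) : ℝ := Real.cosh r ^ m * Real.sin θ - m * J m r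

/-- The derivative is `-cosh^m r` times the curvature `m (1 - sin θ tanh r)` that the mean curvature
equation prescribes, hence strictly negative for `m > 0`. -/
theorem hasDerivAt_flux {m : ℕ} (hm : m ≠ 0) (θ r : ℝ) : HasDerivAt (flux m θ)
    (-(m * Real.cosh r ^ m * (1 - Real.sin θ * Real.tanh r))) r := by
  have h := (((Real.hasDerivAt_cosh r).pow m).mul_const (Real.sin θ)).sub
    ((hasDerivAt_J m r).const_mul (m : ℝ))
  refine h.congr_deriv ?_
  obtain ⟨k, rfl⟩ := Nat.exists_eq_succ_of_ne_zero hm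
  have hc := Real.cosh_pos r
  rw [Real.tanh_eq_sinh_div_cosh]
  simp only [Nat.succ_eq_add_one, Nat.add_sub_cancel, pow_succ]
  field_simp
  ring

theorem flux_strictAnti {m : ℕ} (hm : m ≠ 0) (θ : ℝ) : StrictAnti (flux m θ) := by
  refine strictAnti_of_deriv_neg fun r => ?_
  rw [(hasDerivAt_flux hm θ r).deriv]
  have h1 := (abs_lt.1 (sin_mul_tanh_lt_one θ r)).2
  have h2 : (0 : ℝ) < m := Nat.cast_pos.2 (Nat.pos_of_ne_zero hm)
  have h3 := Real.cosh_pos r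
  have : 0 < m * Real.cosh r ^ m * (1 - Real.sin θ * Real.tanh r) :=
    mul_pos (by positivity) (by linarith)
  linarith

/-- The derivative of the left side is `-m cosh^(m-1) r · e^(-r)`, and `cosh r · e^(-r) ≥ 1 / 2`
bounds it by `-1` once `m ≥ 2`. This is where `n ≥ 3` enters: for `m = 1` the left side is `e^(-r)`,
and the flux is not onto. -/
theorem cosh_pow_sub_J_le {m : ℕ} (hm : 2 ≤ m) {r : ℝ} (hr : 0 ≤ r) :
    Real.cosh r ^ m - m * J m r ≤ 1 - r := by
  have hd : ∀ x, HasDerivAt (fun r => Real.cosh r ^ m - m * J m r + r)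
      (m * Real.cosh x ^ (m - 1) * Real.sinh x - m * Real.cosh x ^ m + 1) x := fun x =>
    (((Real.hasDerivAt_cosh x).pow m).sub ((hasDerivAt_J m x).const_mul (m : ℝ))).add
      (hasDerivAt_id x)
  have hanti : Antitone fun r => Real.cosh r ^ m - m * J m r + r := by
    refine antitone_of_deriv_nonpos (fun x => (hd x).differentiableAt) fun x => ?_
    rw [(hd x).deriv]
    obtain ⟨k, rfl⟩ := Nat.exists_eq_add_of_le hm
    have h1 : 1 ≤ Real.cosh x := Real.one_le_cosh x
    have h2 : Real.cosh x - Real.sinh x = Real.exp (-x) := by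
      rw [Real.cosh_eq, Real.sinh_eq]; ring
    have h3 : 1 ≤ 2 * (Real.cosh x * Real.exp (-x)) := by
      have h4 : Real.exp x * Real.exp (-x) = 1 := by rw [← Real.exp_add]; simp
      rw [Real.cosh_eq]
      nlinarith [Real.exp_pos (-x)]
    have h5 : 1 ≤ Real.cosh x ^ k := one_le_pow₀ h1
    have h6 : (2 : ℝ) ≤ ((2 + k : ℕ) : ℝ) := by push_cast; linarith [Nat.cast_nonneg (α := ℝ) k]
    have h7 : 1 ≤ ((2 + k : ℕ) : ℝ) * Real.cosh x ^ k * (Real.cosh x * Real.exp (-x)) := by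
      have h8 : 0 < Real.cosh x * Real.exp (-x) := by positivity
      have h9 : (2 : ℝ) ≤ ((2 + k : ℕ) : ℝ) * Real.cosh x ^ k := by nlinarith
      nlinarith
    rw [show 2 + k - 1 = k + 1 by omega, show 2 + k = k + 1 + 1 by omega]
    rw [show 2 + k = k + 1 + 1 by omega] at h7
    have h10 : ((k + 1 + 1 : ℕ) : ℝ) * Real.cosh x ^ (k + 1) * Real.sinh x -
      ((k + 1 + 1 : ℕ) : ℝ) * Real.cosh x ^ (k + 1 + 1) + 1 =
      1 - ((k + 1 + 1 : ℕ) : ℝ) * Real.cosh x ^ k * (Real.cosh x * Real.exp (-x)) := by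
      rw [← h2]; ring
    linarith
  have := hanti hr
  simp only [Real.cosh_zero, one_pow, J_zero, mul_zero, sub_zero, add_zero] at this
  linarith

theorem exists_flux_eq {m : ℕ} (hm : 2 ≤ m) (d θ : ℝ) : ∃ r, flux m θ r = d := by
  have hc : Continuous (flux m θ) :=
    continuous_iff_continuousAt.2 fun r => (hasDerivAt_flux (by omega) θ r).continuousAt
  -- `sin θ ≤ 1` compares with `θ = π / 2`, where the linear bound at `1 + |d|` gives `-|d| ≤ d`;
  -- the lower bound uses `-1 ≤ sin θ` and the parity of `J` and `cosh`.
  have hup : flux m θ (1 + |d|) ≤ d := by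
    have h1 := cosh_pow_sub_J_le hm (r := 1 + |d|) (by positivity)
    have h2 : Real.cosh (1 + |d|) ^ m * Real.sin θ ≤ Real.cosh (1 + |d|) ^ m :=
      mul_le_of_le_one_right (by have := Real.cosh_pos (1 + |d|); positivity) (Real.sin_le_one θ)
    have h3 := neg_abs_le d
    rw [flux]; linarith
  have hlo : d ≤ flux m θ (-(1 + |d|)) := by
    have h1 := cosh_pow_sub_J_le hm (r := 1 + |d|) (by positivity)
    have h2 : 0 ≤ Real.cosh (1 + |d|) ^ m * (1 + Real.sin θ) :=
      mul_nonneg (by have := Real.cosh_pos (1 + |d|); positivity)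
        (by linarith [Real.neg_one_le_sin θ])
    have h3 := le_abs_self d
    rw [flux, J_neg, Real.cosh_neg]; linarith
  obtain ⟨r, -, hr⟩ := intermediate_value_Icc' (f := flux m θ)
    (show -(1 + |d|) ≤ 1 + |d| by linarith [abs_nonneg d]) hc.continuousOn ⟨hup, hlo⟩
  exact ⟨r, hr⟩

/-- The distance from the axis at the points with tangent angle `θ` of the generating curve
with flux `d`. -/
def profileDist (m : ℕ) (d θ : ℝ) : ℝ := Classical.epsilon fun r => flux m θ r = d

section

variable {m : ℕ} {d : ℝ}

theorem flux_profileDist (hm : 2 ≤ m) (d θ : ℝ) : flux m θ (profileDist m d θ) = d :=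
  Classical.epsilon_spec (exists_flux_eq hm d θ)

theorem profileDist_eq_iff (hm : 2 ≤ m) {θ r : ℝ} : profileDist m d θ = r ↔ flux m θ r = d := by
  constructor
  · rintro rfl; exact flux_profileDist hm d θ
  · intro h
    exact (flux_strictAnti (by omega) θ).injective ((flux_profileDist hm d θ).trans h.symm)

theorem le_profileDist_iff (hm : 2 ≤ m) {θ r : ℝ} : r ≤ profileDist m d θ ↔ d ≤ flux m θ r := by
  conv_rhs => rw [← flux_profileDist hm d θ]
  exact ((flux_strictAnti (by omega) θ).le_iff_ge).symm

theorem profileDist_le_iff (hm : 2 ≤ m) {θ r : ℝ} : profileDist m d θ ≤ r ↔ flux m θ r ≤ d := by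
  conv_rhs => rw [← flux_profileDist hm d θ]
  exact ((flux_strictAnti (by omega) θ).le_iff_ge).symm

/-- The flux sees `θ` only through `sin θ`, and `Classical.epsilon` of equal predicates is equal.
This is the source of the symmetry `θ ↦ π - θ` and of the period `2 π`. -/
theorem profileDist_congr {θ θ' : ℝ} (h : Real.sin θ = Real.sin θ') :
    profileDist m d θ = profileDist m d θ' := by
  unfold profileDist flux; rw [h]

theorem contDiff_profileDist (hm : 2 ≤ m) (d : ℝ) : ContDiff ℝ ∞ (profileDist m d) := by
  refine contDiff_iff_contDiffAt.2 fun θ => ?_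
  set F : ℝ × ℝ → ℝ := fun u => flux m u.1 u.2 with hF
  have hFs : ContDiff ℝ ∞ F :=
    ((((Real.contDiff_cosh.comp contDiff_snd).pow m).mul (Real.contDiff_sin.comp contDiff_fst)).sub
      (contDiff_const.mul ((contDiff_J m).comp contDiff_snd)))
  set u : ℝ × ℝ := (θ, profileDist m d θ) with hu
  have hFu : ContDiffAt ℝ ∞ F u := hFs.contDiffAt
  -- The partial derivative in `r` that the implicit function theorem requires to be nonzero.
  -- Uniqueness of the solution then identifies the implicit function with `profileDist`.
  set D := -(m * Real.cosh (profileDist m d θ) ^ m *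
    (1 - Real.sin θ * Real.tanh (profileDist m d θ))) with hD
  have hD0 : D ≠ 0 := by
    have h1 := (abs_lt.1 (sin_mul_tanh_lt_one θ (profileDist m d θ))).2
    have h2 : (0 : ℝ) < m := Nat.cast_pos.2 (by omega)
    have h3 := Real.cosh_pos (profileDist m d θ)
    exact neg_ne_zero.2 (mul_pos (by positivity) (by linarith)).ne'
  have h1 : (fderiv ℝ F u ∘L ContinuousLinearMap.inr ℝ ℝ ℝ) =
      ContinuousLinearMap.toSpanSingleton ℝ D := by
    have h2 : HasFDerivAt (F ∘ fun r : ℝ => (θ, r))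
        (fderiv ℝ F u ∘L ContinuousLinearMap.inr ℝ ℝ ℝ) (profileDist m d θ) :=
      (hFu.differentiableAt (by simp)).hasFDerivAt.comp _ (hasFDerivAt_prodMk_right θ _)
    exact h2.unique (hasDerivAt_flux (by omega) θ (profileDist m d θ)).hasFDerivAt
  have hinv : (fderiv ℝ F u ∘L ContinuousLinearMap.inr ℝ ℝ ℝ).IsInvertible := by
    rw [h1]
    refine ⟨ContinuousLinearEquiv.unitsEquivAut ℝ (Units.mk0 D hD0), ?_⟩
    ext; simp
  have hne : (∞ : WithTop ℕ∞) ≠ 0 := by simp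
  refine (hFu.contDiffAt_implicitFunction hne hinv).congr_of_eventuallyEq ?_
  filter_upwards [hFu.eventually_apply_implicitFunction hne hinv] with x hx
  refine (profileDist_eq_iff hm).2 ?_
  have h3 : F u = d := flux_profileDist hm d θ
  rw [← h3]; exact hx

/-- The derivative of arc length with respect to the tangent angle. -/
def arcDensity (m : ℕ) (d θ : ℝ) : ℝ :=
  (m * (1 - Real.sin θ * Real.tanh (profileDist m d θ)))⁻¹

theorem arcDensity_denom_pos (hm : 2 ≤ m) (d θ : ℝ) :
    0 < m * (1 - Real.sin θ * Real.tanh (profileDist m d θ)) := by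
  have h1 := (abs_lt.1 (sin_mul_tanh_lt_one θ (profileDist m d θ))).2
  have h2 : (0 : ℝ) < m := Nat.cast_pos.2 (by omega)
  exact mul_pos h2 (by linarith)

theorem arcDensity_pos (hm : 2 ≤ m) (d θ : ℝ) : 0 < arcDensity m d θ :=
  inv_pos.2 (arcDensity_denom_pos hm d θ)

theorem arcDensity_congr {θ θ' : ℝ} (h : Real.sin θ = Real.sin θ') :
    arcDensity m d θ = arcDensity m d θ' := by
  rw [arcDensity, arcDensity, h, profileDist_congr h]

/-- The curvature is less than `2 m`; this makes arc length run through all of `ℝ`. -/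
theorem le_arcDensity (hm : 2 ≤ m) (d θ : ℝ) : (2 * m : ℝ)⁻¹ ≤ arcDensity m d θ := by
  have h1 := (abs_lt.1 (sin_mul_tanh_lt_one θ (profileDist m d θ))).1
  have h2 : (0 : ℝ) < m := Nat.cast_pos.2 (by omega)
  refine inv_anti₀ (arcDensity_denom_pos hm d θ) ?_
  nlinarith

theorem contDiff_arcDensity (hm : 2 ≤ m) (d : ℝ) : ContDiff ℝ ∞ (arcDensity m d) :=
  (contDiff_const.mul (contDiff_const.sub (Real.contDiff_sin.mul
    (contDiff_tanh.comp (contDiff_profileDist hm d))))).inv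
    fun θ => (arcDensity_denom_pos hm d θ).ne'

/-- Obtained by differentiating `flux m θ (profileDist m d θ) = d`. With `ds = arcDensity dθ` it
reads `dρ = cos θ ds`, so that `θ` is a genuine tangent angle. -/
theorem hasDerivAt_profileDist (hm : 2 ≤ m) (d θ : ℝ) :
    HasDerivAt (profileDist m d) (Real.cos θ * arcDensity m d θ) θ := by
  have hP := ((contDiff_profileDist hm d).differentiable (by simp) θ).hasDerivAt
  set r := profileDist m d θ with hr
  have h1 : HasDerivAt (fun θ => flux m θ (profileDist m d θ))
      (-(m * Real.cosh r ^ m * (1 - Real.sin θ * Real.tanh r)) * deriv (profileDist m d) θ +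
        Real.cosh r ^ m * Real.cos θ) θ := by
    have hc : HasDerivAt (fun θ => Real.cosh (profileDist m d θ) ^ m)
      (m * Real.cosh r ^ (m - 1) * (Real.sinh r * deriv (profileDist m d) θ)) θ := hP.cosh.pow m
    have h := (hc.mul (Real.hasDerivAt_sin θ)).sub
      (((hasDerivAt_J m r).comp θ hP).const_mul (m : ℝ))
    refine h.congr_deriv ?_
    rw [← hr]
    obtain ⟨k, rfl⟩ := Nat.exists_eq_add_of_le hm
    have hcp := Real.cosh_pos r
    rw [Real.tanh_eq_sinh_div_cosh, show 2 + k - 1 = k + 1 by omega,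
      show 2 + k = k + 1 + 1 by omega]
    simp only [pow_succ]
    field_simp
    ring
  have h2 : (fun θ => flux m θ (profileDist m d θ)) = fun _ => d :=
    funext fun θ => flux_profileDist hm d θ
  rw [h2] at h1
  have h3 := h1.unique (hasDerivAt_const θ d)
  have h4 := arcDensity_denom_pos hm d θ
  have hcp : 0 < Real.cosh r ^ m := by have := Real.cosh_pos r; positivity
  have h5 : deriv (profileDist m d) θ = Real.cos θ * arcDensity m d θ := by
    rw [arcDensity, eq_mul_inv_iff_mul_eq₀ h4.ne']
    rw [← hr]
    have h6 : Real.cosh r ^ m * (deriv (profileDist m d) θ *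
        (m * (1 - Real.sin θ * Real.tanh r)) - Real.cos θ) = 0 := by linarith
    have := (mul_eq_zero.1 h6).resolve_left hcp.ne'
    linarith
  rw [← h5]; exact hP

/-- Arc length as a function of the tangent angle. -/
def arcLength (m : ℕ) (d θ : ℝ) : ℝ := ∫ φ in (0 : ℝ)..θ, arcDensity m d φ

/-- Height as a function of the tangent angle. -/
def height (m : ℕ) (d θ : ℝ) : ℝ := ∫ φ in (0 : ℝ)..θ, Real.sin φ * arcDensity m d φ

theorem hasDerivAt_arcLength (hm : 2 ≤ m) (d θ : ℝ) :
    HasDerivAt (arcLength m d) (arcDensity m d θ) θ :=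
  ((contDiff_arcDensity hm d).continuous.integral_hasStrictDerivAt 0 θ).hasDerivAt

theorem hasDerivAt_height (hm : 2 ≤ m) (d θ : ℝ) :
    HasDerivAt (height m d) (Real.sin θ * arcDensity m d θ) θ :=
  ((Real.continuous_sin.mul (contDiff_arcDensity hm d).continuous).integral_hasStrictDerivAt
    0 θ).hasDerivAt

theorem contDiff_arcLength (hm : 2 ≤ m) (d : ℝ) : ContDiff ℝ ∞ (arcLength m d) := by
  refine contDiff_infty_iff_deriv.2
    ⟨fun r => (hasDerivAt_arcLength hm d r).differentiableAt, ?_⟩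
  rw [funext fun r => (hasDerivAt_arcLength hm d r).deriv]
  exact contDiff_arcDensity hm d

theorem contDiff_height (hm : 2 ≤ m) (d : ℝ) : ContDiff ℝ ∞ (height m d) := by
  refine contDiff_infty_iff_deriv.2 ⟨fun r => (hasDerivAt_height hm d r).differentiableAt, ?_⟩
  rw [funext fun r => (hasDerivAt_height hm d r).deriv]
  exact Real.contDiff_sin.mul (contDiff_arcDensity hm d)

theorem arcLength_strictMono (hm : 2 ≤ m) (d : ℝ) : StrictMono (arcLength m d) :=
  strictMono_of_deriv_pos fun θ => by
    rw [(hasDerivAt_arcLength hm d θ).deriv]; exact arcDensity_pos hm d θ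

theorem arcLength_surjective (hm : 2 ≤ m) (d : ℝ) : Function.Surjective (arcLength m d) := by
  have hmono : Monotone fun θ => arcLength m d θ - (2 * m : ℝ)⁻¹ * θ := by
    have hd : ∀ θ, HasDerivAt (fun θ => arcLength m d θ - (2 * m : ℝ)⁻¹ * θ)
      (arcDensity m d θ - (2 * m : ℝ)⁻¹) θ := fun θ =>
      ((hasDerivAt_arcLength hm d θ).sub ((hasDerivAt_id θ).const_mul (2 * m : ℝ)⁻¹)).congr_deriv
        (by rw [mul_one])
    refine monotone_of_deriv_nonneg (fun θ => (hd θ).differentiableAt) fun θ => ?_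
    rw [(hd θ).deriv]; linarith [le_arcDensity hm d θ]
  have h0 : arcLength m d 0 = 0 := intervalIntegral.integral_same
  have hpos : (0 : ℝ) < (2 * m : ℝ)⁻¹ := by
    have h2 : (0 : ℝ) < m := Nat.cast_pos.2 (by omega)
    positivity
  refine (contDiff_arcLength hm d).continuous.surjective ?_ ?_
  · refine tendsto_atTop_mono' _ ?_ (tendsto_id.const_mul_atTop hpos)
    filter_upwards [eventually_ge_atTop 0] with θ hθ
    have := hmono hθ
    simp only [h0, mul_zero, sub_zero] at this
    simp only [id]; linarith
  · refine tendsto_atBot_mono' _ ?_ (tendsto_id.const_mul_atBot hpos)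
    filter_upwards [eventually_le_atBot 0] with θ hθ
    have := hmono hθ
    simp only [h0, mul_zero, sub_zero] at this
    simp only [id]; linarith

end

/-- Arc length as a homeomorphism of the line. -/
def arcHomeomorph {m : ℕ} (hm : 2 ≤ m) (d : ℝ) : ℝ ≃ₜ ℝ :=
  ((arcLength_strictMono hm d).orderIsoOfSurjective _ (arcLength_surjective hm d)).toHomeomorph

/-- The tangent angle as a function of arc length. -/
def angle {m : ℕ} (hm : 2 ≤ m) (d s : ℝ) : ℝ := (arcHomeomorph hm d).symm s

section

variable {m : ℕ} {d : ℝ}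

theorem arcLength_angle (hm : 2 ≤ m) (d s : ℝ) : arcLength m d (angle hm d s) = s :=
  (arcHomeomorph hm d).apply_symm_apply s

theorem angle_arcLength (hm : 2 ≤ m) (d θ : ℝ) : angle hm d (arcLength m d θ) = θ :=
  (arcHomeomorph hm d).symm_apply_apply θ

theorem contDiff_angle (hm : 2 ≤ m) (d : ℝ) : ContDiff ℝ ∞ (angle hm d) :=
  (arcHomeomorph hm d).contDiff_symm_deriv (fun θ => (arcDensity_pos hm d θ).ne')
    (hasDerivAt_arcLength hm d) (contDiff_arcLength hm d)

theorem hasDerivAt_angle (hm : 2 ≤ m) (d s : ℝ) :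
    HasDerivAt (angle hm d) (arcDensity m d (angle hm d s))⁻¹ s :=
  HasDerivAt.of_local_left_inverse (contDiff_angle hm d).continuous.continuousAt
    (hasDerivAt_arcLength hm d _) (arcDensity_pos hm d _).ne'
    (Eventually.of_forall fun s => arcLength_angle hm d s)

theorem angle_strictMono (hm : 2 ≤ m) (d : ℝ) : StrictMono (angle hm d) :=
  ((arcLength_strictMono hm d).orderIsoOfSurjective _ (arcLength_surjective hm d)).symm.strictMono

/-- The unit speed curve with flux `d`. -/
def fluxCurve (hm : 2 ≤ m) (d s : ℝ) : ℝ × ℝ :=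
  (profileDist m d (angle hm d s), height m d (angle hm d s))

theorem contDiff_fluxCurve (hm : 2 ≤ m) (d : ℝ) : ContDiff ℝ ∞ (fluxCurve hm d) :=
  ((contDiff_profileDist hm d).comp (contDiff_angle hm d)).prodMk
    ((contDiff_height hm d).comp (contDiff_angle hm d))

theorem hasDerivAt_fluxCurve (hm : 2 ≤ m) (d s : ℝ) : HasDerivAt (fluxCurve hm d)
    (Real.cos (angle hm d s), Real.sin (angle hm d s)) s := by
  have hw := (arcDensity_pos hm d (angle hm d s)).ne'
  have h1 := (hasDerivAt_profileDist hm d _).comp s (hasDerivAt_angle hm d s)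
  have h2 := (hasDerivAt_height hm d _).comp s (hasDerivAt_angle hm d s)
  rw [mul_assoc, mul_inv_cancel₀ hw, mul_one] at h1 h2
  exact h1.prodMk h2

theorem hasDerivAt_deriv_fluxCurve (hm : 2 ≤ m) (d s : ℝ) : HasDerivAt (deriv (fluxCurve hm d))
    (-Real.sin (angle hm d s) * (arcDensity m d (angle hm d s))⁻¹,
      Real.cos (angle hm d s) * (arcDensity m d (angle hm d s))⁻¹) s := by
  rw [funext fun s => (hasDerivAt_fluxCurve hm d s).deriv]
  exact ((Real.hasDerivAt_cos _).comp s (hasDerivAt_angle hm d s)).prodMk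
    ((Real.hasDerivAt_sin _).comp s (hasDerivAt_angle hm d s))

end

end

end TranslationH

namespace TranslationH

noncomputable section

/-! ### The height function -/

section

variable {m : ℕ} {d H : ℝ}

theorem flux_zero (m : ℕ) (θ : ℝ) : flux m θ 0 = Real.sin θ := by
  simp [flux, J_zero]

theorem R_eq (hH : ((m + 1 : ℕ) : ℝ) * H = m) (d t : ℝ) :
    R (m + 1) H d t = flux m (Real.pi / 2) t - d := by
  rw [R, flux, hH, Real.sin_pi_div_two, mul_one, Nat.add_sub_cancel]

theorem S_eq (hH : ((m + 1 : ℕ) : ℝ) * H = m) (d t : ℝ) :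
    S (m + 1) H d t = d - flux m (-(Real.pi / 2)) t := by
  rw [S, flux, hH, Real.sin_neg, Real.sin_pi_div_two, Nat.add_sub_cancel]; ring

theorem profileDist_strictMonoOn (hm : 2 ≤ m) (d : ℝ) :
    StrictMonoOn (profileDist m d) (Icc (-(Real.pi / 2)) (Real.pi / 2)) := by
  refine strictMonoOn_of_deriv_pos (convex_Icc _ _)
    (contDiff_profileDist hm d).continuous.continuousOn fun θ hθ => ?_
  rw [interior_Icc] at hθ
  rw [(hasDerivAt_profileDist hm d θ).deriv]
  exact mul_pos (Real.cos_pos_of_mem_Ioo hθ) (arcDensity_pos hm d θ)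

theorem le_sin_arcsin (hd : d ≤ 1) : d ≤ Real.sin (Real.arcsin d) := by
  rcases le_total (-1) d with h | h
  · rw [Real.sin_arcsin h hd]
  · rw [Real.arcsin_of_le_neg_one h, Real.sin_neg, Real.sin_pi_div_two]; exact h

theorem profileDist_arcsin_nonneg (hm : 2 ≤ m) (hd : d ≤ 1) :
    0 ≤ profileDist m d (Real.arcsin d) := by
  rw [le_profileDist_iff hm, flux_zero]; exact le_sin_arcsin hd

theorem profileDist_arcsin_eq_zero (hm : 2 ≤ m) (h1 : -1 ≤ d) (hd : d ≤ 1) :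
    profileDist m d (Real.arcsin d) = 0 := by
  rw [profileDist_eq_iff hm, flux_zero, Real.sin_arcsin h1 hd]

theorem leftEnd_eq (hm : 2 ≤ m) (hH : ((m + 1 : ℕ) : ℝ) * H = m) (hd : d < 1) :
    leftEnd (m + 1) H d = profileDist m d (Real.arcsin d) := by
  have h : {t | 0 ≤ t ∧ 0 ≤ S (m + 1) H d t} = Ici (profileDist m d (Real.arcsin d)) := by
    ext t
    rw [mem_ofPred_eq, S_eq hH, sub_nonneg, ← profileDist_le_iff hm, mem_Ici]
    -- For `-1 ≤ d` the condition on `S` holds on all of `[0, ∞)` and the infimum is `0`. For `d ≤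
    -- -1` it is the zero of `S`, and `arcsin d` has its clamped value `-π / 2`.
    rcases le_total (-1) d with h1 | h1
    · rw [profileDist_arcsin_eq_zero hm h1 hd.le]
      have : profileDist m d (-(Real.pi / 2)) ≤ 0 := by
        rw [profileDist_le_iff hm, flux_zero, Real.sin_neg, Real.sin_pi_div_two]; exact h1
      exact ⟨fun h => h.1, fun h => ⟨h, this.trans h⟩⟩
    · have h0 := profileDist_arcsin_nonneg (d := d) hm hd.le
      rw [Real.arcsin_of_le_neg_one h1] at h0 ⊢
      exact ⟨fun h => h.2, fun h => ⟨h0.trans h, h⟩⟩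
  rw [leftEnd, h, csInf_Ici]

theorem rightEnd_eq (hm : 2 ≤ m) (hH : ((m + 1 : ℕ) : ℝ) * H = m) (hd : d < 1) :
    rightEnd (m + 1) H d = profileDist m d (Real.pi / 2) := by
  have h0 : 0 ≤ profileDist m d (Real.pi / 2) := by
    rw [le_profileDist_iff hm, flux_zero, Real.sin_pi_div_two]; exact hd.le
  have h : {t | 0 ≤ t ∧ 0 ≤ R (m + 1) H d t} = Icc 0 (profileDist m d (Real.pi / 2)) := by
    ext t
    rw [mem_ofPred_eq, R_eq hH, sub_nonneg, ← le_profileDist_iff hm, mem_Icc]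
  rw [rightEnd, h, csSup_Icc h0]

/-- The sine of the tangent angle of the graph of the height function. -/
def sinAngle (m : ℕ) (d r : ℝ) : ℝ := (m * J m r + d) / Real.cosh r ^ m

theorem flux_eq_iff {θ r : ℝ} : flux m θ r = d ↔ sinAngle m d r = Real.sin θ := by
  have h : 0 < Real.cosh r ^ m := by have := Real.cosh_pos r; positivity
  rw [flux, sinAngle, div_eq_iff h.ne']
  constructor <;> intro h <;> linarith

theorem sinAngle_profileDist (hm : 2 ≤ m) (d θ : ℝ) :
    sinAngle m d (profileDist m d θ) = Real.sin θ := flux_eq_iff.1 (flux_profileDist hm d θ)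

theorem arcsin_sinAngle_profileDist (hm : 2 ≤ m) {θ : ℝ}
    (hθ : θ ∈ Icc (-(Real.pi / 2)) (Real.pi / 2)) :
    Real.arcsin (sinAngle m d (profileDist m d θ)) = θ := by
  rw [sinAngle_profileDist hm, Real.arcsin_sin hθ.1 hθ.2]

theorem continuous_sinAngle (m : ℕ) (d : ℝ) : Continuous (sinAngle m d) :=
  ((continuous_const.mul (contDiff_J m).continuous).add continuous_const).div
    (Real.continuous_cosh.pow m) fun r => by have := Real.cosh_pos r; positivity

theorem exists_profileDist_eq (hm : 2 ≤ m) {θ₁ θ₂ : ℝ} (h : θ₁ ≤ θ₂) {r : ℝ}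
    (hr : r ∈ Icc (profileDist m d θ₁) (profileDist m d θ₂)) :
    ∃ θ ∈ Icc θ₁ θ₂, profileDist m d θ = r :=
  intermediate_value_Icc h (contDiff_profileDist hm d).continuous.continuousOn hr

theorem arcsin_mem_Ico (hd : d < 1) : Real.arcsin d ∈ Ico (-(Real.pi / 2)) (Real.pi / 2) :=
  ⟨Real.neg_pi_div_two_le_arcsin d, Real.arcsin_lt_pi_div_two.2 hd⟩

/-- `arcsin ∘ sinAngle` inverts `profileDist` on angles between `arcsin d` and `π / 2`, where `cos θ
> 0`; the derivative is that of an inverse function. -/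
theorem hasDerivAt_arcsin_sinAngle (hm : 2 ≤ m) (hd : d < 1) {r : ℝ}
    (hr : r ∈ Ioo (profileDist m d (Real.arcsin d)) (profileDist m d (Real.pi / 2))) :
    Real.arcsin (sinAngle m d r) ∈ Ioo (Real.arcsin d) (Real.pi / 2) ∧
    profileDist m d (Real.arcsin (sinAngle m d r)) = r ∧
    HasDerivAt (fun r => Real.arcsin (sinAngle m d r))
      (Real.cos (Real.arcsin (sinAngle m d r)) *
        arcDensity m d (Real.arcsin (sinAngle m d r)))⁻¹ r := by
  have hα := arcsin_mem_Ico hd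
  have key : ∀ x ∈ Ioo (profileDist m d (Real.arcsin d)) (profileDist m d (Real.pi / 2)),
      Real.arcsin (sinAngle m d x) ∈ Ioo (Real.arcsin d) (Real.pi / 2) ∧
      profileDist m d (Real.arcsin (sinAngle m d x)) = x := fun x hx => by
    obtain ⟨θ, hθ, rfl⟩ := exists_profileDist_eq hm hα.2.le (Ioo_subset_Icc_self hx)
    have hθ' : θ ∈ Icc (-(Real.pi / 2)) (Real.pi / 2) := ⟨hα.1.trans hθ.1, hθ.2⟩
    rw [arcsin_sinAngle_profileDist hm hθ']
    refine ⟨⟨lt_of_le_of_ne hθ.1 ?_, lt_of_le_of_ne hθ.2 ?_⟩, rfl⟩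
    · rintro rfl; exact lt_irrefl _ hx.1
    · rintro rfl; exact lt_irrefl _ hx.2
  obtain ⟨h1, h2⟩ := key r hr
  refine ⟨h1, h2, ?_⟩
  refine HasDerivAt.of_local_left_inverse
    (Real.continuous_arcsin.comp (continuous_sinAngle m d)).continuousAt
    (hasDerivAt_profileDist hm d _) ?_ ?_
  · exact (mul_pos (Real.cos_pos_of_mem_Ioo ⟨lt_of_le_of_lt hα.1 h1.1, h1.2⟩)
      (arcDensity_pos hm d _)).ne'
  · filter_upwards [isOpen_Ioo.mem_nhds hr] with x hx
    exact (key x hx).2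

theorem R_mul_S (hH : ((m + 1 : ℕ) : ℝ) * H = m) (d t : ℝ) :
    R (m + 1) H d t * S (m + 1) H d t = (Real.cosh t ^ m) ^ 2 * (1 - sinAngle m d t ^ 2) := by
  have h : 0 < Real.cosh t ^ m := by have := Real.cosh_pos t; positivity
  rw [R, S, hH, Nat.add_sub_cancel, sinAngle]
  field_simp
  ring

theorem sqrt_R_mul_S (hH : ((m + 1 : ℕ) : ℝ) * H = m) (d t : ℝ) :
    √(R (m + 1) H d t * S (m + 1) H d t) =
      Real.cosh t ^ m * Real.cos (Real.arcsin (sinAngle m d t)) := by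
  have h : 0 < Real.cosh t ^ m := by have := Real.cosh_pos t; positivity
  rw [R_mul_S hH, Real.cos_arcsin, Real.sqrt_mul (sq_nonneg _), Real.sqrt_sq h.le]

theorem slope_eq (hH : ((m + 1 : ℕ) : ℝ) * H = m) (d t : ℝ) :
    TranslationH.slope (m + 1) H d t =
      sinAngle m d t / Real.cos (Real.arcsin (sinAngle m d t)) := by
  have h : 0 < Real.cosh t ^ m := by have := Real.cosh_pos t; positivity
  rw [TranslationH.slope, sqrt_R_mul_S hH, hH, Nat.add_sub_cancel, ← div_div, sinAngle]

theorem sin_arcsin_sinAngle (hm : 2 ≤ m) (hd : d < 1) {r : ℝ}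
    (hr : r ∈ Icc (profileDist m d (Real.arcsin d)) (profileDist m d (Real.pi / 2))) :
    Real.sin (Real.arcsin (sinAngle m d r)) = sinAngle m d r := by
  obtain ⟨θ, -, rfl⟩ := exists_profileDist_eq hm (arcsin_mem_Ico hd).2.le hr
  rw [sinAngle_profileDist hm, Real.sin_arcsin (Real.neg_one_le_sin θ) (Real.sin_le_one θ)]

theorem hasDerivAt_height_arcsin (hm : 2 ≤ m) (hH : ((m + 1 : ℕ) : ℝ) * H = m) (hd : d < 1) {r : ℝ}
    (hr : r ∈ Ioo (profileDist m d (Real.arcsin d)) (profileDist m d (Real.pi / 2))) :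
    HasDerivAt (fun r => height m d (Real.arcsin (sinAngle m d r)))
      (TranslationH.slope (m + 1) H d r) r := by
  obtain ⟨h1, -, h3⟩ := hasDerivAt_arcsin_sinAngle hm hd hr
  refine ((hasDerivAt_height hm d _).comp r h3).congr_deriv ?_
  have hw := arcDensity_pos hm d (Real.arcsin (sinAngle m d r))
  rw [slope_eq hH, sin_arcsin_sinAngle hm hd (Ioo_subset_Icc_self hr), mul_inv]
  field_simp

theorem intervalIntegrable_slope (hm : 2 ≤ m) (hH : ((m + 1 : ℕ) : ℝ) * H = m) (hd : d < 1) :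
    IntervalIntegrable (TranslationH.slope (m + 1) H d) volume
      (profileDist m d (Real.arcsin d)) (profileDist m d (Real.pi / 2)) := by
  have hα := arcsin_mem_Ico hd
  have hle : profileDist m d (Real.arcsin d) ≤ profileDist m d (Real.pi / 2) :=
    (profileDist_strictMonoOn hm d).monotoneOn ⟨hα.1, hα.2.le⟩ ⟨by linarith [Real.pi_pos], le_rfl⟩
      hα.2.le
  -- `1 / cos θ = ds / dρ` is nonnegative and has the continuous primitive arc length, hence is
  -- integrable although unbounded at the right end. It dominates the slope because `|sin θ| ≤ 1`.
  have hA : ∀ r ∈ Ioo (profileDist m d (Real.arcsin d)) (profileDist m d (Real.pi / 2)),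
      HasDerivAt (fun r => arcLength m d (Real.arcsin (sinAngle m d r)))
        (Real.cos (Real.arcsin (sinAngle m d r)))⁻¹ r := fun r hr => by
    obtain ⟨h1, -, h3⟩ := hasDerivAt_arcsin_sinAngle hm hd hr
    refine ((hasDerivAt_arcLength hm d _).comp r h3).congr_deriv ?_
    have hw := arcDensity_pos hm d (Real.arcsin (sinAngle m d r))
    rw [mul_inv]; field_simp
  have hint : IntervalIntegrable (fun r => (Real.cos (Real.arcsin (sinAngle m d r)))⁻¹) volume
      (profileDist m d (Real.arcsin d)) (profileDist m d (Real.pi / 2)) := by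
    refine intervalIntegral.intervalIntegrable_deriv_of_nonneg
      (g := fun r => arcLength m d (Real.arcsin (sinAngle m d r))) ?_ ?_ ?_
    · exact ((contDiff_arcLength hm d).continuous.comp
        (Real.continuous_arcsin.comp (continuous_sinAngle m d))).continuousOn
    · rw [min_eq_left hle, max_eq_right hle]; exact hA
    · intro r _; exact inv_nonneg.2 (Real.cos_arcsin_nonneg _)
  refine hint.mono_fun ?_ ?_
  · rw [funext (slope_eq hH d)]
    exact ((continuous_sinAngle m d).measurable.div (Real.continuous_cos.comp
      (Real.continuous_arcsin.comp (continuous_sinAngle m d))).measurable).aestronglyMeasurable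
  · rw [uIoc_of_le hle]
    refine (ae_restrict_iff' measurableSet_Ioc).2 (Eventually.of_forall fun r hr => ?_)
    beta_reduce
    rw [slope_eq hH, ← sin_arcsin_sinAngle hm hd (Ioc_subset_Icc_self hr), div_eq_mul_inv, norm_mul]
    refine mul_le_of_le_one_left (norm_nonneg _) ?_
    exact Real.abs_sin_le_one _

/-- The fundamental theorem of calculus with the height in the angle variable as primitive, which is
continuous up to the ends where the slope may blow up. -/
theorem mu_eq (hm : 2 ≤ m) (hH : ((m + 1 : ℕ) : ℝ) * H = m) (hd : d < 1) {r : ℝ}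
    (hr : r ∈ Icc (profileDist m d (Real.arcsin d)) (profileDist m d (Real.pi / 2))) :
    mu (m + 1) H d r =
      height m d (Real.arcsin (sinAngle m d r)) - height m d (Real.arcsin d) := by
  have hα := arcsin_mem_Ico hd
  rw [mu, leftEnd_eq hm hH hd]
  have h := intervalIntegral.integral_eq_sub_of_hasDerivAt_of_le
    (f := fun r => height m d (Real.arcsin (sinAngle m d r))) hr.1
    ((contDiff_height hm d).continuous.comp
      (Real.continuous_arcsin.comp (continuous_sinAngle m d))).continuousOn
    (fun x hx => hasDerivAt_height_arcsin hm hH hd ⟨hx.1, hx.2.trans_le hr.2⟩)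
    ((intervalIntegrable_slope hm hH hd).mono_set (by
      rw [uIcc_of_le hr.1, uIcc_of_le (hr.1.trans hr.2)]
      exact Icc_subset_Icc_right hr.2))
  rw [h, arcsin_sinAngle_profileDist hm ⟨hα.1, hα.2.le⟩]

theorem mu_profileDist (hm : 2 ≤ m) (hH : ((m + 1 : ℕ) : ℝ) * H = m) (hd : d < 1) {θ : ℝ}
    (hθ : θ ∈ Icc (Real.arcsin d) (Real.pi / 2)) :
    mu (m + 1) H d (profileDist m d θ) = height m d θ - height m d (Real.arcsin d) := by
  have hα := arcsin_mem_Ico hd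
  have hmono := (profileDist_strictMonoOn hm d).monotoneOn
  have hθ' : θ ∈ Icc (-(Real.pi / 2)) (Real.pi / 2) := ⟨hα.1.trans hθ.1, hθ.2⟩
  rw [mu_eq hm hH hd ⟨hmono ⟨hα.1, hα.2.le⟩ hθ' hθ.1,
    hmono hθ' ⟨by linarith [Real.pi_pos], le_rfl⟩ hθ.2⟩, arcsin_sinAngle_profileDist hm hθ']

theorem halfHeight_eq (hm : 2 ≤ m) (hH : ((m + 1 : ℕ) : ℝ) * H = m) (hd : d < 1) :
    halfHeight (m + 1) H d = height m d (Real.pi / 2) - height m d (Real.arcsin d) := by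
  rw [halfHeight, rightEnd_eq hm hH hd,
    mu_profileDist hm hH hd ⟨(arcsin_mem_Ico hd).2.le, le_rfl⟩]

/-- Comparison with constant curvature `m`, for which the height would be `-cos θ / m`. Since `sin θ
· arcDensity - sin θ / m = sin² θ tanh ρ · arcDensity`, the difference is nondecreasing while `ρ ≥
0`. The comparison height itself rises by `cos (arcsin d) / m ≥ 0`, so the initial decrease for `d <
0` is always made up. -/
theorem height_arcsin_lt (hm : 2 ≤ m) (hd : d < 1) :
    height m d (Real.arcsin d) < height m d (Real.pi / 2) := by
  have hα := arcsin_mem_Ico hd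
  have hm0 : (0 : ℝ) < m := Nat.cast_pos.2 (by omega)
  have hpi := Real.pi_pos
  set α := Real.arcsin d with hαd
  have hK : ∀ θ, HasDerivAt (fun θ => height m d θ + Real.cos θ * (m : ℝ)⁻¹)
      (Real.sin θ ^ 2 * Real.tanh (profileDist m d θ) * arcDensity m d θ) θ := fun θ => by
    refine ((hasDerivAt_height hm d θ).add ((Real.hasDerivAt_cos θ).mul_const _)).congr_deriv ?_
    have h1 := arcDensity_denom_pos hm d θ
    have h2 : 1 - Real.sin θ * Real.tanh (profileDist m d θ) ≠ 0 := right_ne_zero_of_mul h1.ne'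
    rw [arcDensity]
    field_simp
    ring
  have hKc : Continuous fun θ => height m d θ + Real.cos θ * (m : ℝ)⁻¹ :=
    (contDiff_height hm d).continuous.add (Real.continuous_cos.mul continuous_const)
  have hP : ∀ θ ∈ Ioo α (Real.pi / 2), 0 < Real.tanh (profileDist m d θ) := fun θ hθ => by
    have h1 := profileDist_arcsin_nonneg (d := d) hm hd.le
    have h2 := profileDist_strictMonoOn hm d ⟨hα.1, hα.2.le⟩ ⟨hα.1.trans hθ.1.le, hθ.2.le⟩ hθ.1
    rw [Real.tanh_eq_sinh_div_cosh]
    exact div_pos (Real.sinh_pos_iff.2 (h1.trans_lt h2)) (Real.cosh_pos _)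
  have hmono : MonotoneOn (fun θ => height m d θ + Real.cos θ * (m : ℝ)⁻¹)
      (Icc α (Real.pi / 2)) := by
    refine monotoneOn_of_deriv_nonneg (convex_Icc _ _) hKc.continuousOn
      (fun θ _ => (hK θ).differentiableAt.differentiableWithinAt) fun θ hθ => ?_
    rw [interior_Icc] at hθ
    rw [(hK θ).deriv]
    exact mul_nonneg (mul_nonneg (sq_nonneg _) (hP θ hθ).le) (arcDensity_pos hm d θ).le
  -- The derivative vanishes at `θ = 0`, so strictness is claimed only from `max α 0` on, where `sin
  -- θ > 0` in the interior.
  have hstrict : StrictMonoOn (fun θ => height m d θ + Real.cos θ * (m : ℝ)⁻¹)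
      (Icc (max α 0) (Real.pi / 2)) := by
    refine strictMonoOn_of_deriv_pos (convex_Icc _ _) hKc.continuousOn fun θ hθ => ?_
    rw [interior_Icc] at hθ
    rw [(hK θ).deriv]
    have hs : 0 < Real.sin θ := Real.sin_pos_of_pos_of_lt_pi
      ((le_max_right _ _).trans_lt hθ.1) (by linarith [hθ.2])
    exact mul_pos (mul_pos (by positivity) (hP θ ⟨(le_max_left _ _).trans_lt hθ.1, hθ.2⟩))
      (arcDensity_pos hm d θ)
  have hmax : max α 0 < Real.pi / 2 := max_lt hα.2 (by linarith)
  have h1 := hmono ⟨le_rfl, hα.2.le⟩ ⟨le_max_left α 0, hmax.le⟩ (le_max_left α 0)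
  have h2 := hstrict ⟨le_rfl, hmax.le⟩ ⟨hmax.le, le_rfl⟩ hmax
  have h3 : 0 ≤ Real.cos α := Real.cos_nonneg_of_mem_Icc ⟨hα.1, hα.2.le⟩
  simp only [Real.cos_pi_div_two, zero_mul, add_zero] at h1 h2
  have h4 : 0 ≤ Real.cos α * (m : ℝ)⁻¹ := by positivity
  linarith

theorem halfHeight_pos (hm : 2 ≤ m) (hH : ((m + 1 : ℕ) : ℝ) * H = m) (hd : d < 1) :
    0 < halfHeight (m + 1) H d := by
  rw [halfHeight_eq hm hH hd]; exact sub_pos.2 (height_arcsin_lt hm hd)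

theorem isGeneratingSolution (hm : 2 ≤ m) (hH : ((m + 1 : ℕ) : ℝ) * H = m) (hd : d < 1) :
    IsGeneratingSolution (m + 1) H d := by
  have hα := arcsin_mem_Ico hd
  have hpi := Real.pi_pos
  have hL := leftEnd_eq hm hH hd
  have hRt := rightEnd_eq hm hH hd
  have hmono := profileDist_strictMonoOn hm d
  have hlt : profileDist m d (Real.arcsin d) < profileDist m d (Real.pi / 2) :=
    hmono ⟨hα.1, hα.2.le⟩ ⟨by linarith, le_rfl⟩ hα.2
  have hder : ∀ r ∈ Ioo (leftEnd (m + 1) H d) (rightEnd (m + 1) H d),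
      HasDerivAt (mu (m + 1) H d) (TranslationH.slope (m + 1) H d r) r := fun r hr => by
    rw [hL, hRt] at hr
    refine ((hasDerivAt_height_arcsin hm hH hd hr).sub_const
      (height m d (Real.arcsin d))).congr_of_eventuallyEq ?_
    filter_upwards [isOpen_Ioo.mem_nhds hr] with x hx
    exact mu_eq hm hH hd (Ioo_subset_Icc_self hx)
  have hpos : ∀ t ∈ Ioo (leftEnd (m + 1) H d) (rightEnd (m + 1) H d),
      0 < R (m + 1) H d t ∧ 0 < S (m + 1) H d t := fun t ht => by
    rw [hL, hRt] at ht
    rw [R_eq hH, S_eq hH, sub_pos, sub_pos]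
    constructor
    · rw [← not_le, ← profileDist_le_iff hm, not_le]; exact ht.2
    · rw [← not_le, ← le_profileDist_iff hm, not_le]
      exact lt_of_le_of_lt (hmono.monotoneOn ⟨le_rfl, by linarith⟩ ⟨hα.1, hα.2.le⟩ hα.1) ht.1
  refine ⟨?_, ?_, ?_, ?_, ?_, hpos, ?_, ?_, fun r hr => ⟨(hder r hr).differentiableAt, ?_⟩,
    halfHeight_pos hm hH hd⟩
  · rw [hL]; exact profileDist_arcsin_nonneg hm hd.le
  · rw [hL, hRt]; exact hlt
  · intro h; rw [hL]; exact profileDist_arcsin_eq_zero hm h hd.le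
  · intro h
    rw [hL, S_eq hH, Real.arcsin_of_le_neg_one h.le, flux_profileDist hm, sub_self]
    refine ⟨?_, rfl⟩
    rw [← not_le, profileDist_le_iff hm, flux_zero, Real.sin_neg, Real.sin_pi_div_two, not_le]
    exact h
  · rw [hRt, R_eq hH, flux_profileDist hm, sub_self]
  · rw [hL, hRt]; exact intervalIntegrable_slope hm hH hd
  · rw [hL, hRt]
    refine ContinuousOn.congr (f := fun r =>
      height m d (Real.arcsin (sinAngle m d r)) - height m d (Real.arcsin d)) ?_
      fun r hr => mu_eq hm hH hd hr
    exact (((contDiff_height hm d).continuous.comp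
      (Real.continuous_arcsin.comp (continuous_sinAngle m d))).sub continuous_const).continuousOn
  · rw [(hder r hr).deriv]
    rw [hL, hRt] at hr
    obtain ⟨h1, -, -⟩ := hasDerivAt_arcsin_sinAngle hm hd hr
    have hc : 0 < Real.cos (Real.arcsin (sinAngle m d r)) :=
      Real.cos_pos_of_mem_Ioo ⟨lt_of_le_of_lt hα.1 h1.1, h1.2⟩
    have hs := sin_arcsin_sinAngle hm hd (Ioo_subset_Icc_self hr)
    have hg : 0 < Real.cosh r ^ m := by have := Real.cosh_pos r; positivity
    rw [slope_eq hH, Nat.add_sub_cancel, hH]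
    -- `1 + tan² θ = cos⁻² θ`, so the left side of the equation becomes `sin θ · cosh^m ρ`.
    have h2 : 1 + (sinAngle m d r / Real.cos (Real.arcsin (sinAngle m d r))) ^ 2 =
        (Real.cos (Real.arcsin (sinAngle m d r)))⁻¹ ^ 2 := by
      have h3 := Real.sin_sq_add_cos_sq (Real.arcsin (sinAngle m d r))
      rw [hs] at h3
      field_simp
      linarith
    rw [h2, Real.sqrt_sq (inv_nonneg.2 hc.le)]
    have h4 : sinAngle m d r * Real.cosh r ^ m = m * J m r + d := by
      rw [sinAngle]; field_simp
    rw [← h4]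
    field_simp

end

end

end TranslationH

namespace TranslationH

noncomputable section

/-! ### Curves glued from congruent arcs -/

/-- At the parameter `s`, the plane curve `c` is smooth with unit speed and satisfies the equation
of the generating curves of hypersurfaces with mean curvature `m / (m + 1)`. -/
def IsHPoint (m : ℕ) (c : ℝ → ℝ × ℝ) (s : ℝ) : Prop :=
  ContDiffAt ℝ ∞ c s ∧ (deriv c s).1 ^ 2 + (deriv c s).2 ^ 2 = 1 ∧
    (deriv c s).1 * (deriv (deriv c) s).2 - (deriv c s).2 * (deriv (deriv c) s).1 =
      m * (1 - (deriv c s).2 * Real.tanh (c s).1)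

section

variable {m : ℕ} {c c' γ : ℝ → ℝ × ℝ} {s η τ : ℝ}

theorem IsHPoint.deriv_ne_zero (h : IsHPoint m c s) : deriv c s ≠ 0 := fun h0 => by
  have := h.2.1; rw [h0] at this; simp at this

theorem IsHPoint.curvature_pos (hm : 0 < m) (h : IsHPoint m c s) :
    0 < (deriv c s).1 * (deriv (deriv c) s).2 - (deriv c s).2 * (deriv (deriv c) s).1 := by
  rw [h.2.2]
  have h1 : |(deriv c s).2| ≤ 1 := by
    rw [← sq_le_one_iff_abs_le_one]; nlinarith [h.2.1, sq_nonneg (deriv c s).1]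
  have h2 : |(deriv c s).2 * Real.tanh (c s).1| < 1 := by
    rw [abs_mul]
    calc _ ≤ 1 * |Real.tanh (c s).1| := mul_le_mul_of_nonneg_right h1 (abs_nonneg _)
      _ < 1 := by rw [one_mul]; exact abs_tanh_lt_one _
  exact mul_pos (Nat.cast_pos.2 hm) (by linarith [(abs_lt.1 h2).2])

theorem isImmersedHHypersurface_of_isHPoint {e : EuclideanSpace ℝ (Fin (m + 1))} (he : ‖e‖ = 1)
    {H : ℝ} (hH : ((m + 1 : ℕ) : ℝ) * H = m) {Z : Set ℝ} (hc : ∀ s ∉ Z, IsHPoint m c s) :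
    IsImmersedHHypersurface e c Z H := by
  have h1 : (((m + 1 : ℕ) : ℝ) - 1) / ((m + 1 : ℕ) : ℝ) = H := by
    have : ((m + 1 : ℕ) : ℝ) ≠ 0 := by positivity
    rw [div_eq_iff this, mul_comm, hH]; push_cast; ring
  rw [← h1]
  refine isImmersedHHypersurface_of_curvature he (by omega) (fun s hs => (hc s hs).1)
    (fun s hs => (hc s hs).2.1) fun s hs => ?_
  rw [(hc s hs).2.2]; push_cast; ring

/-- The motion `z ↦ η z + (0, τ)`. -/
def motion (η τ : ℝ) (z : ℝ × ℝ) : ℝ × ℝ := (η * z.1, η * z.2 + τ)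

theorem contDiff_motion (η τ : ℝ) : ContDiff ℝ ∞ (motion η τ) :=
  (contDiff_const.mul contDiff_fst).prodMk ((contDiff_const.mul contDiff_snd).add contDiff_const)

theorem hasDerivAt_motion {x : ℝ × ℝ} (h : HasDerivAt γ x s) :
    HasDerivAt (fun s => motion η τ (γ s)) (η • x) s :=
  ((hasDerivAt_fst_apply h).const_mul η).prodMk (((hasDerivAt_snd_apply h).const_mul η).add_const τ)

theorem tanh_mul_of_sq_eq_one (hη : η * η = 1) (x : ℝ) : Real.tanh (η * x) = η * Real.tanh x := by
  rcases mul_self_eq_one_iff.1 hη with rfl | rfl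
  · simp
  · simp [Real.tanh_neg]

/-- For `η = ±1` the motion multiplies velocity and acceleration by the same sign, which cancels in
every quadratic expression; in `t' tanh ρ` it cancels because `tanh` is odd. Orientation is kept,
and with it the sign of the curvature. -/
theorem IsHPoint.congr_motion (hη : η * η = 1) {s₀ : ℝ} (h : IsHPoint m γ (s - s₀))
    (hcc : c =ᶠ[𝓝 s] fun s => motion η τ (γ (s - s₀))) : IsHPoint m c s := by
  have hsub : ContDiffAt ℝ ∞ (fun s : ℝ => s - s₀) s := contDiffAt_id.sub contDiffAt_const
  have hcs : ContDiffAt ℝ ∞ c s :=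
    (ContDiffAt.comp s (contDiff_motion η τ).contDiffAt
      (ContDiffAt.comp (f := fun s : ℝ => s - s₀) s h.1 hsub)).congr_of_eventuallyEq hcc
  have hev : ∀ᶠ x in 𝓝 s, DifferentiableAt ℝ γ (x - s₀) := by
    have h1 : ∀ᶠ y in 𝓝 (s - s₀), DifferentiableAt ℝ γ y := by
      filter_upwards [(h.1.of_le (m := 1) (by norm_cast)).eventually (by norm_num)] with y hy
      exact hy.differentiableAt (by norm_num)
    exact hsub.continuousAt.eventually h1
  have hd : deriv c =ᶠ[𝓝 s] fun x => η • deriv γ (x - s₀) := by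
    filter_upwards [hev, hcc.eventuallyEq_nhds] with x hx hxx
    rw [hxx.deriv_eq]
    exact (hasDerivAt_motion (HasDerivAt.comp_sub_const x s₀ hx.hasDerivAt)).deriv
  have hdd : deriv (deriv c) s = η • deriv (deriv γ) (s - s₀) := by
    rw [hd.deriv_eq]
    have h2 : DifferentiableAt ℝ (deriv γ) (s - s₀) := by
      have h3 := (h.1.fderiv_right (m := 1) (by norm_cast)).differentiableAt (by norm_num)
      have h4 : deriv γ = fun s => fderiv ℝ γ s 1 := rfl
      rw [h4]; exact h3.clm_apply (differentiableAt_const _)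
    exact ((HasDerivAt.comp_sub_const s s₀ h2.hasDerivAt).const_smul η).deriv
  have h0 := hcc.self_of_nhds
  have h1 := hd.self_of_nhds
  refine ⟨hcs, ?_, ?_⟩
  · rw [h1]
    simp only [Prod.smul_fst, Prod.smul_snd, smul_eq_mul]
    linear_combination h.2.1 + (hη) * ((deriv γ (s - s₀)).1 ^ 2 + (deriv γ (s - s₀)).2 ^ 2)
  · rw [h1, hdd, h0]
    simp only [Prod.smul_fst, Prod.smul_snd, smul_eq_mul, motion, tanh_mul_of_sq_eq_one hη]
    linear_combination h.2.2 + hη * ((deriv γ (s - s₀)).1 * (deriv (deriv γ) (s - s₀)).2 -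
      (deriv γ (s - s₀)).2 * (deriv (deriv γ) (s - s₀)).1 +
      m * ((deriv γ (s - s₀)).2 * Real.tanh (γ (s - s₀)).1))

theorem exists_injOn_of_isHPoint (h : IsHPoint m c s) : ∃ U ∈ 𝓝 s, InjOn c U := by
  have key : ∀ f : ℝ → ℝ, ContDiffAt ℝ ∞ f s → deriv f s ≠ 0 → ∃ U ∈ 𝓝 s, InjOn f U :=
    fun f hf hf' => by
    have h1 := (hf.hasStrictDerivAt (by simp)).hasStrictFDerivAt_equiv hf'
    exact ⟨(h1.toOpenPartialHomeomorph f).source,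
      (h1.toOpenPartialHomeomorph f).open_source.mem_nhds h1.mem_toOpenPartialHomeomorph_source,
      (h1.toOpenPartialHomeomorph f).injOn⟩
  have hd := (h.1.differentiableAt (by simp)).hasDerivAt
  by_cases h1 : (deriv c s).1 = 0
  · have h2 : (deriv c s).2 ≠ 0 := fun h2 => h.deriv_ne_zero (Prod.ext h1 h2)
    obtain ⟨U, hU, hi⟩ := key (fun s => (c s).2) h.1.snd
      (by rw [(hasDerivAt_snd_apply hd).deriv]; exact h2)
    exact ⟨U, hU, fun x hx y hy hxy => hi hx hy (congrArg Prod.snd hxy)⟩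
  · obtain ⟨U, hU, hi⟩ := key (fun s => (c s).1) h.1.fst
      (by rw [(hasDerivAt_fst_apply hd).deriv]; exact h1)
    exact ⟨U, hU, fun x hx y hy hxy => hi hx hy (congrArg Prod.fst hxy)⟩

theorem IsPiecewiseSmooth.continuous (h : IsPiecewiseSmooth c) : Continuous c := by
  refine continuous_iff_continuousAt.2 fun s => ?_
  obtain ⟨c₁, c₂, h1, h2, δ, hδ, e1, e2⟩ := h s
  refine continuousAt_iff_continuous_left_right.2 ⟨?_, ?_⟩
  · have hs : Icc (s - δ) s ∈ 𝓝[≤] s := Icc_mem_nhdsLE (by linarith)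
    exact (h1.continuous.continuousWithinAt).congr_of_eventuallyEq
      (eventually_of_mem hs fun x hx => e1 hx) (e1 ⟨by linarith, le_rfl⟩)
  · have hs : Icc s (s + δ) ∈ 𝓝[≥] s := Icc_mem_nhdsGE (by linarith)
    exact (h2.continuous.continuousWithinAt).congr_of_eventuallyEq
      (eventually_of_mem hs fun x hx => e2 hx) (e2 ⟨le_rfl, by linarith⟩)

theorem IsPiecewiseSmooth.isProfileCurve (h : IsPiecewiseSmooth c) {Z : Set ℝ}
    (hZ : ∀ s ∉ Z, IsHPoint m c s) (hcorner : ∀ s ∈ Z, ¬ DifferentiableAt ℝ c s) :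
    IsProfileCurve Z c where
  continuous := h.continuous
  piecewise_smooth s := by
    obtain ⟨c₁, c₂, h1, h2, δ, hδ, e1, e2⟩ := h s
    exact ⟨δ, hδ, h1.contDiffOn.congr e1, h2.contDiffOn.congr e2⟩
  smooth s hs := (hZ s hs).1
  unit_speed s hs := (hZ s hs).2.1
  corner := hcorner

end

/-- The motion `z ↦ ε z + (0, 2 h)`, where `ε ^ 2 = 1`, as a bijection of the plane. -/
def motionPerm {ε : ℝ} (hε : ε * ε = 1) (h : ℝ) : Equiv.Perm (ℝ × ℝ) where
  toFun := motion ε (2 * h)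
  invFun := motion ε (-(ε * (2 * h)))
  left_inv z := by
    refine Prod.ext ?_ ?_ <;> simp only [motion]
    · linear_combination z.1 * hε
    · linear_combination z.2 * hε
  right_inv z := by
    refine Prod.ext ?_ ?_ <;> simp only [motion]
    · linear_combination z.1 * hε
    · linear_combination (z.2 - 2 * h) * hε

section

variable {ε h : ℝ} (hε : ε * ε = 1)

theorem motionPerm_apply (z : ℝ × ℝ) : motionPerm hε h z = (ε * z.1, ε * z.2 + 2 * h) := rfl

theorem exists_motionPerm_zpow (k : ℤ) :
    ∃ η τ : ℝ, η * η = 1 ∧ ∀ z, (motionPerm hε h ^ k) z = motion η τ z := by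
  induction k using Int.induction_on with
  | zero => exact ⟨1, 0, by norm_num, fun z => by simp [motion]⟩
  | succ k ih =>
    obtain ⟨η, τ, hη, hz⟩ := ih
    refine ⟨ε * η, ε * τ + 2 * h, by linear_combination η * η * hε + hη, fun z => ?_⟩
    rw [add_comm, zpow_add, zpow_one, Equiv.Perm.mul_apply, hz, motionPerm_apply]
    exact Prod.ext (by simp only [motion]; ring) (by simp only [motion]; ring)
  | pred k ih =>
    obtain ⟨η, τ, hη, hz⟩ := ih
    refine ⟨ε * η, ε * τ - ε * (2 * h), by linear_combination η * η * hε + hη, fun z => ?_⟩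
    rw [sub_eq_add_neg, add_comm, zpow_add, zpow_neg_one, Equiv.Perm.mul_apply, hz]
    change motion ε (-(ε * (2 * h))) _ = _
    exact Prod.ext (by simp only [motion]; ring) (by simp only [motion]; ring)

/-- The curve that is glued from the images of the arc `γ` on `[0, L]` under the powers of a
motion. -/
def gluedCurve (h : ℝ) (γ : ℝ → ℝ × ℝ) (L s : ℝ) : ℝ × ℝ :=
  (motionPerm hε h ^ ⌊s / L⌋) (γ (s - ⌊s / L⌋ * L))

variable {γ : ℝ → ℝ × ℝ} {L : ℝ}

theorem gluedCurve_eq (hL : 0 < L) (hγ : γ L = motionPerm hε h (γ 0)) (k : ℤ) {s : ℝ}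
    (hs : s ∈ Icc (k * L) ((k + 1) * L)) :
    gluedCurve hε h γ L s = (motionPerm hε h ^ k) (γ (s - k * L)) := by
  -- At the right end of the interval the floor jumps to `k + 1`; the closing condition `hγ` makes
  -- both expressions agree, so the formula holds on the closed interval.
  rcases eq_or_lt_of_le hs.2 with h1 | h1
  · have h2 : ⌊s / L⌋ = k + 1 := by
      rw [h1, mul_div_assoc, div_self hL.ne', mul_one]
      exact_mod_cast Int.floor_intCast (R := ℝ) (k + 1)
    rw [gluedCurve, h2, h1]
    have h3 : ((k : ℝ) + 1) * L - ((k + 1 : ℤ) : ℝ) * L = 0 := by push_cast; ring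
    have h4 : ((k : ℝ) + 1) * L - k * L = L := by ring
    rw [h3, h4, hγ, zpow_add_one, Equiv.Perm.mul_apply]
  · have h2 : ⌊s / L⌋ = k := by
      rw [Int.floor_eq_iff, le_div_iff₀ hL, div_lt_iff₀ hL]; exact ⟨hs.1, h1⟩
    rw [gluedCurve, h2]

theorem gluedCurve_add (hL : 0 < L) (k : ℤ) (s : ℝ) :
    gluedCurve hε h γ L (s + k * L) = (motionPerm hε h ^ k) (gluedCurve hε h γ L s) := by
  have h1 : (s + k * L) / L = s / L + k := by field_simp
  rw [gluedCurve, gluedCurve, h1, Int.floor_add_intCast, add_comm _ k, zpow_add,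
    Equiv.Perm.mul_apply]
  congr 3
  push_cast; ring

theorem gluedCurve_of_mem (hL : 0 < L) (hγ : γ L = motionPerm hε h (γ 0)) {s : ℝ}
    (hs : s ∈ Icc 0 L) : gluedCurve hε h γ L s = γ s := by
  simpa using gluedCurve_eq hε hL hγ 0 (s := s) (by simpa using hs)

theorem range_gluedCurve (hL : 0 < L) (hγ : γ L = motionPerm hε h (γ 0)) :
    range (gluedCurve hε h γ L) = ⋃ k : ℤ, (motionPerm hε h ^ k) '' (γ '' Icc 0 L) := by
  ext z
  simp only [mem_range, mem_iUnion, mem_image]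
  constructor
  · rintro ⟨s, rfl⟩
    refine ⟨⌊s / L⌋, _, ⟨s - ⌊s / L⌋ * L, ⟨?_, ?_⟩, rfl⟩, rfl⟩
    · have := Int.floor_le (s / L); rw [le_div_iff₀ hL] at this; linarith
    · have := (Int.lt_floor_add_one (s / L)); rw [div_lt_iff₀ hL] at this; linarith
  · rintro ⟨k, _, ⟨s, hs, rfl⟩, rfl⟩
    refine ⟨s + k * L, ?_⟩
    rw [gluedCurve_add hε hL, gluedCurve_of_mem hε hL hγ hs]

theorem isPiecewiseSmooth_gluedCurve (hL : 0 < L) (hγ : γ L = motionPerm hε h (γ 0))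
    (hγs : ContDiff ℝ ∞ γ) : IsPiecewiseSmooth (gluedCurve hε h γ L) := by
  have hp : ∀ k : ℤ, ContDiff ℝ ∞ fun s : ℝ => (motionPerm hε h ^ k) (γ (s - k * L)) := fun k => by
    obtain ⟨η, τ, -, hz⟩ := exists_motionPerm_zpow hε (h := h) k
    simp only [hz]
    exact (contDiff_motion η τ).comp (hγs.comp (contDiff_id.sub contDiff_const))
  intro s
  have hfl := Int.floor_le (s / L)
  have hfl' := Int.lt_floor_add_one (s / L)
  have hce := Int.le_ceil (s / L)
  have hce' := Int.ceil_lt_add_one (s / L)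
  rw [le_div_iff₀ hL] at hfl
  rw [div_lt_iff₀ hL] at hfl'
  rw [div_le_iff₀ hL] at hce
  rw [← sub_lt_iff_lt_add, lt_div_iff₀ hL] at hce'
  -- The indices of the pieces to the left and to the right of `s`; they differ exactly when `s` is
  -- a multiple of `L`.
  refine ⟨_, _, hp (⌈s / L⌉ - 1), hp ⌊s / L⌋, min (s - (⌈s / L⌉ - 1) * L)
    ((⌊s / L⌋ + 1) * L - s), lt_min (by linarith) (by linarith), fun x hx => ?_, fun x hx => ?_⟩
  · refine gluedCurve_eq hε hL hγ _ ⟨?_, ?_⟩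
    · push_cast; linarith [hx.1, min_le_left (s - (⌈s / L⌉ - 1) * L) ((⌊s / L⌋ + 1) * L - s)]
    · push_cast; linarith [hx.2]
  · refine gluedCurve_eq hε hL hγ _ ⟨?_, ?_⟩
    · linarith [hx.1]
    · linarith [hx.2, min_le_right (s - (⌈s / L⌉ - 1) * L) ((⌊s / L⌋ + 1) * L - s)]

theorem isHPoint_gluedCurve {m : ℕ} (hL : 0 < L) (hγ : γ L = motionPerm hε h (γ 0))
    (hH : ∀ s, IsHPoint m γ s) {s : ℝ} (hs : ∀ k : ℤ, s ≠ k * L) :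
    IsHPoint m (gluedCurve hε h γ L) s := by
  obtain ⟨η, τ, hη, hz⟩ := exists_motionPerm_zpow hε (h := h) ⌊s / L⌋
  have hfl := Int.floor_le (s / L)
  have hfl' := Int.lt_floor_add_one (s / L)
  rw [le_div_iff₀ hL] at hfl
  rw [div_lt_iff₀ hL] at hfl'
  refine (hH (s - ⌊s / L⌋ * L)).congr_motion hη (τ := τ) ?_
  filter_upwards [Icc_mem_nhds (lt_of_le_of_ne hfl (hs _).symm) hfl'] with x hx
  rw [gluedCurve_eq hε hL hγ _ hx, hz]

/-- If the curve already continues past the arc by the motion, gluing changes nothing, and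
smoothness of `γ` extends over the joints. -/
theorem gluedCurve_eq_of_equivariant (hγ : ∀ s, γ (s + L) = motionPerm hε h (γ s)) :
    gluedCurve hε h γ L = γ := by
  have hk : ∀ (k : ℤ) s, γ (s + k * L) = (motionPerm hε h ^ k) (γ s) := fun k => by
    induction k using Int.induction_on with
    | zero => intro s; simp
    | succ k ih =>
      intro s
      rw [add_comm (k : ℤ) 1, zpow_add, zpow_one, Equiv.Perm.mul_apply, ← ih, ← hγ]
      congr 1; push_cast; ring
    | pred k ih =>
      intro s
      rw [sub_eq_add_neg, add_comm (-(k : ℤ)) (-1), zpow_add, zpow_neg_one, Equiv.Perm.mul_apply,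
        ← ih, Equiv.Perm.eq_inv_iff_eq, ← hγ]
      congr 1; push_cast; ring
  funext s
  rw [gluedCurve, ← hk]; congr 1; ring

/-- Glued curves have corners unless the tangent vectors of the arc fit together. -/
theorem not_differentiableAt_gluedCurve (hL : 0 < L) (hγ : γ L = motionPerm hε h (γ 0))
    {x y : ℝ × ℝ} (h0 : HasDerivAt γ x 0) (h1 : HasDerivAt γ y L) (hxy : x ≠ ε • y) (k : ℤ) :
    ¬ DifferentiableAt ℝ (gluedCurve hε h γ L) (k * L) := by
  intro hd
  set c := gluedCurve hε h γ L with hc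
  have hd0 : DifferentiableAt ℝ c 0 := by
    obtain ⟨η, τ, -, hz⟩ := exists_motionPerm_zpow hε (h := h) (-k)
    have h2 : c = fun s => motion η τ (c (s + k * L)) := by
      funext s
      rw [← hz, hc, gluedCurve_add hε hL, ← Equiv.Perm.mul_apply, ← zpow_add]; simp
    rw [h2]
    refine ((contDiff_motion η τ).differentiable (by simp) _).comp (0 : ℝ) ?_
    have h3 : DifferentiableAt ℝ c (0 + k * L) := by simpa using hd
    exact (HasDerivAt.comp_add_const 0 (k * L) h3.hasDerivAt).differentiableAt
  have hr : HasDerivWithinAt c x (Ici 0) 0 := by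
    refine h0.hasDerivWithinAt.congr_of_eventuallyEq ?_
      (gluedCurve_of_mem hε hL hγ ⟨le_rfl, hL.le⟩)
    filter_upwards [Icc_mem_nhdsGE hL] with s hs
    exact gluedCurve_of_mem hε hL hγ hs
  -- To the left of `0` the curve is the inverse motion of the end of the arc, whose linear part is
  -- again `ε` because `ε ^ 2 = 1`.
  have hl : HasDerivWithinAt c (ε • y) (Iic 0) 0 := by
    have h2 : HasDerivAt (fun s => motion ε (-(ε * (2 * h))) (γ (s + L))) (ε • y) 0 :=
      hasDerivAt_motion (HasDerivAt.comp_add_const 0 L (by simpa using h1))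
    have h3 : ∀ s ∈ Icc (-L) 0, c s = motion ε (-(ε * (2 * h))) (γ (s + L)) := fun s hs => by
      have := gluedCurve_eq hε hL hγ (-1) (s := s)
        (by push_cast; constructor <;> linarith [hs.1, hs.2])
      rw [hc, this, zpow_neg_one]
      push_cast
      rw [neg_one_mul, sub_neg_eq_add]; rfl
    refine h2.hasDerivWithinAt.congr_of_eventuallyEq ?_ (h3 0 ⟨by linarith, le_rfl⟩)
    filter_upwards [Icc_mem_nhdsLE (show -L < 0 by linarith)] with s hs
    exact h3 s hs
  have e1 := (uniqueDiffWithinAt_Ici (0 : ℝ)).eq_deriv _ hr hd0.hasDerivAt.hasDerivWithinAt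
  have e2 := (uniqueDiffWithinAt_Iic (0 : ℝ)).eq_deriv _ hl hd0.hasDerivAt.hasDerivWithinAt
  exact hxy (e1.trans e2.symm)

end

end

end TranslationH

namespace TranslationH

noncomputable section

/-! ### The fundamental arc of the generating curve -/

theorem sub_eq_sub_of_hasDerivAt {F G f : ℝ → ℝ} (hF : ∀ x, HasDerivAt F (f x) x)
    (hG : ∀ x, HasDerivAt G (f x) x) (x y : ℝ) : F x - G x = F y - G y := by
  have h : ∀ x, HasDerivAt (fun x => F x - G x) 0 x := fun x =>
    ((hF x).sub (hG x)).congr_deriv (sub_self _)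
  exact is_const_of_deriv_eq_zero (fun x => (h x).differentiableAt) (fun x => (h x).deriv) x y

/-- `F` and `-F (π - ·)` have the same derivative, and the constant is read off at the fixed point
`π / 2`. -/
theorem reflect_of_hasDerivAt {F f : ℝ → ℝ} (hF : ∀ x, HasDerivAt F (f x) x)
    (hf : ∀ x, f (Real.pi - x) = f x) (x : ℝ) : F (Real.pi - x) = 2 * F (Real.pi / 2) - F x := by
  have h1 : ∀ x, HasDerivAt (fun x => -F (Real.pi - x)) (f x) x := fun x => by
    rw [← hf x]
    exact ((hF (Real.pi - x)).comp x ((hasDerivAt_id x).const_sub Real.pi)).neg.congr_deriv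
      (by ring)
  have h2 := sub_eq_sub_of_hasDerivAt hF h1 x (Real.pi / 2)
  rw [sub_half] at h2
  linarith

section

variable {m : ℕ} {d H : ℝ}

theorem isHPoint_fluxCurve (hm : 2 ≤ m) (d s : ℝ) : IsHPoint m (fluxCurve hm d) s := by
  refine ⟨(contDiff_fluxCurve hm d).contDiffAt, ?_, ?_⟩
  · rw [(hasDerivAt_fluxCurve hm d s).deriv]; exact Real.cos_sq_add_sin_sq _
  · rw [(hasDerivAt_deriv_fluxCurve hm d s).deriv, (hasDerivAt_fluxCurve hm d s).deriv]
    simp only [fluxCurve, arcDensity, inv_inv]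
    linear_combination (m * (1 - Real.sin (angle hm d s) *
      Real.tanh (profileDist m d (angle hm d s)))) * Real.cos_sq_add_sin_sq (angle hm d s)

theorem arcLength_pi_sub (hm : 2 ≤ m) (d θ : ℝ) :
    arcLength m d (Real.pi - θ) = 2 * arcLength m d (Real.pi / 2) - arcLength m d θ :=
  reflect_of_hasDerivAt (hasDerivAt_arcLength hm d)
    (fun x => arcDensity_congr (Real.sin_pi_sub x)) θ

theorem height_pi_sub (hm : 2 ≤ m) (d θ : ℝ) :
    height m d (Real.pi - θ) = 2 * height m d (Real.pi / 2) - height m d θ :=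
  reflect_of_hasDerivAt (hasDerivAt_height hm d)
    (fun x => by rw [arcDensity_congr (Real.sin_pi_sub x), Real.sin_pi_sub]) θ

/-- The tangent angle along the generating curve, which starts at the left end. -/
def arcAngle (hm : 2 ≤ m) (d s : ℝ) : ℝ := angle hm d (s + arcLength m d (Real.arcsin d))

/-- The unit speed curve with flux `d` that starts at the left end at height zero. -/
def arc (hm : 2 ≤ m) (d s : ℝ) : ℝ × ℝ :=
  (profileDist m d (arcAngle hm d s), height m d (arcAngle hm d s) - height m d (Real.arcsin d))

/-- The length of the arc of the generating curve between two points over the left end. -/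
def arcLen (m : ℕ) (d : ℝ) : ℝ :=
  2 * (arcLength m d (Real.pi / 2) - arcLength m d (Real.arcsin d))

theorem arc_eq (hm : 2 ≤ m) (d : ℝ) : arc hm d = fun s =>
    motion 1 (-height m d (Real.arcsin d))
      (fluxCurve hm d (s - -arcLength m d (Real.arcsin d))) := by
  funext s; simp [arc, motion, fluxCurve, arcAngle, sub_eq_add_neg]

theorem isHPoint_arc (hm : 2 ≤ m) (d s : ℝ) : IsHPoint m (arc hm d) s :=
  (isHPoint_fluxCurve hm d _).congr_motion (by norm_num)
    (Eventually.of_forall fun x => congrFun (arc_eq hm d) x)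

theorem contDiff_arc (hm : 2 ≤ m) (d : ℝ) : ContDiff ℝ ∞ (arc hm d) :=
  contDiff_iff_contDiffAt.2 fun s => (isHPoint_arc hm d s).1

theorem hasDerivAt_arc (hm : 2 ≤ m) (d s : ℝ) : HasDerivAt (arc hm d)
    (Real.cos (arcAngle hm d s), Real.sin (arcAngle hm d s)) s := by
  rw [arc_eq]
  have h := hasDerivAt_motion (η := 1) (τ := -height m d (Real.arcsin d))
    (HasDerivAt.comp_sub_const s (-arcLength m d (Real.arcsin d)) (hasDerivAt_fluxCurve hm d _))
  simpa [arcAngle, sub_eq_add_neg] using h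

theorem arcAngle_strictMono (hm : 2 ≤ m) (d : ℝ) : StrictMono (arcAngle hm d) := fun s s' h =>
  angle_strictMono hm d (by linarith)

theorem arcAngle_eq_iff (hm : 2 ≤ m) {s θ : ℝ} :
    arcAngle hm d s = θ ↔ s = arcLength m d θ - arcLength m d (Real.arcsin d) := by
  constructor
  · rintro rfl; rw [arcAngle, arcLength_angle]; ring
  · rintro rfl; rw [arcAngle, sub_add_cancel, angle_arcLength]

theorem arcAngle_sub (hm : 2 ≤ m) (d θ : ℝ) :
    arcAngle hm d (arcLength m d θ - arcLength m d (Real.arcsin d)) = θ :=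
  (arcAngle_eq_iff hm).2 rfl

theorem arcAngle_zero (hm : 2 ≤ m) (d : ℝ) : arcAngle hm d 0 = Real.arcsin d :=
  (arcAngle_eq_iff hm).2 (sub_self _).symm

theorem arcAngle_arcLen_sub (hm : 2 ≤ m) (d s : ℝ) :
    arcAngle hm d (arcLen m d - s) = Real.pi - arcAngle hm d s := by
  rw [arcAngle_eq_iff hm, arcLength_pi_sub hm, arcLen]
  have := (arcAngle_eq_iff (d := d) hm (s := s)).1 rfl
  linarith

theorem arcAngle_arcLen (hm : 2 ≤ m) (d : ℝ) :
    arcAngle hm d (arcLen m d) = Real.pi - Real.arcsin d := by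
  have := arcAngle_arcLen_sub hm d 0
  rwa [sub_zero, arcAngle_zero] at this

theorem arcLen_pos (hm : 2 ≤ m) (hd : d < 1) : 0 < arcLen m d := by
  have := arcLength_strictMono hm d (arcsin_mem_Ico hd).2
  rw [arcLen]; linarith

theorem arcAngle_mem_Icc (hm : 2 ≤ m) {s : ℝ} :
    arcAngle hm d s ∈ Icc (Real.arcsin d) (Real.pi - Real.arcsin d) ↔ s ∈ Icc 0 (arcLen m d) := by
  rw [← arcAngle_zero hm, ← arcAngle_arcLen_sub hm, sub_zero, mem_Icc, mem_Icc,
    (arcAngle_strictMono hm d).le_iff_le, (arcAngle_strictMono hm d).le_iff_le]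

theorem arcAngle_mem_Ioo (hm : 2 ≤ m) {s : ℝ} :
    arcAngle hm d s ∈ Ioo (Real.arcsin d) (Real.pi - Real.arcsin d) ↔ s ∈ Ioo 0 (arcLen m d) := by
  rw [← arcAngle_zero hm, ← arcAngle_arcLen_sub hm, sub_zero, mem_Ioo, mem_Ioo,
    (arcAngle_strictMono hm d).lt_iff_lt, (arcAngle_strictMono hm d).lt_iff_lt]

theorem arc_zero (hm : 2 ≤ m) (hH : ((m + 1 : ℕ) : ℝ) * H = m) (hd : d < 1) :
    arc hm d 0 = (leftEnd (m + 1) H d, 0) := by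
  rw [arc, arcAngle_zero, sub_self, leftEnd_eq hm hH hd]

/-- The substitution `θ ↦ π - θ` fixes `sin θ`, hence `ρ`, and reflects arc length and height in
their values at `π / 2`. -/
theorem arc_arcLen_sub (hm : 2 ≤ m) (hH : ((m + 1 : ℕ) : ℝ) * H = m) (hd : d < 1) (s : ℝ) :
    arc hm d (arcLen m d - s) = ((arc hm d s).1, 2 * halfHeight (m + 1) H d - (arc hm d s).2) := by
  rw [arc, arc, arcAngle_arcLen_sub, height_pi_sub hm, profileDist_congr (Real.sin_pi_sub _),
    halfHeight_eq hm hH hd]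
  exact Prod.ext rfl (by ring)

theorem arc_arcLen (hm : 2 ≤ m) (hH : ((m + 1 : ℕ) : ℝ) * H = m) (hd : d < 1) :
    arc hm d (arcLen m d) = (leftEnd (m + 1) H d, 2 * halfHeight (m + 1) H d) := by
  have := arc_arcLen_sub hm hH hd 0
  rwa [arc_zero hm hH hd, sub_zero, sub_zero] at this

/-- On the first half of the arc the generating curve is the graph of the height function. -/
theorem arc_snd (hm : 2 ≤ m) (hH : ((m + 1 : ℕ) : ℝ) * H = m) (hd : d < 1) {s : ℝ}
    (hs : s ∈ Icc 0 (arcLen m d / 2)) : (arc hm d s).2 = mu (m + 1) H d (arc hm d s).1 := by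
  have h1 : arcAngle hm d (arcLen m d / 2) = Real.pi / 2 := by
    rw [arcAngle_eq_iff hm, arcLen]; ring
  have h2 : arcAngle hm d s ∈ Icc (Real.arcsin d) (Real.pi / 2) := by
    rw [← arcAngle_zero hm, ← h1]
    exact ⟨(arcAngle_strictMono hm d).monotone hs.1, (arcAngle_strictMono hm d).monotone hs.2⟩
  exact (mu_profileDist hm hH hd h2).symm

/-- The points of the fundamental arc, described by the height function. -/
def arcSet (n : ℕ) (H d : ℝ) : Set (ℝ × ℝ) :=
  {z | z.1 ∈ Icc (leftEnd n H d) (rightEnd n H d) ∧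
    (z.2 = mu n H d z.1 ∨ z.2 = 2 * halfHeight n H d - mu n H d z.1)}

theorem leftEnd_lt_arc (hm : 2 ≤ m) (hH : ((m + 1 : ℕ) : ℝ) * H = m) (hd : d < 1) {s : ℝ}
    (hs : s ∈ Ioo 0 (arcLen m d)) : leftEnd (m + 1) H d < (arc hm d s).1 := by
  have hα := arcsin_mem_Ico hd
  have key : ∀ θ ∈ Ioc (Real.arcsin d) (Real.pi / 2),
      leftEnd (m + 1) H d < profileDist m d θ := fun θ hθ => by
    rw [leftEnd_eq hm hH hd]
    exact profileDist_strictMonoOn hm d ⟨hα.1, hα.2.le⟩ ⟨hα.1.trans hθ.1.le, hθ.2⟩ hθ.1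
  have h1 := (arcAngle_mem_Ioo hm).2 hs
  rcases le_total (arcAngle hm d s) (Real.pi / 2) with h | h
  · exact key _ ⟨h1.1, h⟩
  · rw [arc, ← profileDist_congr (Real.sin_pi_sub _)]
    exact key _ ⟨by linarith [h1.2], by linarith⟩

theorem image_arc (hm : 2 ≤ m) (hH : ((m + 1 : ℕ) : ℝ) * H = m) (hd : d < 1) :
    arc hm d '' Icc 0 (arcLen m d) = arcSet (m + 1) H d := by
  have hα := arcsin_mem_Ico hd
  have hpi := Real.pi_pos
  have hL := arcLen_pos hm hd
  ext z
  constructor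
  · have hfst : ∀ s ∈ Icc 0 (arcLen m d / 2),
        (arc hm d s).1 ∈ Icc (leftEnd (m + 1) H d) (rightEnd (m + 1) H d) := fun s hs => by
      constructor
      · rcases eq_or_lt_of_le hs.1 with h | h
        · rw [← h, arc_zero hm hH hd]
        · exact (leftEnd_lt_arc hm hH hd ⟨h, by linarith [hs.2]⟩).le
      · rw [rightEnd_eq hm hH hd, le_profileDist_iff hm]
        have h1 := flux_profileDist hm d (arcAngle hm d s)
        have h2 := mul_le_mul_of_nonneg_left (Real.sin_le_one (arcAngle hm d s))
          (pow_nonneg (Real.cosh_pos (arc hm d s).1).le m)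
        simp only [flux, arc] at h1 h2 ⊢
        rw [Real.sin_pi_div_two]
        linarith
    rintro ⟨s, hs, rfl⟩
    rcases le_total s (arcLen m d / 2) with h | h
    · exact ⟨hfst s ⟨hs.1, h⟩, Or.inl (arc_snd hm hH hd ⟨hs.1, h⟩)⟩
    · have h1 : arcLen m d - s ∈ Icc 0 (arcLen m d / 2) := ⟨by linarith [hs.2], by linarith⟩
      have h2 := hfst _ h1
      have h3 := arc_snd hm hH hd h1
      rw [arc_arcLen_sub hm hH hd] at h2 h3
      exact ⟨h2, Or.inr (by linarith)⟩
  · rintro ⟨h1, h2⟩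
    rw [leftEnd_eq hm hH hd, rightEnd_eq hm hH hd] at h1
    -- This angle yields the point on the graph of `mu`; the mirrored parameter `arcLen - s` yields
    -- the point above it.
    obtain ⟨θ, hθ, hz⟩ := exists_profileDist_eq hm hα.2.le h1
    set s := arcLength m d θ - arcLength m d (Real.arcsin d) with hs
    have hθs : arcAngle hm d s = θ := arcAngle_sub hm d θ
    have hsI : s ∈ Icc 0 (arcLen m d) := by
      rw [← arcAngle_mem_Icc hm, hθs]; exact ⟨hθ.1, by linarith [hθ.2, hα.2]⟩
    have hmu : (arc hm d s).2 = mu (m + 1) H d z.1 := by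
      rw [← hz, mu_profileDist hm hH hd hθ, arc, hθs]
    have hfst : (arc hm d s).1 = z.1 := by rw [arc, hθs, hz]
    rcases h2 with h2 | h2
    · exact ⟨s, hsI, Prod.ext hfst (hmu.trans h2.symm)⟩
    · refine ⟨arcLen m d - s, ⟨by linarith [hsI.2], by linarith [hsI.1]⟩, ?_⟩
      rw [arc_arcLen_sub hm hH hd]
      exact Prod.ext hfst (by simp only; rw [hmu, h2])

theorem zpow_apply_mem_iff {C : Set (ℝ × ℝ)} {Φ : Equiv.Perm (ℝ × ℝ)} (h : ∀ z, Φ z ∈ C ↔ z ∈ C)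
    (k : ℤ) (z : ℝ × ℝ) : (Φ ^ k) z ∈ C ↔ z ∈ C := by
  induction k using Int.induction_on generalizing z with
  | zero => simp
  | succ k ih => rw [zpow_add_one, Equiv.Perm.mul_apply, ih, h]
  | pred k ih =>
    rw [zpow_sub_one, Equiv.Perm.mul_apply, ih, ← h, ← Equiv.Perm.mul_apply, mul_inv_cancel,
      Equiv.Perm.one_apply]

/-- The arc closes up under the motion. -/
theorem arc_arcLen_eq_motionPerm (hm : 2 ≤ m) (hH : ((m + 1 : ℕ) : ℝ) * H = m) (hd : d < 1) {ε : ℝ}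
    (hε : ε * ε = 1) (h : ε = 1 ∨ -1 ≤ d) :
    arc hm d (arcLen m d) = motionPerm hε (halfHeight (m + 1) H d) (arc hm d 0) := by
  rw [arc_arcLen hm hH hd, arc_zero hm hH hd, motionPerm_apply]
  rcases h with rfl | h
  · simp
  · rw [leftEnd_eq hm hH hd, profileDist_arcsin_eq_zero hm h hd.le]; simp

/-- The parametrization of the generating curve; `ε = 1` yields the periodic curve, and `ε = -1`
the closed one. -/
def genCurve (hm : 2 ≤ m) (H d : ℝ) {ε : ℝ} (hε : ε * ε = 1) : ℝ → ℝ × ℝ :=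
  gluedCurve hε (halfHeight (m + 1) H d) (arc hm d) (arcLen m d)

theorem neg_one_mul_self : (-1 : ℝ) * -1 = 1 := by norm_num

/-- The arc covers the half `ρ ≥ 0` and is already invariant under `t ↦ 2 h - t`. Hence the point
reflection alone supplies the other half, although two reflections define the curve. -/
theorem range_genCurve_neg_one (hm : 2 ≤ m) (hH : ((m + 1 : ℕ) : ℝ) * H = m) (h0 : -1 ≤ d)
    (hd : d < 1) : range (genCurve hm H d neg_one_mul_self) = closedCurve (m + 1) H d := by
  have ha : leftEnd (m + 1) H d = 0 := by
    rw [leftEnd_eq hm hH hd, profileDist_arcsin_eq_zero hm h0 hd.le]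
  rw [genCurve, range_gluedCurve _ (arcLen_pos hm hd)
    (arc_arcLen_eq_motionPerm hm hH hd _ (Or.inr h0)), image_arc hm hH hd]
  have hinv : ∀ z, motionPerm neg_one_mul_self (halfHeight (m + 1) H d) z ∈
      closedCurve (m + 1) H d ↔ z ∈ closedCurve (m + 1) H d := fun z => by
    rw [motionPerm_apply]
    simp only [closedCurve, mem_ofPred_eq, neg_mul, one_mul, abs_neg]
    refine and_congr_right fun _ => ⟨fun h => h.symm.imp ?_ ?_, fun h => h.symm.imp ?_ ?_⟩ <;>
      intro h <;> linarith
  have hsub : arcSet (m + 1) H d ⊆ closedCurve (m + 1) H d := fun z hz => by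
    have h1 : 0 ≤ z.1 := ha ▸ hz.1.1
    rw [closedCurve, mem_ofPred_eq, abs_of_nonneg h1]; exact hz
  ext z
  simp only [mem_iUnion, mem_image]
  constructor
  · rintro ⟨k, w, hw, rfl⟩
    exact (zpow_apply_mem_iff hinv k w).2 (hsub hw)
  · intro hz
    rcases le_total 0 z.1 with h | h
    · refine ⟨0, z, ?_, rfl⟩
      rw [closedCurve, mem_ofPred_eq, abs_of_nonneg h] at hz; exact hz
    · have hz' := (hinv _).2 hz
      refine ⟨1, motionPerm neg_one_mul_self (halfHeight (m + 1) H d) z, ?_, ?_⟩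
      · rw [closedCurve, mem_ofPred_eq] at hz'
        rwa [abs_of_nonneg (by rw [motionPerm_apply]; simp only; linarith)] at hz'
      · rw [zpow_one]; simp only [motionPerm_apply]
        exact Prod.ext (by simp) (by simp)

theorem motionPerm_one_zpow (h : ℝ) (k : ℤ) (z : ℝ × ℝ) :
    (motionPerm (one_mul (1 : ℝ)) h ^ k) z = (z.1, z.2 + 2 * k * h) := by
  induction k using Int.induction_on generalizing z with
  | zero => simp
  | succ k ih =>
    rw [zpow_add_one, Equiv.Perm.mul_apply, ih, motionPerm_apply]
    exact Prod.ext (by simp) (by push_cast; ring)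
  | pred k ih =>
    have h1 : (motionPerm (one_mul (1 : ℝ)) h)⁻¹ z = (z.1, z.2 - 2 * h) := by
      rw [Equiv.Perm.inv_eq_iff_eq, motionPerm_apply]
      exact Prod.ext (by simp) (by simp)
    rw [zpow_sub_one, Equiv.Perm.mul_apply, ih, h1]
    exact Prod.ext rfl (by push_cast; ring)

theorem range_genCurve_one (hm : 2 ≤ m) (hH : ((m + 1 : ℕ) : ℝ) * H = m) (hd : d < 1) :
    range (genCurve hm H d (one_mul 1)) = periodicCurve (m + 1) H d := by
  rw [genCurve, range_gluedCurve _ (arcLen_pos hm hd)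
    (arc_arcLen_eq_motionPerm hm hH hd _ (Or.inl rfl)), image_arc hm hH hd]
  ext z
  simp only [mem_iUnion, mem_image, motionPerm_one_zpow]
  constructor
  · rintro ⟨k, w, ⟨hw1, hw2⟩, rfl⟩
    rcases hw2 with hw2 | hw2
    · exact ⟨hw1, k, Or.inl (by simp only; rw [hw2]; ring)⟩
    -- The upper half `2 h - μ` of the `k`-th arc carries the index `k + 1`.
    · exact ⟨hw1, k + 1, Or.inr (by simp only; rw [hw2]; push_cast; ring)⟩
  · rintro ⟨h1, k, h2 | h2⟩
    · exact ⟨k, (z.1, mu (m + 1) H d z.1), ⟨h1, Or.inl rfl⟩,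
        Prod.ext rfl (by simp only; rw [h2]; ring)⟩
    · exact ⟨k - 1, (z.1, 2 * halfHeight (m + 1) H d - mu (m + 1) H d z.1), ⟨h1, Or.inr rfl⟩,
        Prod.ext rfl (by simp only; rw [h2]; push_cast; ring)⟩

/-- For `d = 0` the curve is invariant under a point reflection. -/
theorem genCurve_zero (hm : 2 ≤ m) (hH : ((m + 1 : ℕ) : ℝ) * H = m) :
    genCurve hm H 0 neg_one_mul_self = arc hm 0 := by
  -- For `d = 0` the equation `flux = 0` is invariant under `(θ, r) ↦ (θ + π, -r)`, so the
  -- continuation of the arc is its image under the point reflection.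
  have hP : ∀ θ, profileDist m 0 (θ + Real.pi) = -profileDist m 0 θ := fun θ => by
    rw [profileDist_eq_iff hm]
    have := flux_profileDist hm 0 θ
    rw [flux] at this ⊢
    rw [Real.sin_add_pi, Real.cosh_neg, J_neg]; linarith
  have hw : ∀ θ, arcDensity m 0 (θ + Real.pi) = arcDensity m 0 θ := fun θ => by
    rw [arcDensity, arcDensity, hP, Real.sin_add_pi, Real.tanh_neg, neg_mul_neg]
  have hA : ∀ θ, arcLength m 0 (θ + Real.pi) = arcLength m 0 θ + arcLen m 0 := fun θ => by
    have h := sub_eq_sub_of_hasDerivAt (F := fun θ => arcLength m 0 (θ + Real.pi))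
      (fun θ => (HasDerivAt.comp_add_const θ Real.pi (hasDerivAt_arcLength hm 0 _)).congr_deriv
        (hw θ)) (hasDerivAt_arcLength hm 0) θ 0
    have h2 := arcLength_pi_sub hm 0 0
    simp only [zero_add, sub_zero] at h h2
    rw [arcLen, Real.arcsin_zero]; linarith
  have hh : ∀ θ, height m 0 (θ + Real.pi) - height m 0 0 =
      2 * halfHeight (m + 1) H 0 - (height m 0 θ - height m 0 0) := fun θ => by
    have h := sub_eq_sub_of_hasDerivAt (F := fun θ => -height m 0 (θ + Real.pi))
      (fun θ => (HasDerivAt.comp_add_const θ Real.pi (hasDerivAt_height hm 0 _)).neg.congr_deriv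
        (by rw [hw θ, Real.sin_add_pi]; ring)) (hasDerivAt_height hm 0) θ 0
    have h2 := height_pi_sub hm 0 0
    simp only [zero_add, sub_zero] at h h2
    rw [halfHeight_eq hm hH one_pos, Real.arcsin_zero]; linarith
  refine gluedCurve_eq_of_equivariant _ fun s => ?_
  have h1 : arcAngle hm 0 (s + arcLen m 0) = arcAngle hm 0 s + Real.pi := by
    rw [arcAngle_eq_iff hm, hA]
    have := (arcAngle_eq_iff (d := 0) hm (s := s)).1 rfl
    linarith
  rw [arc, h1, hP, motionPerm_apply, arc, Real.arcsin_zero, hh]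
  exact Prod.ext (by simp) (by simp only; ring)

/-- For `d ≤ -1` the curve is invariant under a vertical translation. -/
theorem genCurve_of_le (hm : 2 ≤ m) (hH : ((m + 1 : ℕ) : ℝ) * H = m) (hd : d ≤ -1) :
    genCurve hm H d (one_mul 1) = arc hm d := by
  -- The clamped value makes the arc exactly one full turn of the angle, from `-π / 2` to `3 π / 2`.
  have hα : Real.arcsin d = -(Real.pi / 2) := Real.arcsin_of_le_neg_one hd
  have hw : ∀ θ, arcDensity m d (θ + 2 * Real.pi) = arcDensity m d θ := fun θ =>
    arcDensity_congr (Real.sin_add_two_pi θ)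
  have hA : ∀ θ, arcLength m d (θ + 2 * Real.pi) = arcLength m d θ + arcLen m d := fun θ => by
    have h := sub_eq_sub_of_hasDerivAt (F := fun θ => arcLength m d (θ + 2 * Real.pi))
      (fun θ => (HasDerivAt.comp_add_const θ (2 * Real.pi)
        (hasDerivAt_arcLength hm d _)).congr_deriv (hw θ)) (hasDerivAt_arcLength hm d) θ
        (-(Real.pi / 2))
    have h2 := arcLength_pi_sub hm d (-(Real.pi / 2))
    rw [show Real.pi - -(Real.pi / 2) = -(Real.pi / 2) + 2 * Real.pi by ring] at h2
    rw [arcLen, hα]; linarith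
  have hh : ∀ θ, height m d (θ + 2 * Real.pi) =
      height m d θ + 2 * halfHeight (m + 1) H d := fun θ => by
    have h := sub_eq_sub_of_hasDerivAt (F := fun θ => height m d (θ + 2 * Real.pi))
      (fun θ => (HasDerivAt.comp_add_const θ (2 * Real.pi)
        (hasDerivAt_height hm d _)).congr_deriv (by rw [hw θ, Real.sin_add_two_pi]))
        (hasDerivAt_height hm d) θ (-(Real.pi / 2))
    have h2 := height_pi_sub hm d (-(Real.pi / 2))
    rw [show Real.pi - -(Real.pi / 2) = -(Real.pi / 2) + 2 * Real.pi by ring] at h2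
    rw [halfHeight_eq hm hH (by linarith), hα]; linarith
  refine gluedCurve_eq_of_equivariant _ fun s => ?_
  have h1 : arcAngle hm d (s + arcLen m d) = arcAngle hm d s + 2 * Real.pi := by
    rw [arcAngle_eq_iff hm, hA]
    have := (arcAngle_eq_iff (d := d) hm (s := s)).1 rfl
    linarith
  rw [arc, h1, profileDist_congr (Real.sin_add_two_pi _), motionPerm_apply, arc, hh]
  exact Prod.ext (by simp) (by simp only; ring)

end

end

end TranslationH

namespace TranslationH

noncomputable section

/-! ### Convex regions and closed curves -/

/-- If `|x| ≠ |y|`, strict convexity on `[0, r]` and monotonicity suffice. In the remaining case `y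
= -x` strictness comes from `|a x + b y| < |x|`. -/
theorem StrictConvexOn.comp_abs {f : ℝ → ℝ} {r : ℝ} (hf : StrictConvexOn ℝ (Icc 0 r) f)
    (hmono : StrictMonoOn f (Icc 0 r)) : StrictConvexOn ℝ (Icc (-r) r) fun x => f |x| := by
  refine ⟨convex_Icc _ _, fun x hx y hy hxy a b ha hb hab => ?_⟩
  have hx' : |x| ∈ Icc 0 r := ⟨abs_nonneg x, abs_le.2 hx⟩
  have hy' : |y| ∈ Icc 0 r := ⟨abs_nonneg y, abs_le.2 hy⟩
  have hz' : a * |x| + b * |y| ∈ Icc 0 r := convex_Icc 0 r hx' hy' ha.le hb.le hab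
  have hle : |a * x + b * y| ≤ a * |x| + b * |y| := by
    refine (abs_add_le _ _).trans ?_
    rw [abs_mul, abs_mul, abs_of_pos ha, abs_of_pos hb]
  have hw' : |a * x + b * y| ∈ Icc 0 r := ⟨abs_nonneg _, hle.trans hz'.2⟩
  simp only [smul_eq_mul]
  by_cases h : |x| = |y|
  · have hyx : y = -x := by
      rcases abs_eq_abs.1 h with h | h
      · exact absurd h hxy
      · rw [h, neg_neg]
    have hx0 : 0 < |x| := abs_pos.2 fun h0 => hxy (by rw [hyx, h0, neg_zero])
    have hlt : |a * x + b * y| < |x| := by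
      rw [hyx, show a * x + b * -x = (a - b) * x by ring, abs_mul]
      refine mul_lt_of_lt_one_left hx0 (abs_lt.2 ⟨by linarith, by linarith⟩)
    rw [← h, ← add_mul, hab, one_mul]
    exact hmono hw' hx' hlt
  · exact (hmono.monotoneOn hw' hz' hle).trans_lt (hf.2 hx' hy' h ha hb hab)

/-- The region between the graph of a strictly convex function and its mirror image. -/
theorem exists_strictConvex_frontier {g : ℝ → ℝ} {r h : ℝ} (hg : Continuous g) (hr : 0 < r)
    (hconv : StrictConvexOn ℝ (Icc (-r) r) g) (h1 : g (-r) = h) (h2 : g r = h) :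
    ∃ K : Set (ℝ × ℝ), IsCompact K ∧ (interior K).Nonempty ∧ StrictConvex ℝ K ∧
      frontier K = {z | z.1 ∈ Icc (-r) r ∧ (z.2 = g z.1 ∨ z.2 = 2 * h - g z.1)} := by
  set K : Set (ℝ × ℝ) := {z | z.1 ∈ Icc (-r) r ∧ g z.1 ≤ z.2 ∧ z.2 ≤ 2 * h - g z.1} with hK
  -- The chord between the end points is horizontal at height `h`, and a strictly convex graph lies
  -- below it.
  have hlt : ∀ x ∈ Ioo (-r) r, g x < h := fun x hx => by
    have hne : -r ≠ r := by linarith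
    have h3 : g (((r - x) / (2 * r)) • (-r) + ((r + x) / (2 * r)) • r) <
        ((r - x) / (2 * r)) • g (-r) + ((r + x) / (2 * r)) • g r :=
      hconv.2 (left_mem_Icc.2 (by linarith)) (right_mem_Icc.2 (by linarith)) hne
      (div_pos (by linarith [hx.2]) (by linarith))
      (div_pos (by linarith [hx.1]) (by linarith)) (by field_simp; ring)
    have h4 : ((r - x) / (2 * r)) • (-r) + ((r + x) / (2 * r)) • r = x := by
      simp only [smul_eq_mul]; field_simp; ring
    rw [h4, h1, h2] at h3
    have h5 : ((r - x) / (2 * r)) • h + ((r + x) / (2 * r)) • h = h := by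
      simp only [smul_eq_mul]; field_simp; ring
    rwa [h5] at h3
  have hle : ∀ x ∈ Icc (-r) r, g x ≤ h := fun x hx => by
    rcases eq_or_lt_of_le hx.1 with h3 | h3
    · rw [← h3, h1]
    rcases eq_or_lt_of_le hx.2 with h4 | h4
    · rw [h4, h2]
    exact (hlt x ⟨h3, h4⟩).le
  have hO : {z : ℝ × ℝ | z.1 ∈ Ioo (-r) r ∧ g z.1 < z.2 ∧ z.2 < 2 * h - g z.1} ⊆ interior K := by
    refine interior_maximal (fun z hz => ⟨Ioo_subset_Icc_self hz.1, hz.2.1.le, hz.2.2.le⟩) ?_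
    exact (isOpen_Ioo.preimage continuous_fst).inter
      ((isOpen_lt (hg.comp continuous_fst) continuous_snd).inter
        (isOpen_lt continuous_snd (continuous_const.sub (hg.comp continuous_fst))))
  have hclosed : IsClosed K :=
    (isClosed_Icc.preimage continuous_fst).inter
      ((isClosed_le (hg.comp continuous_fst) continuous_snd).inter
        (isClosed_le continuous_snd (continuous_const.sub (hg.comp continuous_fst))))
  obtain ⟨B, hB⟩ := (isCompact_Icc (a := -r) (b := r)).bddBelow_image hg.continuousOn
  have hB' : ∀ x ∈ Icc (-r) r, B ≤ g x := fun x hx => hB (mem_image_of_mem g hx)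
  refine ⟨K, ?_, ⟨(0, h), hO ⟨⟨by simpa using hr, hr⟩, ?_, ?_⟩⟩, ?_, ?_⟩
  · refine (isCompact_Icc.prod isCompact_Icc :
      IsCompact (Icc (-r) r ×ˢ Icc B (2 * h - B))).of_isClosed_subset hclosed fun z hz => ?_
    exact ⟨hz.1, (hB' _ hz.1).trans hz.2.1, by linarith [hB' _ hz.1, hz.2.2]⟩
  · exact hlt 0 ⟨by simpa using hr, hr⟩
  · have := hlt 0 ⟨by simpa using hr, hr⟩
    simp only; linarith
  · intro x hx y hy hxy a b ha hb hab
    refine hO ?_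
    have h6 := mul_le_mul_of_nonneg_left hx.2.1 ha.le
    have h7 := mul_le_mul_of_nonneg_left hy.2.1 hb.le
    have h8 := mul_le_mul_of_nonneg_left hx.2.2 ha.le
    have h9 := mul_le_mul_of_nonneg_left hy.2.2 hb.le
    have hah : a * h + b * h = h := by rw [← add_mul, hab, one_mul]
    simp only [mem_ofPred_eq, Prod.fst_add, Prod.snd_add, Prod.smul_fst, Prod.smul_snd,
      smul_eq_mul]
    -- Two distinct points on one vertical line cannot lie over `±r`, where the fibre is a single
    -- point, and the open segment between them is strictly inside the fibre. Otherwise strict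
    -- convexity of `g` gives strict inequalities.
    by_cases h3 : x.1 = y.1
    · have h4 : x.2 ≠ y.2 := fun h4 => hxy (Prod.ext h3 h4)
      have h5 : a * x.1 + b * y.1 = x.1 := by rw [← h3, ← add_mul, hab, one_mul]
      have h10 : x.1 ∈ Ioo (-r) r := by
        refine ⟨lt_of_le_of_ne hx.1.1 fun h11 => h4 ?_, lt_of_le_of_ne hx.1.2 fun h11 => h4 ?_⟩
        · have e1 := hx.2; have e2 := hy.2
          rw [← h3] at e2; rw [← h11, h1] at e1 e2; linarith [e1.1, e1.2, e2.1, e2.2]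
        · have e1 := hx.2; have e2 := hy.2
          rw [← h3] at e2; rw [h11, h2] at e1 e2; linarith [e1.1, e1.2, e2.1, e2.2]
      rw [h5]
      have e2 := hy.2
      rw [← h3] at e2
      refine ⟨h10, ?_, ?_⟩
      · rcases lt_or_gt_of_ne h4 with h | h
        · nlinarith [hx.2.1]
        · nlinarith [hx.2.1]
      · rcases lt_or_gt_of_ne h4 with h | h
        · nlinarith [hx.2.2]
        · nlinarith [hx.2.2]
    · have h5 := hconv.2 hx.1 hy.1 h3 ha hb hab
      simp only [smul_eq_mul] at h5
      refine ⟨?_, by linarith, by linarith⟩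
      rcases lt_or_gt_of_ne h3 with h | h
      · constructor <;> nlinarith [hx.1.1, hx.1.2, hy.1.1, hy.1.2]
      · constructor <;> nlinarith [hx.1.1, hx.1.2, hy.1.1, hy.1.2]
  · rw [hclosed.frontier_eq]
    ext z
    have hline : Continuous fun t : ℝ => (z.1, t) := by fun_prop
    constructor
    · rintro ⟨hz, hzi⟩
      refine ⟨hz.1, ?_⟩
      by_contra hne
      rw [not_or] at hne
      have h3 := lt_of_le_of_ne hz.2.1 (Ne.symm hne.1)
      have h4 := lt_of_le_of_ne hz.2.2 hne.2
      refine hzi (hO ⟨⟨lt_of_le_of_ne hz.1.1 fun h5 => ?_, lt_of_le_of_ne hz.1.2 fun h5 => ?_⟩,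
        h3, h4⟩)
      · rw [← h5, h1] at h3 h4; linarith
      · rw [h5, h2] at h3 h4; linarith
    · rintro ⟨hz, hz2⟩
      have h3 := hle _ hz
      refine ⟨⟨hz, ?_, ?_⟩, fun hzi => ?_⟩
      · rcases hz2 with h | h <;> linarith
      · rcases hz2 with h | h <;> linarith
      · have h4 : ∀ᶠ t in 𝓝 z.2, (z.1, t) ∈ K :=
          hline.continuousAt.eventually (mem_interior_iff_mem_nhds.1 hzi)
        -- An arbitrarily small vertical displacement moves a point of the lower graph down, or of
        -- the upper graph up, out of `K`.
        rcases hz2 with h | h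
        · obtain ⟨t, ht, htK⟩ := ((frequently_lt_nhds z.2).and_eventually h4).exists
          exact absurd htK.2.1 (not_le.2 (h ▸ ht))
        · obtain ⟨t, ht, htK⟩ := ((frequently_gt_nhds z.2).and_eventually h4).exists
          exact absurd htK.2.2 (not_le.2 (h ▸ ht))

/-- The circle is compact, so an injective continuous map from it into a Hausdorff space is a closed
embedding. -/
theorem isEmbedding_lift {X : Type*} [TopologicalSpace X] [T2Space X] {c : ℝ → X} {L : ℝ}
    (hL : 0 < L) (hc : Function.Periodic c L) (hcont : Continuous c) (hinj : InjOn c (Ico 0 L)) :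
    IsEmbedding (hc.lift : AddCircle L → X) := by
  have : Fact (0 < L) := ⟨hL⟩
  have h1 : Continuous (hc.lift : AddCircle L → X) := hcont.quotient_lift _
  have h2 : Function.Injective (hc.lift : AddCircle L → X) := fun x y hxy => by
    obtain ⟨s, hs, rfl⟩ := AddCircle.eq_coe_Ico x
    obtain ⟨t, ht, rfl⟩ := AddCircle.eq_coe_Ico y
    rw [Function.Periodic.lift_coe, Function.Periodic.lift_coe] at hxy
    rw [hinj hs ht hxy]
  exact (h1.isClosedEmbedding h2).isEmbedding

/-- Short paths are found in the parameter space over the line. The open map to the circle and the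
embedding carry the neighbourhood over to the hypersurface. -/
theorem IsEmbedding.eventually_nhdsWithin_range {X Y Z : Type*} [TopologicalSpace X]
    [TopologicalSpace Y] [TopologicalSpace Z] {F : Y → Z} (hF : IsEmbedding F) {G : X → Y}
    (hG : IsOpenMap G) {x : X} {P : Z → Prop} (h : ∀ᶠ y in 𝓝 x, P (F (G y))) :
    ∀ᶠ z in 𝓝[range F] (F (G x)), P z := by
  rw [← hF.map_nhds_eq, eventually_map]
  exact Eventually.filter_mono (hG.nhds_le x) (eventually_map.2 h)

variable {n : ℕ} {e : EuclideanSpace ℝ (Fin n)}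

/-- The parametrization of the hypersurface that is generated by a closed curve. -/
def closedMap (e : EuclideanSpace ℝ (Fin n)) {c : ℝ → ℝ × ℝ} {L : ℝ} (hc : Function.Periodic c L)
    (q : ↥(Metric.ball (0 : ↥(ℝ ∙ e)ᗮ) 1) × AddCircle L) : Amb n :=
  translationMap e (hc.lift : AddCircle L → ℝ × ℝ) ((q.1 : ↥(ℝ ∙ e)ᗮ), q.2)

theorem closedMap_coe {c : ℝ → ℝ × ℝ} {L : ℝ} (hc : Function.Periodic c L)
    (b : ↥(Metric.ball (0 : ↥(ℝ ∙ e)ᗮ) 1)) (t : ℝ) :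
    closedMap e hc (b, (t : AddCircle L)) = translationMap e c ((b : ↥(ℝ ∙ e)ᗮ), t) := rfl

theorem range_closedMap {c : ℝ → ℝ × ℝ} {L : ℝ} (hL : 0 < L) (hc : Function.Periodic c L) :
    range (closedMap e hc) = translationHypersurface e (range c) := by
  have : Fact (0 < L) := ⟨hL⟩
  ext p
  constructor
  · rintro ⟨⟨b, x⟩, rfl⟩
    obtain ⟨t, -, rfl⟩ := AddCircle.eq_coe_Ico x
    rw [closedMap_coe]
    exact ⟨_, mem_ball_zero_iff.1 b.2, inner_orthogonal _, c t, mem_range_self t, rfl⟩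
  · intro hp
    obtain ⟨⟨b, t⟩, hb, rfl⟩ := exists_translationMap_eq hp
    exact ⟨(⟨b, mem_ball_zero_iff.2 hb⟩, (t : AddCircle L)), closedMap_coe hc _ _⟩

theorem isInducedComplete_of_isEmbedding_lift (he : ‖e‖ = 1) {c : ℝ → ℝ × ℝ} {L : ℝ} (hL : 0 < L)
    (hc : Function.Periodic c L) (hps : IsPiecewiseSmooth c) (hclosed : IsClosed (range c))
    (hemb : IsEmbedding (closedMap e hc)) :
    IsInducedComplete (translationHypersurface e (range c)) id := by
  refine isInducedComplete_translationHypersurface he hclosed fun p hp ε hε => ?_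
  obtain ⟨⟨a, s⟩, ha, rfl⟩ := exists_translationMap_eq hp
  have hg : Continuous fun q : ↥(Metric.ball (0 : ↥(ℝ ∙ e)ᗮ) 1) × ℝ =>
      ((q.1 : ↥(ℝ ∙ e)ᗮ), q.2) :=
    (continuous_subtype_val.comp continuous_fst).prodMk continuous_snd
  have h1 := (hg.tendsto (⟨a, mem_ball_zero_iff.2 ha⟩, s)).eventually
    (eventually_joinedWithin he hps (q₀ := (a, s)) ha hε)
  have hG : IsOpenMap fun q : ↥(Metric.ball (0 : ↥(ℝ ∙ e)ᗮ) 1) × ℝ =>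
      (q.1, (q.2 : AddCircle L)) :=
    IsOpenMap.id.prodMap (QuotientAddGroup.isOpenMap_coe (N := AddSubgroup.zmultiples L))
  have h2 : ∀ᶠ q : ↥(Metric.ball (0 : ↥(ℝ ∙ e)ᗮ) 1) × ℝ in 𝓝 (⟨a, mem_ball_zero_iff.2 ha⟩, s),
      JoinedWithin (translationHypersurface e (range c)) id ε
        (closedMap e hc (q.1, (q.2 : AddCircle L))) (translationMap e c (a, s)) := by
    filter_upwards [h1] with q hq
    rw [closedMap_coe]
    exact joinedWithin_translationHypersurface hq
  have h3 := IsEmbedding.eventually_nhdsWithin_range hemb hG (P := fun p' =>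
    JoinedWithin (translationHypersurface e (range c)) id ε p' (translationMap e c (a, s))) h2
  rw [range_closedMap hL hc, closedMap_coe] at h3
  exact h3

end

end TranslationH

namespace TranslationH

noncomputable section

/-! ### The parametrization of the generating curve -/

section

variable {m : ℕ} {d H : ℝ}

theorem leftEnd_eq_zero (hm : 2 ≤ m) (hH : ((m + 1 : ℕ) : ℝ) * H = m) (h0 : -1 ≤ d) (hd : d < 1) :
    leftEnd (m + 1) H d = 0 := by
  rw [leftEnd_eq hm hH hd, profileDist_arcsin_eq_zero hm h0 hd.le]

section

variable {ε : ℝ} (hε : ε * ε = 1)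

theorem isPiecewiseSmooth_genCurve (hm : 2 ≤ m) (hH : ((m + 1 : ℕ) : ℝ) * H = m) (hd : d < 1)
    (h : ε = 1 ∨ -1 ≤ d) : IsPiecewiseSmooth (genCurve hm H d hε) :=
  isPiecewiseSmooth_gluedCurve hε (arcLen_pos hm hd) (arc_arcLen_eq_motionPerm hm hH hd hε h)
    (contDiff_arc hm d)

/-- The motions multiply `ρ` by `±1`, and by `leftEnd_lt_arc` the arc meets `ρ = 0` only at its
ends. -/
theorem genCurve_fst_eq_zero_iff (hm : 2 ≤ m) (hH : ((m + 1 : ℕ) : ℝ) * H = m) (h0 : -1 ≤ d)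
    (hd : d < 1) {s : ℝ} : (genCurve hm H d hε s).1 = 0 ↔ ∃ k : ℤ, s = k * arcLen m d := by
  have hL := arcLen_pos hm hd
  have ha := leftEnd_eq_zero hm hH h0 hd
  set k := ⌊s / arcLen m d⌋ with hk
  have hfl : k * arcLen m d ≤ s := (le_div_iff₀ hL).1 (Int.floor_le _)
  have hfl' : s < (k + 1) * arcLen m d := (div_lt_iff₀ hL).1 (Int.lt_floor_add_one _)
  obtain ⟨η, τ, hη, hz⟩ := exists_motionPerm_zpow hε (h := halfHeight (m + 1) H d) k
  have hη0 : η ≠ 0 := fun h => by simp [h] at hη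
  have h1 : (genCurve hm H d hε s).1 = η * (arc hm d (s - k * arcLen m d)).1 := by
    rw [genCurve, gluedCurve, ← hk, hz]; rfl
  rw [h1, mul_eq_zero, or_iff_right hη0]
  constructor
  · intro h2
    refine ⟨k, le_antisymm (not_lt.1 fun h3 => ?_) hfl⟩
    have := leftEnd_lt_arc hm hH hd (s := s - k * arcLen m d) ⟨by linarith, by linarith⟩
    rw [ha, h2] at this
    exact lt_irrefl _ this
  · rintro ⟨j, hj⟩
    have : k = j := by rw [hk, hj, mul_div_cancel_right₀ _ hL.ne', Int.floor_intCast]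
    rw [this, hj, sub_self, arc_zero hm hH hd, ha]

theorem isHPoint_genCurve (hm : 2 ≤ m) (hH : ((m + 1 : ℕ) : ℝ) * H = m) (h0 : -1 ≤ d)
    (hd : d < 1) {s : ℝ} (hs : (genCurve hm H d hε s).1 ≠ 0) :
    IsHPoint m (genCurve hm H d hε) s :=
  isHPoint_gluedCurve hε (arcLen_pos hm hd)
    (arc_arcLen_eq_motionPerm hm hH hd hε (Or.inr h0)) (isHPoint_arc hm d) fun k hk =>
      hs ((genCurve_fst_eq_zero_iff hε hm hH h0 hd).2 ⟨k, hk⟩)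

/-- With `α = arcsin d` the arc starts with velocity `(cos α, sin α)` and ends with `(-cos α, sin
α)`. For `ε = 1` these match only if `cos α = 0`, which `-1 < d < 1` excludes; for `ε = -1` only if
`sin α = d` vanishes. -/
theorem not_differentiableAt_genCurve (hm : 2 ≤ m) (hH : ((m + 1 : ℕ) : ℝ) * H = m) (h0 : -1 < d)
    (hd : d < 1) (h : ε = 1 ∨ d ≠ 0) {s : ℝ} (hs : (genCurve hm H d hε s).1 = 0) :
    ¬ DifferentiableAt ℝ (genCurve hm H d hε) s := by
  obtain ⟨k, rfl⟩ := (genCurve_fst_eq_zero_iff hε hm hH h0.le hd).1 hs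
  have d0 := hasDerivAt_arc hm d 0
  have d1 := hasDerivAt_arc hm d (arcLen m d)
  rw [arcAngle_zero] at d0
  rw [arcAngle_arcLen, Real.cos_pi_sub, Real.sin_pi_sub] at d1
  refine not_differentiableAt_gluedCurve hε (arcLen_pos hm hd)
    (arc_arcLen_eq_motionPerm hm hH hd hε (Or.inr h0.le)) d0 d1 (fun he => ?_) k
  have e1 := congrArg Prod.fst he
  have e2 := congrArg Prod.snd he
  simp only [Prod.smul_fst, Prod.smul_snd, smul_eq_mul] at e1 e2
  rw [Real.sin_arcsin h0.le hd.le] at e2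
  rcases mul_self_eq_one_iff.1 hε with rfl | rfl
  · have hc : 0 < Real.cos (Real.arcsin d) :=
      Real.cos_pos_of_mem_Ioo ⟨Real.neg_pi_div_two_lt_arcsin.2 h0, Real.arcsin_lt_pi_div_two.2 hd⟩
    linarith
  · rcases h with h | h
    · norm_num at h
    · exact h (by linarith)

end

/-! ### The height function on the symmetric interval -/

/-- The continuous extension of the even extension of the height function. -/
def evenHeight (m : ℕ) (d r : ℝ) : ℝ :=
  height m d (Real.arcsin (sinAngle m d |r|)) - height m d (Real.arcsin d)

theorem continuous_evenHeight (hm : 2 ≤ m) (d : ℝ) : Continuous (evenHeight m d) :=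
  ((contDiff_height hm d).continuous.comp (Real.continuous_arcsin.comp
    ((continuous_sinAngle m d).comp continuous_abs))).sub continuous_const

theorem mu_abs_eq (hm : 2 ≤ m) (hH : ((m + 1 : ℕ) : ℝ) * H = m) (hd : d < 1) {r : ℝ}
    (hr : |r| ∈ Icc (leftEnd (m + 1) H d) (rightEnd (m + 1) H d)) :
    mu (m + 1) H d |r| = evenHeight m d r := by
  rw [leftEnd_eq hm hH hd, rightEnd_eq hm hH hd] at hr
  exact mu_eq hm hH hd hr

theorem evenHeight_neg (m : ℕ) (d r : ℝ) : evenHeight m d (-r) = evenHeight m d r := by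
  rw [evenHeight, evenHeight, abs_neg]

theorem rightEnd_pos (hm : 2 ≤ m) (hH : ((m + 1 : ℕ) : ℝ) * H = m)
    (hd : d < 1) : 0 < rightEnd (m + 1) H d := by
  have h := isGeneratingSolution (d := d) hm hH hd
  exact h.left_nonneg.trans_lt h.left_lt_right

theorem closedCurve_eq (hm : 2 ≤ m) (hH : ((m + 1 : ℕ) : ℝ) * H = m) (h0 : 0 ≤ d)
    (hd : d < 1) : closedCurve (m + 1) H d =
    {z | z.1 ∈ Icc (-rightEnd (m + 1) H d) (rightEnd (m + 1) H d) ∧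
      (z.2 = evenHeight m d z.1 ∨ z.2 = 2 * halfHeight (m + 1) H d - evenHeight m d z.1)} := by
  have ha := leftEnd_eq_zero hm hH (by linarith) hd
  ext z
  simp only [closedCurve, mem_ofPred_eq]
  have : |z.1| ∈ Icc (leftEnd (m + 1) H d) (rightEnd (m + 1) H d) ↔
      z.1 ∈ Icc (-rightEnd (m + 1) H d) (rightEnd (m + 1) H d) := by
    rw [ha, mem_Icc, and_iff_right (abs_nonneg _), abs_le, mem_Icc]
  rw [← this]
  refine and_congr_right fun hz => ?_
  rw [mu_abs_eq hm hH hd hz]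

theorem evenHeight_rightEnd (hm : 2 ≤ m) (hH : ((m + 1 : ℕ) : ℝ) * H = m) (h0 : 0 ≤ d)
    (hd : d < 1) : evenHeight m d (rightEnd (m + 1) H d) = halfHeight (m + 1) H d := by
  have hr := rightEnd_pos hm hH hd
  have ha := leftEnd_eq_zero hm hH (by linarith) hd
  rw [← mu_abs_eq hm hH hd (by rw [ha, abs_of_pos hr]; exact ⟨hr.le, le_rfl⟩), abs_of_pos hr]
  rfl

theorem hasDerivAt_height_arcsin_tan (hm : 2 ≤ m) (hH : ((m + 1 : ℕ) : ℝ) * H = m) (h0 : 0 ≤ d)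
    (hd : d < 1) {r : ℝ} (hr : r ∈ Ioo 0 (rightEnd (m + 1) H d)) :
    Real.arcsin (sinAngle m d r) ∈ Ioo (Real.arcsin d) (Real.pi / 2) ∧
    profileDist m d (Real.arcsin (sinAngle m d r)) = r ∧
    HasDerivAt (fun r => height m d (Real.arcsin (sinAngle m d r)) - height m d (Real.arcsin d))
      (Real.tan (Real.arcsin (sinAngle m d r))) r := by
  rw [← leftEnd_eq_zero (d := d) hm hH (by linarith) hd, leftEnd_eq hm hH hd,
    rightEnd_eq hm hH hd] at hr
  obtain ⟨h1, h2, -⟩ := hasDerivAt_arcsin_sinAngle hm hd hr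
  refine ⟨h1, h2, ((hasDerivAt_height_arcsin hm hH hd hr).sub_const _).congr_deriv ?_⟩
  rw [slope_eq hH, Real.tan_eq_sin_div_cos, sin_arcsin_sinAngle hm hd (Ioo_subset_Icc_self hr)]

/-- The derivative is `tan θ`, and `θ` increases with `r`. -/
theorem strictConvexOn_height_arcsin (hm : 2 ≤ m) (hH : ((m + 1 : ℕ) : ℝ) * H = m) (h0 : 0 ≤ d)
    (hd : d < 1) : StrictConvexOn ℝ (Icc 0 (rightEnd (m + 1) H d))
    fun r => height m d (Real.arcsin (sinAngle m d r)) - height m d (Real.arcsin d) := by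
  have hα := arcsin_mem_Ico hd
  refine StrictMonoOn.strictConvexOn_of_deriv (convex_Icc _ _) ?_ ?_
  · exact (((contDiff_height hm d).continuous.comp (Real.continuous_arcsin.comp
      (continuous_sinAngle m d))).sub continuous_const).continuousOn
  · rw [interior_Icc]
    intro r hr r' hr' hlt
    obtain ⟨h1, h2, h3⟩ := hasDerivAt_height_arcsin_tan hm hH h0 hd hr
    obtain ⟨h1', h2', h3'⟩ := hasDerivAt_height_arcsin_tan hm hH h0 hd hr'
    rw [h3.deriv, h3'.deriv]
    refine Real.strictMonoOn_tan ⟨hα.1.trans_lt h1.1, h1.2⟩ ⟨hα.1.trans_lt h1'.1, h1'.2⟩ ?_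
    rw [← (profileDist_strictMonoOn hm d).lt_iff_lt ⟨hα.1.trans h1.1.le, h1.2.le⟩
      ⟨hα.1.trans h1'.1.le, h1'.2.le⟩, h2, h2']
    exact hlt

theorem strictMonoOn_height_arcsin (hm : 2 ≤ m) (hH : ((m + 1 : ℕ) : ℝ) * H = m) (h0 : 0 ≤ d)
    (hd : d < 1) : StrictMonoOn
    (fun r => height m d (Real.arcsin (sinAngle m d r)) - height m d (Real.arcsin d))
    (Icc 0 (rightEnd (m + 1) H d)) := by
  refine strictMonoOn_of_deriv_pos (convex_Icc _ _) ?_ fun r hr => ?_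
  · exact (((contDiff_height hm d).continuous.comp (Real.continuous_arcsin.comp
      (continuous_sinAngle m d))).sub continuous_const).continuousOn
  · rw [interior_Icc] at hr
    obtain ⟨h1, -, h3⟩ := hasDerivAt_height_arcsin_tan hm hH h0 hd hr
    rw [h3.deriv]
    exact Real.tan_pos_of_pos_of_lt_pi_div_two ((Real.arcsin_nonneg.2 h0).trans_lt h1.1) h1.2

theorem strictConvexOn_evenHeight (hm : 2 ≤ m) (hH : ((m + 1 : ℕ) : ℝ) * H = m) (h0 : 0 ≤ d)
    (hd : d < 1) : StrictConvexOn ℝ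
    (Icc (-rightEnd (m + 1) H d) (rightEnd (m + 1) H d)) (evenHeight m d) :=
  StrictConvexOn.comp_abs (strictConvexOn_height_arcsin hm hH h0 hd)
    (strictMonoOn_height_arcsin hm hH h0 hd)

theorem evenHeight_zero (m : ℕ) (d : ℝ) : evenHeight m d 0 = 0 := by
  rw [evenHeight, abs_zero, sinAngle, J_zero, Real.cosh_zero]; simp

theorem evenHeight_nonneg (hm : 2 ≤ m) (hH : ((m + 1 : ℕ) : ℝ) * H = m) (h0 : 0 ≤ d)
    (hd : d < 1) {r : ℝ} (hr : r ∈ Icc (-rightEnd (m + 1) H d) (rightEnd (m + 1) H d)) :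
    0 ≤ evenHeight m d r := by
  have h := (strictMonoOn_height_arcsin hm hH h0 hd).monotoneOn
    ⟨le_rfl, (rightEnd_pos hm hH hd).le⟩ ⟨abs_nonneg r, abs_le.2 hr⟩ (abs_nonneg r)
  have h1 := evenHeight_zero m d
  rw [evenHeight, abs_zero] at h1
  simp only [h1] at h
  exact h

theorem evenHeight_lt_iff (hm : 2 ≤ m) (hH : ((m + 1 : ℕ) : ℝ) * H = m) (h0 : 0 ≤ d)
    (hd : d < 1) {r : ℝ} (hr : r ∈ Icc (-rightEnd (m + 1) H d) (rightEnd (m + 1) H d)) :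
    evenHeight m d r < halfHeight (m + 1) H d ↔
      r ∈ Ioo (-rightEnd (m + 1) H d) (rightEnd (m + 1) H d) := by
  have hp := rightEnd_pos hm hH hd
  have h := (strictMonoOn_height_arcsin hm hH h0 hd).lt_iff_lt
    ⟨abs_nonneg r, abs_le.2 hr⟩ (right_mem_Icc.2 hp.le)
  rw [← evenHeight_rightEnd hm hH h0 hd, mem_Ioo, ← abs_lt, ← h, evenHeight, evenHeight,
    abs_of_pos hp]

theorem evenHeight_le (hm : 2 ≤ m) (hH : ((m + 1 : ℕ) : ℝ) * H = m) (h0 : 0 ≤ d)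
    (hd : d < 1) {r : ℝ} (hr : r ∈ Icc (-rightEnd (m + 1) H d) (rightEnd (m + 1) H d)) :
    evenHeight m d r ≤ halfHeight (m + 1) H d := by
  have hp := rightEnd_pos hm hH hd
  have h := (strictMonoOn_height_arcsin hm hH h0 hd).le_iff_le
    ⟨abs_nonneg r, abs_le.2 hr⟩ (right_mem_Icc.2 hp.le)
  rw [← evenHeight_rightEnd hm hH h0 hd, evenHeight, evenHeight, abs_of_pos hp]
  exact h.2 (abs_le.2 hr)

/-- For `d = 0` the height function is even and smooth. -/
theorem contDiffOn_evenHeight_zero (hm : 2 ≤ m) (hH : ((m + 1 : ℕ) : ℝ) * H = m) :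
    ContDiffOn ℝ ∞ (evenHeight m 0)
    (Ioo (-rightEnd (m + 1) H 0) (rightEnd (m + 1) H 0)) := by
  have hP : ∀ θ, profileDist m 0 (-θ) = -profileDist m 0 θ := fun θ => by
    rw [profileDist_eq_iff hm]
    have := flux_profileDist hm 0 θ
    rw [flux] at this ⊢
    rw [Real.sin_neg, Real.cosh_neg, J_neg]; linarith
  have hw : ∀ θ, arcDensity m 0 (-θ) = arcDensity m 0 θ := fun θ => by
    rw [arcDensity, arcDensity, hP, Real.sin_neg, Real.tanh_neg, neg_mul_neg]
  have hh : ∀ θ, height m 0 (-θ) = height m 0 θ := fun θ => by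
    have h := sub_eq_sub_of_hasDerivAt (F := fun θ => height m 0 (-θ))
      (fun θ => ((hasDerivAt_height hm 0 (-θ)).comp θ (hasDerivAt_neg θ)).congr_deriv
        (by rw [hw θ, Real.sin_neg]; ring)) (hasDerivAt_height hm 0) θ 0
    simp only [neg_zero] at h
    linarith
  have hs : ∀ r, sinAngle m 0 (-r) = -sinAngle m 0 r := fun r => by
    rw [sinAngle, sinAngle, J_neg, Real.cosh_neg]; ring
  -- For `d = 0` the height is even in `θ` and `sinAngle` is odd in `r`. The absolute value can
  -- therefore be dropped, which removes the only obstacle to smoothness at `ρ = 0`.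
  have heq : ∀ r, evenHeight m 0 r =
      height m 0 (Real.arcsin (sinAngle m 0 r)) - height m 0 (Real.arcsin 0) := fun r => by
    rcases abs_choice r with h | h <;> rw [evenHeight, h]
    rw [hs, Real.arcsin_neg, hh]
  have hlt : ∀ r ∈ Ico 0 (rightEnd (m + 1) H 0), sinAngle m 0 r < 1 := fun r hr => by
    have hcp : 0 < Real.cosh r ^ m := by have := Real.cosh_pos r; positivity
    rcases eq_or_lt_of_le hr.1 with h | h
    · rw [← h, sinAngle, J_zero]; simp
    · obtain ⟨h1, -, -⟩ := hasDerivAt_height_arcsin_tan hm hH le_rfl one_pos ⟨h, hr.2⟩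
      exact Real.arcsin_lt_pi_div_two.1 h1.2
  have hnn : ∀ r, 0 ≤ r → 0 ≤ sinAngle m 0 r := fun r hr => by
    have hcp : 0 < Real.cosh r ^ m := by have := Real.cosh_pos r; positivity
    refine div_nonneg ?_ hcp.le
    have : 0 ≤ J m r := intervalIntegral.integral_nonneg hr fun t _ => by
      have := Real.cosh_pos t; positivity
    positivity
  have hss : ContDiff ℝ ∞ (sinAngle m 0) :=
    ((contDiff_const.mul (contDiff_J m)).add contDiff_const).div (Real.contDiff_cosh.pow m)
      fun r => by have := Real.cosh_pos r; positivity
  rw [show evenHeight m 0 = fun r =>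
    height m 0 (Real.arcsin (sinAngle m 0 r)) - height m 0 (Real.arcsin 0) from funext heq]
  intro r hr
  have habs : |sinAngle m 0 r| < 1 := by
    rcases le_total 0 r with h | h
    · rw [abs_of_nonneg (hnn r h)]; exact hlt r ⟨h, hr.2⟩
    · have h1 : 0 ≤ -r := by linarith
      rw [← abs_neg, ← hs, abs_of_nonneg (hnn _ h1)]; exact hlt _ ⟨h1, by linarith [hr.1]⟩
  refine ContDiffAt.contDiffWithinAt (ContDiffAt.sub ?_ contDiffAt_const)
  have h1 : ContDiffAt ℝ ∞ (fun r => Real.arcsin (sinAngle m 0 r)) r :=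
    ContDiffAt.comp (g := Real.arcsin) r
      (Real.contDiffAt_arcsin (abs_lt.1 habs).1.ne' (abs_lt.1 habs).2.ne) hss.contDiffAt
  exact ContDiffAt.comp (g := height m 0) r (contDiff_height hm 0).contDiffAt h1

end

end

end TranslationH

namespace TranslationH

noncomputable section

/-! ### The hypersurfaces with a closed generating curve -/

section

variable {m : ℕ} {d H : ℝ}

theorem periodic_genCurve (hm : 2 ≤ m) (H : ℝ) (hd : d < 1) :
    Function.Periodic (genCurve hm H d neg_one_mul_self) (2 * arcLen m d) := fun s => by
  have h := gluedCurve_add neg_one_mul_self (h := halfHeight (m + 1) H d) (γ := arc hm d)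
    (arcLen_pos hm hd) 2 s
  have h2 : motionPerm neg_one_mul_self (halfHeight (m + 1) H d) ^ (2 : ℤ) = 1 := by
    ext z
    · rw [zpow_two, Equiv.Perm.mul_apply]; simp [motionPerm_apply]
    · rw [zpow_two, Equiv.Perm.mul_apply]; simp [motionPerm_apply]
  rw [h2] at h
  exact_mod_cast h

/-- On the first arc the height is strictly increasing, as `0 ≤ d` keeps the angle in `(0, π)` in
the interior. The second arc, without its ends, lies in `ρ < 0`. -/
theorem injOn_genCurve (hm : 2 ≤ m) (hH : ((m + 1 : ℕ) : ℝ) * H = m) (h0 : 0 ≤ d) (hd : d < 1) :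
    InjOn (genCurve hm H d neg_one_mul_self) (Ico 0 (2 * arcLen m d)) := by
  have hL := arcLen_pos hm hd
  have ha := leftEnd_eq_zero hm hH (by linarith) hd
  have hγ := arc_arcLen_eq_motionPerm hm hH hd neg_one_mul_self (Or.inr (by linarith))
  have hmono : StrictMonoOn (fun s => (arc hm d s).2) (Icc 0 (arcLen m d)) := by
    refine strictMonoOn_of_deriv_pos (convex_Icc _ _)
      (contDiff_arc hm d).continuous.snd.continuousOn fun s hs => ?_
    rw [interior_Icc] at hs
    rw [(hasDerivAt_snd_apply (hasDerivAt_arc hm d s)).deriv]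
    have h1 := (arcAngle_mem_Ioo hm).2 hs
    have h2 := Real.arcsin_nonneg.2 h0
    exact Real.sin_pos_of_pos_of_lt_pi (h2.trans_lt h1.1) (by linarith [h1.2])
  have hinj : InjOn (arc hm d) (Icc 0 (arcLen m d)) := fun s hs t ht hst =>
    hmono.injOn hs ht (congrArg Prod.snd hst)
  have hfst : ∀ s ∈ Icc 0 (arcLen m d), 0 ≤ (arc hm d s).1 := fun s hs => by
    have h1 := (image_arc hm hH hd).subset (mem_image_of_mem _ hs)
    exact ha ▸ h1.1.1
  have hc1 : ∀ s ∈ Icc 0 (arcLen m d), genCurve hm H d neg_one_mul_self s = arc hm d s :=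
    fun s hs => gluedCurve_of_mem _ hL hγ hs
  have hc2 : ∀ s ∈ Icc (arcLen m d) (2 * arcLen m d), genCurve hm H d neg_one_mul_self s =
      motionPerm neg_one_mul_self (halfHeight (m + 1) H d) (arc hm d (s - arcLen m d)) :=
    fun s hs => by
      have := gluedCurve_eq neg_one_mul_self hL hγ 1 (s := s)
        ⟨by push_cast; linarith [hs.1], by push_cast; linarith [hs.2]⟩
      rw [genCurve, this]; simp
  have hneg : ∀ s ∈ Ioo (arcLen m d) (2 * arcLen m d),
      (genCurve hm H d neg_one_mul_self s).1 < 0 := fun s hs => by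
    rw [hc2 s (Ioo_subset_Icc_self hs), motionPerm_apply]
    have := leftEnd_lt_arc hm hH hd (s := s - arcLen m d) ⟨by linarith [hs.1], by linarith [hs.2]⟩
    rw [ha] at this
    simp only; linarith
  have hcross : ∀ s ∈ Icc 0 (arcLen m d), ∀ t ∈ Ioo (arcLen m d) (2 * arcLen m d),
      genCurve hm H d neg_one_mul_self s ≠ genCurve hm H d neg_one_mul_self t :=
    fun s hs t ht hst => by
      have h1 := hneg t ht
      rw [← hst, hc1 s hs] at h1
      exact absurd (hfst s hs) (not_le.2 h1)
  intro s hs t ht hst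
  rcases le_or_gt s (arcLen m d) with h1 | h1 <;> rcases le_or_gt t (arcLen m d) with h2 | h2
  · rw [hc1 s ⟨hs.1, h1⟩, hc1 t ⟨ht.1, h2⟩] at hst
    exact hinj ⟨hs.1, h1⟩ ⟨ht.1, h2⟩ hst
  · exact absurd hst (hcross s ⟨hs.1, h1⟩ t ⟨h2, ht.2⟩)
  · exact absurd hst.symm (hcross t ⟨ht.1, h2⟩ s ⟨h1, hs.2⟩)
  · rw [hc2 s ⟨h1.le, hs.2.le⟩, hc2 t ⟨h2.le, ht.2.le⟩] at hst
    have := hinj ⟨by linarith, by linarith [hs.2]⟩ ⟨by linarith, by linarith [ht.2]⟩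
      ((motionPerm neg_one_mul_self _).injective hst)
    linarith

theorem isClosed_closedCurve (hm : 2 ≤ m) (hH : ((m + 1 : ℕ) : ℝ) * H = m) (h0 : 0 ≤ d)
    (hd : d < 1) : IsClosed (closedCurve (m + 1) H d) := by
  have hg := continuous_evenHeight hm d
  rw [closedCurve_eq hm hH h0 hd]
  exact (isClosed_Icc.preimage continuous_fst).inter
    ((isClosed_eq continuous_snd (hg.comp continuous_fst)).union
      (isClosed_eq continuous_snd (continuous_const.sub (hg.comp continuous_fst))))

theorem snd_image_closedCurve (hm : 2 ≤ m) (hH : ((m + 1 : ℕ) : ℝ) * H = m) (h0 : 0 ≤ d)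
    (hd : d < 1) :
    Prod.snd '' closedCurve (m + 1) H d = Icc 0 (2 * halfHeight (m + 1) H d) := by
  apply Subset.antisymm
  · rw [closedCurve_eq hm hH h0 hd]
    rintro _ ⟨z, ⟨hz, h⟩, rfl⟩
    have h1 := evenHeight_nonneg hm hH h0 hd hz
    have h2 := evenHeight_le hm hH h0 hd hz
    rcases h with h | h <;> rw [h] <;> constructor <;> linarith
  · have h1 := intermediate_value_Icc (arcLen_pos hm hd).le
      (contDiff_arc hm d).continuous.snd.continuousOn
    rw [arc_zero hm hH hd, arc_arcLen hm hH hd] at h1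
    refine h1.trans ?_
    rintro _ ⟨s, hs, rfl⟩
    refine mem_image_of_mem _ ?_
    rw [← range_genCurve_neg_one hm hH (by linarith) hd]
    exact ⟨s, gluedCurve_of_mem _ (arcLen_pos hm hd)
      (arc_arcLen_eq_motionPerm hm hH hd neg_one_mul_self (Or.inr (by linarith))) hs⟩

/-- The cases `d = 0` and `0 < d < 1` differ only in the corners `Z` and in the regularity `k` of
the graph across `ρ = 0`; these are isolated in `hZ`, `hcorner` and `hreg`. -/
theorem isConvexClosedType_genCurve {e : EuclideanSpace ℝ (Fin (m + 1))} (he : ‖e‖ = 1)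
    (hm : 2 ≤ m) (hH : ((m + 1 : ℕ) : ℝ) * H = m) (h0 : 0 ≤ d) (hd : d < 1) {k : WithTop ℕ∞}
    (hk : k ≤ ∞) {Z : Set ℝ} (hZ : ∀ s ∉ Z, IsHPoint m (genCurve hm H d neg_one_mul_self) s)
    (hcorner : ∀ s ∈ Z, ¬ DifferentiableAt ℝ (genCurve hm H d neg_one_mul_self) s)
    (hreg : ContDiffOn ℝ k (evenHeight m d)
      (Ioo (-rightEnd (m + 1) H d) (rightEnd (m + 1) H d))) :
    IsConvexClosedType e (generatingCurve (m + 1) H d) H (halfHeight (m + 1) H d) k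
      (genCurve hm H d neg_one_mul_self) (2 * arcLen m d) (periodic_genCurve hm H hd) Z := by
  have hL : 0 < 2 * arcLen m d := by linarith [arcLen_pos hm hd]
  have hgen : generatingCurve (m + 1) H d = closedCurve (m + 1) H d := if_pos h0
  have hrange := range_genCurve_neg_one hm hH (by linarith) hd
  have hps := isPiecewiseSmooth_genCurve neg_one_mul_self hm hH hd (Or.inr (by linarith))
  have hclosed := isClosed_closedCurve hm hH h0 hd
  have hc := periodic_genCurve hm H hd
  have hemb := isEmbedding_fermiMap_comp he
    (isEmbedding_lift hL hc hps.continuous (injOn_genCurve hm hH h0 hd))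
  have hp := rightEnd_pos hm hH hd
  have hch := closedCurve_eq hm hH h0 hd
  have hr := evenHeight_rightEnd hm hH h0 hd
  rw [hgen]
  refine ⟨hL, hps.isProfileCurve hZ hcorner, hrange, injOn_genCurve hm hH h0 hd, ?_,
    fun s hs => (hZ s hs).curvature_pos (by omega), isImmersedHHypersurface_of_isHPoint he hH hZ,
    hemb, ?_, fun x t => ?_, ?_, ?_, fun x t => ?_, ?_⟩
  · rw [hch]
    exact exists_strictConvex_frontier (continuous_evenHeight hm d) hp
      (strictConvexOn_evenHeight hm hH h0 hd) ((evenHeight_neg m d _).trans hr) hr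
  · have := isInducedComplete_of_isEmbedding_lift he hL hc hps (hrange ▸ hclosed) hemb
    rwa [hrange] at this
  · rw [mem_translationHypersurface he, mem_translationHypersurface he]
    refine and_congr_right fun _ => ?_
    simp only [closedCurve, mem_ofPred_eq]
    refine and_congr_right fun _ => ⟨fun h => h.symm.imp ?_ ?_, fun h => h.symm.imp ?_ ?_⟩ <;>
      intro h <;> linarith
  · refine isVerticalGraph_of_signedDist (P := fun t => t < halfHeight (m + 1) H d) he hk
      isOpen_Ioo hreg fun z => ?_
    rw [hch]
    constructor
    · rintro ⟨⟨hz, h | h⟩, hlt⟩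
      · exact ⟨(evenHeight_lt_iff hm hH h0 hd hz).1 (h ▸ hlt), h⟩
      · exact absurd (evenHeight_le hm hH h0 hd hz) (by linarith)
    · rintro ⟨hz, h⟩
      have hz' := Ioo_subset_Icc_self hz
      exact ⟨⟨hz', Or.inl h⟩, h ▸ (evenHeight_lt_iff hm hH h0 hd hz').2 hz⟩
  · refine isVerticalGraph_of_signedDist (P := fun t => halfHeight (m + 1) H d < t) he hk
      isOpen_Ioo ((contDiffOn_const (c := 2 * halfHeight (m + 1) H d)).sub hreg) fun z => ?_
    rw [hch]
    constructor
    · rintro ⟨⟨hz, h | h⟩, hlt⟩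
      · exact absurd (evenHeight_le hm hH h0 hd hz) (by linarith)
      · exact ⟨(evenHeight_lt_iff hm hH h0 hd hz).1 (by linarith), h⟩
    · rintro ⟨hz, h⟩
      have hz' := Ioo_subset_Icc_self hz
      exact ⟨⟨hz', Or.inr h⟩, by linarith [(evenHeight_lt_iff hm hH h0 hd hz').2 hz]⟩
  · obtain ⟨h1, h2⟩ := signedDist_reflection he x
    rw [mem_translationHypersurface he, mem_translationHypersurface he]
    simp only [h1, h2, closedCurve, mem_ofPred_eq, abs_neg]
  · have hb : ∀ z ∈ closedCurve (m + 1) H d, |z.1| ≤ rightEnd (m + 1) H d := fun z hz => hz.1.2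
    rw [asymptoticBoundary_eq he hclosed hb, snd_image_closedCurve hm hH h0 hd]
    have hh := halfHeight_pos (d := d) hm hH hd
    exact ⟨(cylinderHomeomorph he _).trans ((Homeomorph.refl _).prodCongr
      (iccHomeoI 0 (2 * halfHeight (m + 1) H d) (by linarith)))⟩

end

end

end TranslationH

namespace TranslationH

noncomputable section

/-! ### The hypersurfaces with a periodic generating curve -/

section

variable {m : ℕ} {d H : ℝ}

theorem genCurve_one_of_mem (hm : 2 ≤ m) (hH : ((m + 1 : ℕ) : ℝ) * H = m) (hd : d < 1) {s : ℝ}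
    (hs : s ∈ Icc 0 (arcLen m d)) : genCurve hm H d (one_mul 1) s = arc hm d s :=
  gluedCurve_of_mem _ (arcLen_pos hm hd) (arc_arcLen_eq_motionPerm hm hH hd _ (Or.inl rfl)) hs

/-- The preceding arc is the translate by `-2 h`, and the arc is invariant under `t ↦ 2 h - t`;
together they give the reflection `t ↦ -t`. -/
theorem genCurve_one_neg (hm : 2 ≤ m) (hH : ((m + 1 : ℕ) : ℝ) * H = m) (hd : d < 1) {s : ℝ}
    (hs : s ∈ Icc 0 (arcLen m d)) :
    genCurve hm H d (one_mul 1) (-s) = ((arc hm d s).1, -(arc hm d s).2) := by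
  have h := gluedCurve_eq (one_mul 1) (arcLen_pos hm hd)
    (arc_arcLen_eq_motionPerm hm hH hd _ (Or.inl rfl)) (-1) (s := -s)
    ⟨by push_cast; linarith [hs.2], by push_cast; linarith [hs.1]⟩
  rw [genCurve, h, motionPerm_one_zpow,
    show -s - ((-1 : ℤ) : ℝ) * arcLen m d = arcLen m d - s by push_cast; ring,
    arc_arcLen_sub hm hH hd]
  exact Prod.ext rfl (by push_cast; ring)

theorem genCurve_one_add (hm : 2 ≤ m) (H : ℝ) (hd : d < 1) (k : ℤ) (s : ℝ) :
    genCurve hm H d (one_mul 1) (s + k * arcLen m d) =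
      ((genCurve hm H d (one_mul 1) s).1,
        (genCurve hm H d (one_mul 1) s).2 + 2 * k * halfHeight (m + 1) H d) := by
  rw [genCurve, gluedCurve_add _ (arcLen_pos hm hd), motionPerm_one_zpow]

/-- The part of the arc on which the height decreases. -/
theorem exists_strictAntiOn_arc (hm : 2 ≤ m) (hd : d < 0) : ∃ δ > 0, δ < arcLen m d / 2 ∧
    arcAngle hm d δ = 0 ∧ StrictAntiOn (fun s => (arc hm d s).2) (Icc 0 δ) := by
  have hα := Real.arcsin_lt_zero.2 hd
  have h1 := arcLength_strictMono hm d hα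
  have h2 := arcLength_strictMono hm d (show 0 < Real.pi / 2 by linarith [Real.pi_pos])
  refine ⟨arcLength m d 0 - arcLength m d (Real.arcsin d), by linarith, by rw [arcLen]; linarith,
    arcAngle_sub hm d 0, ?_⟩
  refine strictAntiOn_of_deriv_neg (convex_Icc _ _)
    (contDiff_arc hm d).continuous.snd.continuousOn fun s hs => ?_
  rw [interior_Icc] at hs
  rw [(hasDerivAt_snd_apply (hasDerivAt_arc hm d s)).deriv]
  have h3 := arcAngle_strictMono hm d hs.1
  have h4 := arcAngle_strictMono hm d hs.2
  rw [arcAngle_zero] at h3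
  rw [arcAngle_sub] at h4
  exact Real.sin_neg_of_neg_of_neg_pi_lt h4
    (by linarith [Real.neg_pi_div_two_le_arcsin d, Real.pi_pos])

/-- At a corner no derivative is available, but the height decreases strictly through the joint: the
arc starts with negative angle, and the reflection `t ↦ -t` carries this to the other side. -/
theorem exists_injOn_genCurve_one (hm : 2 ≤ m) (hH : ((m + 1 : ℕ) : ℝ) * H = m) (hd : d < 0)
    (k : ℤ) : ∃ U ∈ 𝓝 (k * arcLen m d), InjOn (genCurve hm H d (one_mul 1)) U := by
  have hd1 : d < 1 := by linarith
  obtain ⟨δ, hδ, hδL, -, hanti⟩ := exists_strictAntiOn_arc hm hd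
  set c := genCurve hm H d (one_mul 1) with hc
  have h1 : StrictAntiOn (fun s => (c s).2) (Icc 0 δ) := hanti.congr fun s hs => by
    simp only [hc]; rw [genCurve_one_of_mem hm hH hd1 ⟨hs.1, by linarith [hs.2]⟩]
  have h2 : StrictAntiOn (fun s => (c s).2) (Icc (-δ) 0) := by
    have hneg : ∀ s ∈ Icc (-δ) 0, (c s).2 = -(arc hm d (-s)).2 := fun s hs => by
      have := genCurve_one_neg hm hH hd1 (s := -s) ⟨by linarith [hs.2], by linarith [hs.1]⟩
      rw [neg_neg] at this
      rw [hc, this]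
    intro s hs t ht hst
    simp only [hneg s hs, hneg t ht]
    exact neg_lt_neg (hanti (a := -t) (b := -s) ⟨by linarith [ht.2], by linarith [ht.1]⟩
      ⟨by linarith [hs.2], by linarith [hs.1]⟩ (by linarith))
  have h3 := h2.union h1 (isGreatest_Icc (by linarith)) (isLeast_Icc hδ.le)
  rw [Icc_union_Icc_eq_Icc (by linarith) hδ.le] at h3
  refine ⟨Icc (k * arcLen m d - δ) (k * arcLen m d + δ),
    Icc_mem_nhds (by linarith) (by linarith), fun s hs t ht hst => ?_⟩
  have hsh : ∀ s, (c s).2 = (c (s - k * arcLen m d)).2 + 2 * k * halfHeight (m + 1) H d :=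
    fun s => by
      have := genCurve_one_add hm H hd1 k (s - k * arcLen m d)
      rw [sub_add_cancel] at this
      exact congrArg Prod.snd this
  have h4 := congrArg Prod.snd hst
  rw [hsh s, hsh t] at h4
  have h5 := h3.injOn (x₁ := s - k * arcLen m d) (x₂ := t - k * arcLen m d)
    ⟨by linarith [hs.1], by linarith [hs.2]⟩ ⟨by linarith [ht.1], by linarith [ht.2]⟩
    (add_right_cancel h4)
  linarith

/-- The height is negative at `θ = 0` and equals `h > 0` at `θ = π / 2`, so it vanishes in between.
-/
theorem exists_mem_arc_crossing (hm : 2 ≤ m) (hH : ((m + 1 : ℕ) : ℝ) * H = m) (hd : d < 0) :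
    ∃ s ∈ Ioo 0 (arcLen m d), (arc hm d s).2 = 0 ∧ arcAngle hm d s ∈ Ioo 0 (Real.pi / 2) := by
  have hd1 : d < 1 := by linarith
  obtain ⟨δ, hδ, hδL, hδ0, hanti⟩ := exists_strictAntiOn_arc hm hd
  have h1 : (arc hm d δ).2 < 0 := by
    have := hanti ⟨le_rfl, hδ.le⟩ ⟨hδ.le, le_rfl⟩ hδ
    simpa [arc_zero hm hH hd1] using this
  have h2 : 0 < (arc hm d (arcLen m d / 2)).2 := by
    have h := arc_arcLen_sub hm hH hd1 (arcLen m d / 2)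
    rw [sub_half] at h
    have h3 := congrArg Prod.snd h
    simp only at h3
    linarith [halfHeight_pos (d := d) hm hH hd1]
  obtain ⟨s, hs, hs0⟩ := intermediate_value_Ioo hδL.le
    (contDiff_arc hm d).continuous.snd.continuousOn ⟨h1, h2⟩
  refine ⟨s, ⟨hδ.trans hs.1, by linarith [hs.2]⟩, hs0, ?_⟩
  have h3 := arcAngle_strictMono hm d hs.1
  have h4 := arcAngle_strictMono hm d hs.2
  have h5 : arcAngle hm d (arcLen m d / 2) = Real.pi / 2 := by
    rw [arcAngle_eq_iff hm, arcLen]; ring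
  exact ⟨hδ0 ▸ h3, h5 ▸ h4⟩

theorem periodicCurve_eq (hm : 2 ≤ m) (hH : ((m + 1 : ℕ) : ℝ) * H = m) (hd : d < 1) :
    periodicCurve (m + 1) H d = {z | z.1 ∈ Icc (leftEnd (m + 1) H d) (rightEnd (m + 1) H d) ∧
      ∃ k : ℤ, z.2 = 2 * k * halfHeight (m + 1) H d + evenHeight m d z.1 ∨
        z.2 = 2 * k * halfHeight (m + 1) H d - evenHeight m d z.1} := by
  ext z
  refine and_congr_right fun hz => ?_
  have h := (isGeneratingSolution (d := d) hm hH hd).left_nonneg.trans hz.1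
  rw [← mu_abs_eq hm hH hd ((abs_of_nonneg h).symm ▸ hz), abs_of_nonneg h]

/-- Existence of `k` says that one of two continuous functions takes an integer value, and the
integers are closed in `ℝ`. -/
theorem isClosed_periodicCurve (hm : 2 ≤ m) (hH : ((m + 1 : ℕ) : ℝ) * H = m) (hd : d < 1) :
    IsClosed (periodicCurve (m + 1) H d) := by
  have hg := continuous_evenHeight hm d
  have hh := halfHeight_pos (d := d) hm hH hd
  have hcl : IsClosed (range ((↑) : ℤ → ℝ)) := Int.isClosedEmbedding_coe_real.isClosed_range
  have h1 : Continuous fun z : ℝ × ℝ =>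
      (z.2 - evenHeight m d z.1) / (2 * halfHeight (m + 1) H d) :=
    (continuous_snd.sub (hg.comp continuous_fst)).div_const _
  have h2 : Continuous fun z : ℝ × ℝ =>
      (z.2 + evenHeight m d z.1) / (2 * halfHeight (m + 1) H d) :=
    (continuous_snd.add (hg.comp continuous_fst)).div_const _
  have h3 := (isClosed_Icc.preimage continuous_fst).inter
    ((hcl.preimage h1).union (hcl.preimage h2))
    (s₁ := Prod.fst ⁻¹' Icc (leftEnd (m + 1) H d) (rightEnd (m + 1) H d))
  rw [periodicCurve_eq hm hH hd]
  convert h3 using 1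
  ext z
  refine and_congr_right fun _ => ?_
  rw [exists_or]
  refine or_congr (exists_congr fun k => ?_) (exists_congr fun k => ?_) <;>
    rw [eq_div_iff (by positivity)] <;> constructor <;> intro h <;> linarith

theorem snd_image_periodicCurve (hm : 2 ≤ m) (hH : ((m + 1 : ℕ) : ℝ) * H = m) (hd : d < 1) :
    Prod.snd '' periodicCurve (m + 1) H d = univ := by
  refine eq_univ_of_forall fun t => ?_
  have hh := halfHeight_pos (d := d) hm hH hd
  have h1 := intermediate_value_Icc (arcLen_pos hm hd).le
    (contDiff_arc hm d).continuous.snd.continuousOn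
  rw [arc_zero hm hH hd, arc_arcLen hm hH hd] at h1
  set k := ⌊t / (2 * halfHeight (m + 1) H d)⌋ with hk
  have hfl := (le_div_iff₀ (show 0 < 2 * halfHeight (m + 1) H d by linarith)).1
    (Int.floor_le (t / (2 * halfHeight (m + 1) H d)))
  have hfl' := (div_lt_iff₀ (show 0 < 2 * halfHeight (m + 1) H d by linarith)).1
    (Int.lt_floor_add_one (t / (2 * halfHeight (m + 1) H d)))
  rw [← hk] at hfl hfl'
  obtain ⟨s, hs, hst⟩ := h1 (show t - 2 * k * halfHeight (m + 1) H d ∈ _ from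
    ⟨by simp only; linarith, by simp only; linarith⟩)
  rw [← range_genCurve_one hm hH hd]
  refine ⟨_, ⟨s + k * arcLen m d, rfl⟩, ?_⟩
  rw [genCurve_one_add hm H hd, genCurve_one_of_mem hm hH hd hs]
  simp only at hst ⊢
  linarith

theorem isPeriodicType_genCurve {e : EuclideanSpace ℝ (Fin (m + 1))} (he : ‖e‖ = 1)
    (hm : 2 ≤ m) (hH : ((m + 1 : ℕ) : ℝ) * H = m) (hd : d < 0) {Z : Set ℝ}
    (hZ : ∀ s ∉ Z, IsHPoint m (genCurve hm H d (one_mul 1)) s)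
    (hcorner : ∀ s ∈ Z, ¬ DifferentiableAt ℝ (genCurve hm H d (one_mul 1)) s)
    (hZ0 : ∀ s ∈ Z, (genCurve hm H d (one_mul 1) s).1 = 0 ∧ ∃ k : ℤ, s = k * arcLen m d) :
    IsPeriodicType e (generatingCurve (m + 1) H d) H (halfHeight (m + 1) H d)
      (genCurve hm H d (one_mul 1)) Z := by
  have hd1 : d < 1 := by linarith
  have hL := arcLen_pos hm hd1
  have hgen : generatingCurve (m + 1) H d = periodicCurve (m + 1) H d := if_neg (not_le.2 hd)
  have hrange := range_genCurve_one hm hH hd1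
  have hps := isPiecewiseSmooth_genCurve (one_mul 1) hm hH hd1 (Or.inl rfl)
  have hclosed := isClosed_periodicCurve hm hH hd1
  have hper : ∀ s, genCurve hm H d (one_mul 1) (s + arcLen m d) =
      genCurve hm H d (one_mul 1) s + (0, 2 * halfHeight (m + 1) H d) := fun s => by
    have := genCurve_one_add hm H hd1 1 s
    rw [Int.cast_one, one_mul] at this
    rw [this]
    exact Prod.ext (by simp) (by simp)
  have hinj : ∀ s, ∃ U ∈ 𝓝 s, InjOn (genCurve hm H d (one_mul 1)) U := fun s => by
    by_cases hs : s ∈ Z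
    · obtain ⟨-, k, rfl⟩ := hZ0 s hs
      exact exists_injOn_genCurve_one hm hH hd k
    · exact exists_injOn_of_isHPoint (hZ s hs)
  obtain ⟨δ₀, hδ₀, hsep⟩ := exists_separation hps.continuous hL hper hinj
  rw [hgen]
  refine ⟨hps.isProfileCurve hZ hcorner, hrange, ⟨_, hL, hper⟩,
    isImmersedHHypersurface_of_isHPoint he hH hZ,
    fun q hq => locally_injective_translationMap he hinj hq.1,
    isInducedComplete_paramDomain he hps hδ₀ hsep, ?_, fun k x t => ?_, ?_⟩
  -- The crossing of the arc with `t = 0` is its own mirror image, hence is reached at `-s` too,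
  -- with velocity `(-cos θ, sin θ)`. The determinant of the two velocities is `2 sin θ cos θ ≠ 0`.
  · obtain ⟨s, hs, hs0, hθ⟩ := exists_mem_arc_crossing hm hH hd
    have hsI := Ioo_subset_Icc_self hs
    have hpos : 0 < (arc hm d s).1 :=
      (isGeneratingSolution (d := d) hm hH hd1).left_nonneg.trans_lt (leftEnd_lt_arc hm hH hd1 hs)
    have e1 := genCurve_one_of_mem hm hH hd1 hsI
    have e2 := genCurve_one_neg hm hH hd1 hsI
    have d1 : HasDerivAt (genCurve hm H d (one_mul 1))
        (Real.cos (arcAngle hm d s), Real.sin (arcAngle hm d s)) s := by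
      refine (hasDerivAt_arc hm d s).congr_of_eventuallyEq ?_
      filter_upwards [Icc_mem_nhds hs.1 hs.2] with x hx
      exact genCurve_one_of_mem hm hH hd1 hx
    have d2 : HasDerivAt (genCurve hm H d (one_mul 1))
        (-Real.cos (arcAngle hm d s), Real.sin (arcAngle hm d s)) (-s) := by
      have h1 : HasDerivAt (fun x => arc hm d (-x))
          (-Real.cos (arcAngle hm d s), -Real.sin (arcAngle hm d s)) (-s) := by
        have h2 : HasDerivAt (arc hm d)
          (Real.cos (arcAngle hm d s), Real.sin (arcAngle hm d s)) (- -s) := by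
          rw [neg_neg]; exact hasDerivAt_arc hm d s
        exact (h2.scomp (-s) (hasDerivAt_neg (-s))).congr_deriv (by simp)
      have h2 := (hasDerivAt_fst_apply h1).prodMk (hasDerivAt_snd_apply h1).neg
      rw [neg_neg] at h2
      refine h2.congr_of_eventuallyEq ?_
      filter_upwards [Icc_mem_nhds (show -arcLen m d < -s by linarith [hs.2])
        (show -s < 0 by linarith [hs.1])] with x hx
      have := genCurve_one_neg hm hH hd1 (s := -x) ⟨by linarith [hx.2], by linarith [hx.1]⟩
      rwa [neg_neg] at this
    have hnZ : ∀ x, genCurve hm H d (one_mul 1) x = arc hm d s → x ∉ Z := fun x hx hxZ =>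
      hpos.ne' (hx ▸ (hZ0 x hxZ).1)
    have e3 : genCurve hm H d (one_mul 1) (-s) = arc hm d s :=
      e2.trans (Prod.ext rfl (by simp only; rw [hs0, neg_zero]))
    refine ⟨(0, s), ⟨by simp, hnZ s e1⟩, (0, -s), ⟨by simp, hnZ _ e3⟩, ?_, ?_⟩
    · simp only [translationMap, e1, e3]
    · refine range_fderiv_translationMap_ne he (by simp) d1.differentiableAt d2.differentiableAt
        (e1.trans e3.symm) ?_
      rw [d1.deriv, d2.deriv]
      have h1 := Real.sin_pos_of_pos_of_lt_pi hθ.1 (by linarith [hθ.2, Real.pi_pos])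
      have h2 := Real.cos_pos_of_mem_Ioo ⟨by linarith [hθ.1, Real.pi_pos], hθ.2⟩
      have := mul_pos h1 h2
      simp only
      nlinarith
  · rw [mem_translationHypersurface he, mem_translationHypersurface he]
    refine and_congr_right fun _ => and_congr_right fun _ => ?_
    constructor <;> rintro ⟨j, h | h⟩
    · exact ⟨k - j, Or.inr (by push_cast; simp only at h ⊢; rw [h]; ring)⟩
    · exact ⟨k - j, Or.inl (by push_cast; simp only at h ⊢; rw [h]; ring)⟩
    · exact ⟨k - j, Or.inr (by push_cast; simp only at h ⊢; linarith)⟩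
    · exact ⟨k - j, Or.inl (by push_cast; simp only at h ⊢; linarith)⟩
  · have hb : ∀ z ∈ periodicCurve (m + 1) H d, |z.1| ≤ rightEnd (m + 1) H d := fun z hz => by
      rw [abs_of_nonneg ((isGeneratingSolution (d := d) hm hH hd1).left_nonneg.trans hz.1.1)]
      exact hz.1.2
    rw [asymptoticBoundary_eq he hclosed hb, snd_image_periodicCurve hm hH hd1]
    exact ⟨(cylinderHomeomorph he _).trans ((Homeomorph.refl _).prodCongr
      (Homeomorph.Set.univ ℝ))⟩

end

end

end TranslationH

namespace TranslationH

noncomputable section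

/-! ### Singular points -/

/-- Divide by `|s|` and pass to the limit. As `x s` may vanish for `s ≠ 0`, the quotient of `G` is
expressed by the continuous function `dslope G 0`. -/
theorem abs_deriv_eq_of_abs_eq {G x y : ℝ → ℝ} {K u v y₀ : ℝ} (hG : HasDerivAt G K 0)
    (hG0 : G 0 = 0) (hx : HasDerivAt x u 0) (hx0 : x 0 = 0) (hy : HasDerivAt y v 0)
    (hy0 : y 0 = y₀) (h : ∀ᶠ s in 𝓝 0, |y s - y₀| = |G (|x s|)|) : |v| = |u| * |K| := by
  have h1 := (hasDerivAt_iff_tendsto_slope.1 hx).abs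
  have h2 := (hasDerivAt_iff_tendsto_slope.1 hy).abs
  have h3 : Tendsto (fun s => |dslope G 0 (|x s|)|) (𝓝[≠] 0) (𝓝 |K|) := by
    have hc : ContinuousAt (dslope G 0) 0 := continuousAt_dslope_same.2 hG.differentiableAt
    have hx' : Tendsto (fun s => |x s|) (𝓝 0) (𝓝 0) := by
      have := hx.continuousAt.tendsto.abs
      rwa [hx0, abs_zero] at this
    have h4 := (hc.tendsto.comp hx').abs
    rw [dslope_same, hG.deriv] at h4
    exact h4.mono_left nhdsWithin_le_nhds
  refine tendsto_nhds_unique h2 ((h1.mul h3).congr' ?_)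
  filter_upwards [h.filter_mono nhdsWithin_le_nhds] with s hs
  have h5 := sub_smul_dslope G 0 (|x s|)
  rw [sub_zero, hG0, sub_zero, smul_eq_mul] at h5
  rw [slope_def_field, slope_def_field, hx0, hy0, sub_zero, sub_zero, abs_div, abs_div, hs, ← h5,
    abs_mul, abs_abs]
  ring

section

variable {m : ℕ} {d H : ℝ}

/-- The one-sided slope of the profile at the corner is `d / √(1 - d²)`. It exists because `arcsin`
is differentiable at `|d| < 1`, and it is nonzero because `d ≠ 0`. -/
theorem exists_hasDerivAt_height_zero (hm : 2 ≤ m) (h0 : -1 < d) (hd : d < 1) (hne : d ≠ 0) :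
    ∃ K ≠ 0, HasDerivAt
      (fun r => height m d (Real.arcsin (sinAngle m d r)) - height m d (Real.arcsin d)) K 0 := by
  have h1 : HasDerivAt (sinAngle m d) m 0 := by
    have h := (((hasDerivAt_J m 0).const_mul (m : ℝ)).add_const d).div
      ((Real.hasDerivAt_cosh 0).pow m) (by simp)
    exact h.congr_deriv (by simp)
  have h2 : sinAngle m d 0 = d := by simp [sinAngle, J_zero]
  have h3 : HasDerivAt (fun r => Real.arcsin (sinAngle m d r)) (1 / √(1 - d ^ 2) * m) 0 :=
    HasDerivAt.comp (h₂ := Real.arcsin) 0 (by rw [h2]; exact Real.hasDerivAt_arcsin h0.ne' hd.ne) h1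
  have h4 : HasDerivAt (fun r => height m d (Real.arcsin (sinAngle m d r))) _ 0 :=
    HasDerivAt.comp (h₂ := height m d) 0 (hasDerivAt_height hm d _) h3
  refine ⟨_, ?_, h4.sub_const _⟩
  rw [h2, Real.sin_arcsin h0.le hd.le]
  have h5 : 0 < √(1 - d ^ 2) := Real.sqrt_pos.2 (by nlinarith)
  have h6 : (m : ℝ) ≠ 0 := Nat.cast_ne_zero.2 (by omega)
  exact mul_ne_zero (mul_ne_zero hne (arcDensity_pos hm d _).ne')
    (mul_ne_zero (one_div_pos.2 h5).ne' h6)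

/-- Near a corner `|t - t₀| = |G |ρ||` with `G' 0 = K ≠ 0`, so velocities satisfy `|t'| = |K| |ρ'|`.
As soon as one component vanishes, both do. -/
theorem isSingularAlong_genCurve {e : EuclideanSpace ℝ (Fin (m + 1))} (he : ‖e‖ = 1)
    (hm : 2 ≤ m) (hH : ((m + 1 : ℕ) : ℝ) * H = m) (h0 : -1 < d) (hd : d < 1) (hne : d ≠ 0)
    {ε : ℝ} (hε : ε * ε = 1)
    (hC : ∀ z ∈ range (genCurve hm H d hε), z.1 = 0 → ∀ (ζ : ℝ → ℝ × ℝ) (ζ' : ℝ × ℝ),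
      HasDerivAt ζ ζ' 0 → ζ 0 = z → (∀ᶠ s in 𝓝 0, ζ s ∈ range (genCurve hm H d hε)) →
      (∀ᶠ s in 𝓝 0, |(ζ s).2 - z.2| = |evenHeight m d (ζ s).1|) ∧ (ζ'.1 = 0 ∨ ζ'.2 = 0)) :
    IsSingularAlong e (translationHypersurface e (range (genCurve hm H d hε))) := by
  refine isSingularAlong_of_corners he (by omega) (fun s hs => ?_)
    ⟨0, (genCurve_fst_eq_zero_iff hε hm hH h0.le hd).2 ⟨0, by simp⟩⟩
    fun z hz hz1 ζ ζ' hζ hζ0 hev => ?_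
  · have h := isHPoint_genCurve hε hm hH h0.le hd hs
    exact ⟨h.1, h.deriv_ne_zero⟩
  · obtain ⟨h1, h2⟩ := hC z hz hz1 ζ ζ' hζ hζ0 hev
    obtain ⟨K, hK, hG⟩ := exists_hasDerivAt_height_zero hm h0 hd hne
    have hG0 := evenHeight_zero m d
    rw [evenHeight, abs_zero] at hG0
    have h3 := abs_deriv_eq_of_abs_eq hG hG0 (hasDerivAt_fst_apply hζ) (by rw [hζ0, hz1])
      (hasDerivAt_snd_apply hζ) (congrArg Prod.snd hζ0) h1
    rcases h2 with h2 | h2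
    · rw [h2, abs_zero, zero_mul, abs_eq_zero] at h3
      exact Prod.ext h2 h3
    · rw [h2, abs_zero, eq_comm, mul_eq_zero, abs_eq_zero, abs_eq_zero, or_iff_left hK] at h3
      exact Prod.ext h3 h2

theorem isSingularAlong_closedCurve {e : EuclideanSpace ℝ (Fin (m + 1))} (he : ‖e‖ = 1)
    (hm : 2 ≤ m) (hH : ((m + 1 : ℕ) : ℝ) * H = m) (h0 : 0 < d) (hd : d < 1) :
    IsSingularAlong e (translationHypersurface e (generatingCurve (m + 1) H d)) := by
  have hrange := range_genCurve_neg_one hm hH (show -1 ≤ d by linarith) hd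
  have hh := halfHeight_pos (d := d) hm hH hd
  rw [generatingCurve, if_pos h0.le, ← hrange]
  refine isSingularAlong_genCurve he hm hH (by linarith) hd h0.ne' neg_one_mul_self ?_
  rw [hrange, closedCurve_eq hm hH h0.le hd]
  rintro z ⟨hz, hz2⟩ hz1 ζ ζ' hζ hζ0 hev
  have hcont : ContinuousAt (fun s => (ζ s).2) 0 := (hasDerivAt_snd_apply hζ).continuousAt
  rw [hz1, evenHeight_zero] at hz2
  -- The corner at `t = 0` is a minimum of the height, the one at `t = 2 h` a maximum, hence `t' =
  -- 0`. Comparison with `h` decides which of the two graphs the nearby points lie on.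
  rcases hz2 with hz2 | hz2
  · have hlt : ∀ᶠ s in 𝓝 0, (ζ s).2 < halfHeight (m + 1) H d :=
      hcont.eventually_lt continuousAt_const (by rw [hζ0, hz2]; exact hh)
    have key : ∀ᶠ s in 𝓝 0, (ζ s).2 = evenHeight m d (ζ s).1 ∧ 0 ≤ evenHeight m d (ζ s).1 := by
      filter_upwards [hev, hlt] with s hs hs2
      refine ⟨hs.2.resolve_right fun h => ?_, evenHeight_nonneg hm hH h0.le hd hs.1⟩
      linarith [evenHeight_le hm hH h0.le hd hs.1]
    refine ⟨key.mono fun s hs => by rw [hz2, sub_zero, hs.1], Or.inr ?_⟩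
    refine IsLocalMin.hasDerivAt_eq_zero (f := fun s => (ζ s).2) ?_ (hasDerivAt_snd_apply hζ)
    filter_upwards [key] with s hs
    rw [hζ0, hz2, hs.1]; exact hs.2
  · have hlt : ∀ᶠ s in 𝓝 0, halfHeight (m + 1) H d < (ζ s).2 :=
      continuousAt_const.eventually_lt hcont (by rw [hζ0, hz2]; linarith)
    have key : ∀ᶠ s in 𝓝 0, (ζ s).2 = 2 * halfHeight (m + 1) H d - evenHeight m d (ζ s).1 ∧
        0 ≤ evenHeight m d (ζ s).1 := by
      filter_upwards [hev, hlt] with s hs hs2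
      refine ⟨hs.2.resolve_left fun h => ?_, evenHeight_nonneg hm hH h0.le hd hs.1⟩
      linarith [evenHeight_le hm hH h0.le hd hs.1]
    refine ⟨key.mono fun s hs => ?_, Or.inr ?_⟩
    · rw [hz2, hs.1, ← abs_neg]; congr 1; ring
    · refine IsLocalMax.hasDerivAt_eq_zero (f := fun s => (ζ s).2) ?_ (hasDerivAt_snd_apply hζ)
      filter_upwards [key] with s hs
      rw [hζ0, hz2, hs.1]; linarith [hs.2]

theorem isSingularAlong_periodicCurve {e : EuclideanSpace ℝ (Fin (m + 1))} (he : ‖e‖ = 1)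
    (hm : 2 ≤ m) (hH : ((m + 1 : ℕ) : ℝ) * H = m) (h0 : -1 < d) (hd : d < 0) :
    IsSingularAlong e (translationHypersurface e (generatingCurve (m + 1) H d)) := by
  have hd1 : d < 1 := by linarith
  have hrange := range_genCurve_one hm hH hd1
  have hh := halfHeight_pos (d := d) hm hH hd1
  have ha := leftEnd_eq_zero hm hH h0.le hd1
  rw [generatingCurve, if_neg (not_le.2 hd), ← hrange]
  refine isSingularAlong_genCurve he hm hH h0 hd1 hd.ne (one_mul 1) ?_
  rw [hrange, periodicCurve_eq hm hH hd1]
  rintro z ⟨hz, k, hz2⟩ hz1 ζ ζ' hζ hζ0 hev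
  have hcont : ContinuousAt (fun s => (ζ s).2) 0 := (hasDerivAt_snd_apply hζ).continuousAt
  have hcont1 : ContinuousAt (fun s => (ζ s).1) 0 := (hasDerivAt_fst_apply hζ).continuousAt
  rw [hz1, evenHeight_zero, add_zero, sub_zero, or_self] at hz2
  constructor
  · have hlt : ∀ᶠ s in 𝓝 0, |(ζ s).2 - z.2| < halfHeight (m + 1) H d :=
      (hcont.sub continuousAt_const).abs.eventually_lt continuousAt_const
        (by simp only [Pi.sub_apply]; rw [hζ0, sub_self, abs_zero]; exact hh)
    have hlt2 : ∀ᶠ s in 𝓝 0, |evenHeight m d (ζ s).1| < halfHeight (m + 1) H d :=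
      (ContinuousAt.comp (g := evenHeight m d) (continuous_evenHeight hm d).continuousAt
        hcont1).abs.eventually_lt continuousAt_const
        (by simp only [Function.comp]; rw [hζ0, hz1, evenHeight_zero, abs_zero]; exact hh)
    filter_upwards [hev, hlt, hlt2] with s hs h1 h2
    obtain ⟨-, j, hj⟩ := hs
    rw [hz2] at h1 ⊢
    rw [abs_lt] at h1 h2
    -- Branches with different indices are based at heights at least `2 h` apart, while `t - z.2`
    -- and `evenHeight` are both smaller than `h` in absolute value.
    have hjk : j = k := by
      have h3 : 2 * halfHeight (m + 1) H d * ((j : ℝ) - k) < 2 * halfHeight (m + 1) H d * 1 := by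
        rcases hj with hj | hj <;> rw [hj] at h1 <;> linarith [h1.1, h1.2, h2.1, h2.2]
      have h4 : 2 * halfHeight (m + 1) H d * ((k : ℝ) - j) < 2 * halfHeight (m + 1) H d * 1 := by
        rcases hj with hj | hj <;> rw [hj] at h1 <;> linarith [h1.1, h1.2, h2.1, h2.2]
      have h5 := lt_of_mul_lt_mul_left h3 (by linarith)
      have h6 := lt_of_mul_lt_mul_left h4 (by linarith)
      have h7 : j - k < 1 := by exact_mod_cast h5
      have h8 : k - j < 1 := by exact_mod_cast h6
      omega
    rcases hj with hj | hj
    · rw [hj, hjk, add_sub_cancel_left]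
    · rw [hj, hjk, ← abs_neg]; congr 1; ring
  -- The periodic curve stays in `ρ ≥ 0`, so `ρ` has a local minimum at the corner.
  · refine Or.inl (IsLocalMin.hasDerivAt_eq_zero (f := fun s => (ζ s).1) ?_
      (hasDerivAt_fst_apply hζ))
    filter_upwards [hev] with s hs
    rw [hζ0, hz1]; exact ha ▸ hs.1.1

end

end

end TranslationH
-- The classification, case by case in `d`.
theorem mainTheorem7 (n : ℕ) (hn : 3 ≤ n) (e : EuclideanSpace ℝ (Fin n)) (he : ‖e‖ = 1)
    (H : ℝ) (hH : H = ((n : ℝ) - 1) / n) :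
    (∀ d < 1, IsGeneratingSolution n H d) ∧
    -- the case `d = 0`
    (∃ (c : ℝ → ℝ × ℝ) (L : ℝ) (hc : Function.Periodic c L),
      IsConvexClosedType e (generatingCurve n H 0) H (halfHeight n H 0) ∞ c L hc ∅) ∧
    -- the case `0 < d < 1`
    (∀ d : ℝ, 0 < d → d < 1 →
      (∃ (c : ℝ → ℝ × ℝ) (L : ℝ) (hc : Function.Periodic c L),
        IsConvexClosedType e (generatingCurve n H d) H (halfHeight n H d) 0 c L hc
          {s | (c s).1 = 0}) ∧
      IsSingularAlong e (translationHypersurface e (generatingCurve n H d))) ∧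
    -- the case `d ≤ -1`
    (∀ d : ℝ, d ≤ -1 → ∃ c : ℝ → ℝ × ℝ,
      IsPeriodicType e (generatingCurve n H d) H (halfHeight n H d) c ∅) ∧
    -- the case `-1 < d < 0`
    (∀ d : ℝ, -1 < d → d < 0 →
      (∃ c : ℝ → ℝ × ℝ,
        IsPeriodicType e (generatingCurve n H d) H (halfHeight n H d) c {s | (c s).1 = 0}) ∧
      IsSingularAlong e (translationHypersurface e (generatingCurve n H d))) := by
  obtain ⟨m, rfl⟩ : ∃ m, n = m + 1 := ⟨n - 1, by omega⟩
  have hm : 2 ≤ m := by omega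
  have hH' : ((m + 1 : ℕ) : ℝ) * H = m := by
    have : ((m + 1 : ℕ) : ℝ) ≠ 0 := by positivity
    rw [hH, mul_div_cancel₀ _ this]; push_cast; ring
  refine ⟨fun d hd => isGeneratingSolution hm hH' hd, ?_, fun d h0 hd => ⟨?_, ?_⟩,
    fun d hd => ⟨genCurve hm H d (one_mul 1), ?_⟩,
    fun d h0 hd => ⟨⟨genCurve hm H d (one_mul 1), ?_⟩, ?_⟩⟩
  · refine ⟨_, _, _, isConvexClosedType_genCurve he hm hH' le_rfl one_pos le_rfl (Z := ∅)
      (fun s _ => ?_) (fun s hs => absurd hs (Set.notMem_empty s))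
      (contDiffOn_evenHeight_zero hm hH')⟩
    rw [genCurve_zero hm hH']
    exact isHPoint_arc hm 0 s
  · refine ⟨_, _, _, isConvexClosedType_genCurve he hm hH' h0.le hd (by simp)
      (fun s hs => isHPoint_genCurve _ hm hH' (by linarith) hd hs)
      (fun s hs => not_differentiableAt_genCurve _ hm hH' (by linarith) hd (Or.inr h0.ne') hs)
      (contDiffOn_zero.2 (continuous_evenHeight hm d).continuousOn)⟩
  · exact isSingularAlong_closedCurve he hm hH' h0 hd
  · refine isPeriodicType_genCurve he hm hH' (by linarith) (Z := ∅) (fun s _ => ?_)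
      (fun s hs => absurd hs (Set.notMem_empty s)) (fun s hs => absurd hs (Set.notMem_empty s))
    rw [genCurve_of_le hm hH' hd]
    exact isHPoint_arc hm d s
  · exact isPeriodicType_genCurve he hm hH' hd
      (fun s hs => isHPoint_genCurve _ hm hH' h0.le (by linarith) hs)
      (fun s hs => not_differentiableAt_genCurve _ hm hH' h0 (by linarith) (Or.inl rfl) hs)
      (fun s hs => ⟨hs, (genCurve_fst_eq_zero_iff _ hm hH' h0.le (by linarith)).1 hs⟩)
  · exact isSingularAlong_periodicCurve he hm hH' h0 hd
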